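/- **Conventions.** Let $\epsilon: 1\to C\xrightarrow{\iota} G\xrightarrow{\pi} M\to 1$ be a short exact sequence of finite groups, $X$ a smooth manifold (Hausdorff, second countable, without boundary) of dimension $d$, and $p\colon E\to X$ a smooth complex vector bundle of rank $t$. For a smooth fibre bundle $q\colon L\to X$ let $\mathrm{Diff}_q(L)$ be the group of diffeomorphisms $\phi$ of $L$ covering a diffeomorphism $q_*\phi$ of $X$, i.e. $q\circ\phi=(q_*\phi)\circ q$ (and restricting to $\mathbb{C}$-linear maps on the fibres if $q$ is a complex vector bundle), $\mathrm{Diff}^{\mathrm{id}}_q(L)$ the subgroup of those covering $\mathrm{id}_X$, and $\mathrm{Diff}_q(X)$ the group of diffeomorphisms of $X$ covered by an element of $\mathrm{Diff}_q(L)$. A (smooth) *action* of $\epsilon$ on $q$ is a morphism $(\sigma,\rho,\tau)$ of short exact sequences from $\epsilon$ to $1\to \mathrm{Diff}^{\mathrm{id}}_q(L)\to \mathrm{Diff}_q(L)\xrightarrow{q_*}\mathrm{Diff}_q(X)\to 1$; it is *faithful* if $\sigma,\rho,\tau$ are all injective. For a smooth Hermitian metric $h$ on $p$, the Stiefel bundle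 $V_k(p,h)\colon V_k(E,h)\to X$ has as total space the set of $k$-tuples $(e_1,\dots,e_k)$ of vectors in a common fibre with $h(e_i,e_j)=\delta_{ij}$, with its smooth structure as an embedded submanifold of $E^k$ (of dimension $d+k(2t-k)$). The Grassmann bundle $\mathrm{Gr}_k(p)\colon \mathrm{Gr}_k(E)\to X$ has as total space the set of $k$-dimensional complex subspaces of the fibres, with the topology and smooth structure of the quotient of $V_k(E,h)$ under $(e_1,\dots,e_k)\mapsto\langle e_1,\dots,e_k\rangle$ (of dimension $d+2k(t-k)$). Let $\theta_X\colon X\times\mathbb{C}\to X$ be the trivial line bundle. **Proposition (Compactification).** Let $\beta=(\sigma,\rho,\tau)$ be a faithful action of $\epsilon$ on $p$. 1. There is a smooth $\rho$-invariant Hermitian metric on $p$. For every smooth $\rho$-invariant Hermitian metric $h$ on $p$ and every $1\le k\le t$, $V_k(p,h)$ is a smooth fibre bundle, and $\rho(g)\cdot(e_1,\dots,e_k)=(\rho(g)(e_1),\dots,\rho(g)(e_k))$ defines a faithful action of $\epsilon$ on $V_k(p,h)$ with the same action $\tau$ on $X$. 2. Let $\beta_1=(\sigma_1,\rho_1,\tau)$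 be the action of $\epsilon$ on $p\oplus\theta_X$ that is the direct sum of $\beta$ and of the action $g\cdot(x,z)=(\tau(\pi(g))(x),z)$ on $\theta_X$. There is a smooth $\rho_1$-invariant Hermitian metric on $p\oplus\theta_X$. For every $1\le k\le t+1$ (and whichever smooth Hermitian metric on $p\oplus\theta_X$ is used to define the smooth structure), $\mathrm{Gr}_k(p\oplus\theta_X)$ is a smooth fibre bundle, and $\rho(g)\cdot W=\rho_1(g)(W)$ defines an action of $\epsilon$ on $\mathrm{Gr}_k(p\oplus\theta_X)$ with the same action $\tau$ on $X$. This action is faithful if $1\le k\le t$; for $k=t+1$ it is faithful if and only if $C$ is trivial. -/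

import Mathlib

open Bundle Topology
open scoped Manifold ContDiff

/-!
### Diffeomorphism groups of fibre bundles and actions of group extensions
-/

section Diffeomorphisms

variable {EL HL L : Type*} [NormedAddCommGroup EL] [NormedSpace ℝ EL] [TopologicalSpace HL]
  [TopologicalSpace L] [ChartedSpace HL L]

/-- The group of `C^∞`-diffeomorphisms of a manifold `L`, as a subgroup of the permutations. -/
def diffGroup (IL : ModelWithCorners ℝ EL HL) (L : Type*) [TopologicalSpace L]
    [ChartedSpace HL L] : Subgroup (Equiv.Perm L) where
  carrier := {φ | ContMDiff IL IL ∞ φ ∧ ContMDiff IL IL ∞ φ.symm}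
  mul_mem' := fun ha hb => ⟨ha.1.comp hb.1, hb.2.comp ha.2⟩
  one_mem' := ⟨contMDiff_id, contMDiff_id⟩
  inv_mem' := fun h => ⟨h.2, h.1⟩

variable {EX HX X : Type*} [NormedAddCommGroup EX] [NormedSpace ℝ EX] [TopologicalSpace HX]
  [TopologicalSpace X] [ChartedSpace HX X]

/-- `Diff_p(L)` for a smooth fibre bundle `p : L → X`: the diffeomorphisms `φ` of `L` that cover
some diffeomorphism `ψ` of `X`, i.e. `p ∘ φ = ψ ∘ p`. -/
def bundleDiff (IL : ModelWithCorners ℝ EL HL) (IX : ModelWithCorners ℝ EX HX) (p : L → X) :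
    Subgroup (Equiv.Perm L) where
  carrier := {φ | φ ∈ diffGroup IL L ∧ ∃ ψ ∈ diffGroup IX X, ∀ z, p (φ z) = ψ (p z)}
  mul_mem' := by
    rintro a b ⟨ha, ψ, hψ, h⟩ ⟨hb, ψ', hψ', h'⟩
    exact ⟨mul_mem ha hb, ψ * ψ', mul_mem hψ hψ', fun z => by simp [h, h']⟩
  one_mem' := ⟨one_mem _, 1, one_mem _, fun _ => rfl⟩
  inv_mem' := by
    rintro a ⟨ha, ψ, hψ, h⟩
    refine ⟨inv_mem ha, ψ⁻¹, inv_mem hψ, fun z => ?_⟩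
    rw [Equiv.Perm.eq_inv_iff_eq, ← h]
    simp

/-- For a group `A` of automorphisms of `p : L → X` (such as `Diff_p(L)`), the subgroup `A^id` of
those that keep every fibre fixed (i.e. cover the identity of `X`), regarded inside the
permutations of `L`. -/
def fixingFibres (A : Subgroup (Equiv.Perm L)) (p : L → X) : Subgroup (Equiv.Perm L) where
  carrier := {φ | φ ∈ A ∧ ∀ z, p (φ z) = p z}
  mul_mem' := by
    rintro a b ⟨ha, h⟩ ⟨hb, h'⟩
    exact ⟨mul_mem ha hb, fun z => by simp [h, h']⟩
  one_mem' := ⟨one_mem _, fun _ => rfl⟩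
  inv_mem' := by
    rintro a ⟨ha, h⟩
    exact ⟨inv_mem ha, fun z => by rw [← h]; simp⟩

/-- For a group `A` of automorphisms of `p : L → X`, the group (`Diff_p(X)` when `A = Diff_p(L)`)
of the diffeomorphisms of the base `X` that are covered by an element of `A`. -/
def baseDiff (IX : ModelWithCorners ℝ EX HX) (A : Subgroup (Equiv.Perm L)) (p : L → X) :
    Subgroup (Equiv.Perm X) where
  carrier := {ψ | ψ ∈ diffGroup IX X ∧ ∃ φ ∈ A, ∀ z, p (φ z) = ψ (p z)}
  mul_mem' := by
    rintro a b ⟨ha, φ, hφ, h⟩ ⟨hb, φ', hφ', h'⟩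
    exact ⟨mul_mem ha hb, φ * φ', mul_mem hφ hφ', fun z => by simp [h, h']⟩
  one_mem' := ⟨one_mem _, 1, one_mem _, fun _ => rfl⟩
  inv_mem' := by
    rintro a ⟨ha, φ, hφ, h⟩
    refine ⟨inv_mem ha, φ⁻¹, inv_mem hφ, fun z => ?_⟩
    rw [Equiv.Perm.eq_inv_iff_eq, ← h]
    simp

/-- A morphism `(σ, ρ, τ)` of short exact sequences from `ε : 1 → C → G → M → 1` to
`1 → A^id → A → Diff_p(X) → 1`, where `A` is a group of automorphisms of `p : L → X`.
The field `comm_base` says that the map of `X` covered by `ρ g` is `τ (π g)`. -/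
structure ExtensionAction {C G M : Type*} [Group C] [Group G] [Group M]
    (ε : GroupExtension C G M) (IX : ModelWithCorners ℝ EX HX)
    (A : Subgroup (Equiv.Perm L)) (p : L → X) where
  σ : C →* fixingFibres A p
  ρ : G →* A
  τ : M →* baseDiff IX A p
  comm_fibre : ∀ c, (ρ (ε.inl c) : Equiv.Perm L) = (σ c : Equiv.Perm L)
  comm_base : ∀ g z, p ((ρ g : Equiv.Perm L) z) = (τ (ε.rightHom g) : Equiv.Perm X) (p z)

/-- The action is faithful if all three group homomorphisms are injective. -/
def ExtensionAction.Faithful {C G M : Type*} [Group C] [Group G] [Group M]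
    {ε : GroupExtension C G M} {IX : ModelWithCorners ℝ EX HX}
    {A : Subgroup (Equiv.Perm L)} {p : L → X} (α : ExtensionAction ε IX A p) : Prop :=
  Function.Injective α.σ ∧ Function.Injective α.ρ ∧ Function.Injective α.τ

end Diffeomorphisms

/-!
### Smooth manifolds without boundary and smooth fibre bundles
-/

/-- The atlas of `L` makes it a Hausdorff, second countable smooth manifold of dimension `m`. -/
structure IsSmoothManifold (m : ℕ) (L : Type*) [TopologicalSpace L]
    [ChartedSpace (EuclideanSpace ℝ (Fin m)) L] : Prop where
  t2 : T2Space L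
  secondCountable : SecondCountableTopology L
  isManifold : IsManifold (𝓡 m) ∞ L

/-- `p : L → X` is a smooth fibre bundle: for some smooth manifold `Y` (the fibre), every point
of `X` lies in an open `U ⊆ X` such that `p ⁻¹' U` is diffeomorphic to `U × Y` over `U`. -/
def IsSmoothFibreBundle (m d : ℕ) {L X : Type*}
    [TopologicalSpace L] [ChartedSpace (EuclideanSpace ℝ (Fin m)) L]
    [TopologicalSpace X] [ChartedSpace (EuclideanSpace ℝ (Fin d)) X] (p : L → X) : Prop :=
  ∃ (n : ℕ) (Y : Type) (_ : TopologicalSpace Y) (_ : ChartedSpace (EuclideanSpace ℝ (Fin n)) Y),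
    IsSmoothManifold n Y ∧ ∀ x : X, ∃ e : Trivialization Y p, x ∈ e.baseSet ∧
      ContMDiffOn (𝓡 m) ((𝓡 d).prod (𝓡 n)) ∞ e e.source ∧
      ContMDiffOn ((𝓡 d).prod (𝓡 n)) (𝓡 m) ∞ e.toOpenPartialHomeomorph.symm e.target

/-!
### Complex vector bundles: automorphisms, Hermitian metrics, Stiefel and Grassmann bundles

A smooth complex vector bundle with model fibre `F` is given by a family `E` of complex vector
spaces over `X`, as usual in Mathlib; smoothness is meant over `ℝ`.
-/

section VectorBundles

variable (d : ℕ) {X : Type*} [TopologicalSpace X] [ChartedSpace (EuclideanSpace ℝ (Fin d)) X]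
  (F : Type*) [NormedAddCommGroup F] [NormedSpace ℝ F]
  (E : X → Type*) [∀ x, AddCommGroup (E x)] [∀ x, Module ℂ (E x)]
  [TopologicalSpace (TotalSpace F E)] [∀ x, TopologicalSpace (E x)] [FiberBundle F E]

/-- `φ` maps each fibre to a fibre by a `ℂ`-linear map. -/
def IsFibrewiseLinear (φ : TotalSpace F E → TotalSpace F E) : Prop :=
  ∀ x : X, ∃ (y : X) (T : E x →ₗ[ℂ] E y), ∀ v : E x, φ ⟨x, v⟩ = ⟨y, T v⟩

/-- `Diff_p(E)` for a smooth complex vector bundle `p`: the diffeomorphisms of the total space that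
cover a diffeomorphism of the base and restrict to `ℂ`-linear maps on the fibres. -/
def vectorBundleDiff : Subgroup (Equiv.Perm (TotalSpace F E)) where
  carrier := {φ | φ ∈ bundleDiff ((𝓡 d).prod 𝓘(ℝ, F)) (𝓡 d) (TotalSpace.proj : TotalSpace F E → X)
    ∧ IsFibrewiseLinear F E φ}
  mul_mem' := by
    rintro a b ⟨ha, h⟩ ⟨hb, h'⟩
    refine ⟨mul_mem ha hb, fun x => ?_⟩
    obtain ⟨y, T, hT⟩ := h' x
    obtain ⟨z, S, hS⟩ := h y
    exact ⟨z, S ∘ₗ T, fun v => by simp [hT, hS]⟩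
  one_mem' := ⟨one_mem _, fun x => ⟨x, LinearMap.id, fun _ => rfl⟩⟩
  inv_mem' := by
    rintro a ⟨ha, h⟩
    refine ⟨inv_mem ha, fun x => ?_⟩
    obtain ⟨-, ψ, -, hψ⟩ := ha
    obtain ⟨y, T, hT⟩ := h (ψ⁻¹ x)
    obtain rfl : y = x := by
      have h0 := hψ ⟨ψ⁻¹ x, 0⟩
      rw [hT] at h0
      simpa using h0
    have hpre : ∀ v : E y, ∃ w : E (ψ⁻¹ y), a ⟨ψ⁻¹ y, w⟩ = ⟨y, v⟩ := by
      intro v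
      obtain ⟨⟨u, w⟩, hw⟩ := a.surjective ⟨y, v⟩
      obtain rfl : u = ψ⁻¹ y := by
        rw [Equiv.Perm.eq_inv_iff_eq, ← hψ ⟨u, w⟩, hw]
      exact ⟨w, hw⟩
    have hbij : Function.Bijective T := by
      constructor
      · intro v w hvw
        have : a ⟨ψ⁻¹ y, v⟩ = a ⟨ψ⁻¹ y, w⟩ := by rw [hT, hT, hvw]
        simpa using a.injective this
      · intro v
        obtain ⟨w, hw⟩ := hpre v
        rw [hT] at hw
        exact ⟨w, by simpa using hw⟩
    refine ⟨ψ⁻¹ y, (LinearEquiv.ofBijective T hbij).symm.toLinearMap, fun v => ?_⟩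
    rw [Equiv.Perm.inv_eq_iff_eq, hT]
    congr 1
    exact ((LinearEquiv.ofBijective T hbij).apply_symm_apply v).symm

/-- A smooth action of a group extension on a smooth complex vector bundle. -/
abbrev VectorBundleAction {C G M : Type*} [Group C] [Group G] [Group M]
    (ε : GroupExtension C G M) :=
  ExtensionAction ε (𝓡 d) (vectorBundleDiff d F E) (TotalSpace.proj : TotalSpace F E → X)

/-- A smooth action of a group extension on a smooth fibre bundle `p : L → X`. -/
abbrev FibreBundleAction {C G M : Type*} [Group C] [Group G] [Group M]
    (m : ℕ)
    (ε : GroupExtension C G M) {L : Type*} [TopologicalSpace L]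
    [ChartedSpace (EuclideanSpace ℝ (Fin m)) L] (p : L → X) :=
  ExtensionAction ε (𝓡 d) (bundleDiff (𝓡 m) (𝓡 d) p) p

/-- A smooth Hermitian metric: a positive definite Hermitian form on every fibre that depends
smoothly on pairs of vectors in the same fibre, i.e. is smooth on the total space of the fibre
product of the bundle with itself. -/
structure HermitianMetric where
  form : ∀ x, E x →ₗ⋆[ℂ] E x →ₗ[ℂ] ℂ
  conj_symm : ∀ x (v w : E x), starRingEnd ℂ (form x v w) = form x w v
  pos_def : ∀ x (v : E x), v ≠ 0 → 0 < (form x v v).re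
  smooth : ContMDiff ((𝓡 d).prod 𝓘(ℝ, F × F)) 𝓘(ℝ, ℂ) ∞
    (fun z : TotalSpace (F × F) (E ×ᵇ E) => form z.1 z.2.1 z.2.2)

variable {d F E}

/-- `h` is invariant under the action `β`. -/
def HermitianMetric.IsInvariant {C G M : Type*} [Group C] [Group G] [Group M]
    {ε : GroupExtension C G M} (h : HermitianMetric d F E)
    (β : VectorBundleAction d F E ε) : Prop :=
  ∀ (g : G) (x y : X) (v w : E x) (v' w' : E y),
    (β.ρ g).1 ⟨x, v⟩ = ⟨y, v'⟩ → (β.ρ g).1 ⟨x, w⟩ = ⟨y, w'⟩ →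
      h.form y v' w' = h.form x v w

/-- The total space of the associated Stiefel bundle: `k`-tuples of vectors in a common fibre that
are orthonormal for `h`. -/
structure StiefelBundle (h : HermitianMetric d F E) (k : ℕ) where
  base : X
  frame : Fin k → E base
  orthonormal : ∀ i j, h.form base (frame i) (frame j) = if i = j then 1 else 0

namespace StiefelBundle

variable {h : HermitianMetric d F E} {k : ℕ}

/-- The `i`-th vector of an orthonormal frame, as a point of the total space of the bundle. -/
def vec (i : Fin k) (e : StiefelBundle h k) : TotalSpace F E := ⟨e.base, e.frame i⟩

/-- The topology of a subspace of the `k`-fold product of the total space (for `k ≥ 1`). -/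
instance : TopologicalSpace (StiefelBundle h k) :=
  TopologicalSpace.induced (fun e i => e.vec i : StiefelBundle h k → Fin k → TotalSpace F E)
    inferInstance

theorem linearIndependent (e : StiefelBundle h k) : LinearIndependent ℂ e.frame := by
  rw [Fintype.linearIndependent_iff]
  intro c hc i
  have := congrArg (h.form e.base (e.frame i)) hc
  simpa [map_sum, e.orthonormal] using this

end StiefelBundle

/-- The total space of the associated Grassmann bundle: the `k`-dimensional complex linear
subspaces of the fibres. The metric `h` enters only into the definition of the topology. -/
structure GrassmannBundle (h : HermitianMetric d F E) (k : ℕ) where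
  base : X
  space : Submodule ℂ (E base)
  finrank_eq : Module.finrank ℂ space = k

/-- The linear subspace generated by an orthonormal frame. -/
def StiefelBundle.span {h : HermitianMetric d F E} {k : ℕ} (e : StiefelBundle h k) :
    GrassmannBundle h k where
  base := e.base
  space := Submodule.span ℂ (Set.range e.frame)
  finrank_eq := by simpa using finrank_span_eq_card e.linearIndependent

namespace GrassmannBundle

variable {h : HermitianMetric d F E} {k : ℕ}

/-- The quotient topology from the Stiefel bundle. -/
instance : TopologicalSpace (GrassmannBundle h k) :=
  TopologicalSpace.coinduced StiefelBundle.span inferInstance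

/-- The underlying set of vectors of a subspace of a fibre, inside the total space. -/
def vectors (W : GrassmannBundle h k) : Set (TotalSpace F E) :=
  (fun v : E W.base => (⟨W.base, v⟩ : TotalSpace F E)) '' W.space

end GrassmannBundle

/-- The atlas on the total space of the Stiefel bundle is its standard smooth structure: it is a
smooth manifold whose inclusion into the `k`-fold product of the total space of the vector bundle
is smooth with injective differentials. (As the topology is the subspace topology, the inclusion is
then a smooth embedding, which determines the smooth structure.) -/
structure IsStiefelManifold (m : ℕ) (h : HermitianMetric d F E) (k : ℕ)
    [ChartedSpace (EuclideanSpace ℝ (Fin m)) (StiefelBundle h k)] : Prop where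
  isSmoothManifold : IsSmoothManifold m (StiefelBundle h k)
  smooth_vec : ∀ i, ContMDiff (𝓡 m) ((𝓡 d).prod 𝓘(ℝ, F)) ∞
    (StiefelBundle.vec i : StiefelBundle h k → TotalSpace F E)
  immersion : ∀ (e : StiefelBundle h k) (u : TangentSpace (𝓡 m) e),
    (∀ i, mfderiv (𝓡 m) ((𝓡 d).prod 𝓘(ℝ, F))
      (StiefelBundle.vec i : StiefelBundle h k → TotalSpace F E) e u = 0) → u = 0

/-- The atlas on the total space of the Grassmann bundle is its standard smooth structure, as a
quotient of the Stiefel bundle: it is a smooth manifold and the (surjective) map taking an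
orthonormal frame to the subspace it generates is a smooth submersion. (This determines the smooth
structure.) -/
structure IsGrassmannManifold (m n : ℕ) (h : HermitianMetric d F E) (k : ℕ)
    [ChartedSpace (EuclideanSpace ℝ (Fin m)) (StiefelBundle h k)]
    [ChartedSpace (EuclideanSpace ℝ (Fin n)) (GrassmannBundle h k)] : Prop where
  isSmoothManifold : IsSmoothManifold n (GrassmannBundle h k)
  smooth_span : ContMDiff (𝓡 m) (𝓡 n) ∞ (StiefelBundle.span : StiefelBundle h k → _)
  submersion : ∀ e : StiefelBundle h k, Function.Surjective
    (mfderiv (𝓡 m) (𝓡 n) (StiefelBundle.span : StiefelBundle h k → GrassmannBundle h k) e)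

/-- The self-map `φ ⊕ id` of the direct sum of `E` and the trivial complex line bundle, where `id`
is the identity on the line coordinate. If `φ` covers `ψ`, then on the trivial line
bundle `X × ℂ` it is `(x, z) ↦ (ψ x, z)`. -/
def sumTrivialLine (φ : TotalSpace F E → TotalSpace F E) :
    TotalSpace (F × ℂ) (E ×ᵇ Trivial X ℂ) → TotalSpace (F × ℂ) (E ×ᵇ Trivial X ℂ) :=
  fun z => ⟨(φ ⟨z.1, z.2.1⟩).1, ((φ ⟨z.1, z.2.1⟩).2, z.2.2)⟩

end VectorBundles

/-! The guiding principle is that smoothness on the Stiefel and Grassmann bundles can always be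
tested on vectors of the underlying vector bundle.

Metrics: a partition of unity glues the standard forms of local trivializations
(`HermitianMetric.nonempty`), and averaging over the finite group `G` gives invariance
(`HermitianMetric.exists_isInvariant`). Smooth Gram–Schmidt then provides local unitary frames
(`HermitianMetric.exists_unitaryFrame`), in which an orthonormal `k`-frame becomes a matrix S with
S*S = 1, consisting of a square block B above an r × k block Z.

Charts: where det(1 + B) ≠ 0, a generalized Cayley transform identifies such matrices with pairs (a,
b), where a is skew-Hermitian and b is an arbitrary r × k matrix. With N = 1 + b*b - a it reads B =
2N⁻¹ - 1, Z = 2bN⁻¹; N is invertible because its Hermitian part 1 + b*b is positive definite.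
Completing a frame to an orthonormal basis gives a unitary frame in which B = 1, so these charts
cover. Where det B ≠ 0, a subspace is a graph, described by the slope ZB⁻¹, which does not depend on
the choice of basis. In both cases the total space is locally a product of `X` and a real vector
space, and `exists_chartedSpace_of_local_products` turns this into a manifold structure.

A map to the Stiefel bundle is then smooth once its vectors are
(`StiefelBundle.IsAdapted.contMDiffOn`), and a map to the Grassmann bundle once it has local smooth
frames (`GrassmannBundle.IsAdapted.contMDiffOn`). This yields the smoothness of the span map, of the
trivializations and of the group actions. The span map is a submersion because it has local sections
through every frame, and the Grassmann bundle is Hausdorff because orthogonal projections separate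
the subspaces of a fibre. For local triviality, a unitary frame identifies the fibres isometrically
with ℂ^(k+r), so that the model fibre is the same construction over a point.

Faithfulness: every vector is a multiple of the first member of some orthonormal frame, which
settles the Stiefel case. If k ≤ t, a line in the rank t + 1 bundle is the intersection of the
`k`-dimensional subspaces containing it (`GrassmannBundle.exists_eq_smul`). An element fixing all
subspaces thus sends (v, 1) to a multiple of itself; the coordinate 1 is preserved, so the factor is
1 and v is fixed. If k = t + 1, the Grassmann bundle has one point over each point of `X`, the
action factors through `M`, and its kernel is `C`. -/

set_option linter.unusedSectionVars false

/-! ### Smooth sections of a bundle along a map. -/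

section SectionsAlongMaps

variable {d : ℕ} {X : Type*} [TopologicalSpace X] [ChartedSpace (EuclideanSpace ℝ (Fin d)) X]
  {F : Type*} [NormedAddCommGroup F] [NormedSpace ℝ F]
  {E : X → Type*} [∀ x, AddCommGroup (E x)] [∀ x, Module ℂ (E x)]
  [TopologicalSpace (TotalSpace F E)] [∀ x, TopologicalSpace (E x)] [FiberBundle F E]
  {EP : Type*} [NormedAddCommGroup EP] [NormedSpace ℝ EP] {HP : Type*} [TopologicalSpace HP]
  {J : ModelWithCorners ℝ EP HP} {P : Type*} [TopologicalSpace P] [ChartedSpace HP P]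

variable (d F J) in
/-- `w` is a smooth section over `O` of the pullback of the bundle `E` along `f`. -/
def SmoothSec (f : P → X) (w : ∀ p, E (f p)) (O : Set P) : Prop :=
  ContMDiffOn J ((𝓡 d).prod 𝓘(ℝ, F)) ∞ (fun p => TotalSpace.mk' F (f p) (w p)) O

theorem SmoothSec.mono {f : P → X} {w : ∀ p, E (f p)} {O O' : Set P}
    (h : SmoothSec d F J f w O) (hO : O' ⊆ O) : SmoothSec d F J f w O' :=
  ContMDiffOn.mono h hO

theorem SmoothSec.base {f : P → X} {w : ∀ p, E (f p)} {O : Set P}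
    (h : SmoothSec d F J f w O) : ContMDiffOn J (𝓡 d) ∞ f O :=
  fun p hp => (contMDiffWithinAt_totalSpace.1 (h p hp)).1

theorem SmoothSec.congr {f : P → X} {w w' : ∀ p, E (f p)} {O : Set P}
    (h : SmoothSec d F J f w O) (hw : ∀ p ∈ O, w' p = w p) : SmoothSec d F J f w' O :=
  ContMDiffOn.congr h fun p hp => by rw [hw p hp]

theorem contMDiffWithinAt_complex_smul {V : Type*} [NormedAddCommGroup V] [NormedSpace ℝ V]
    [NormedSpace ℂ V] [IsScalarTower ℝ ℂ V] {c : P → ℂ} {v : P → V} {O : Set P} {p : P}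
    (hc : ContMDiffWithinAt J 𝓘(ℝ, ℂ) ∞ c O p) (hv : ContMDiffWithinAt J 𝓘(ℝ, V) ∞ v O p) :
    ContMDiffWithinAt J 𝓘(ℝ, V) ∞ (fun p => c p • v p) O p :=
  (contDiff_smul (𝕜 := ℝ) (𝕜' := ℂ) (F := V)).comp_contMDiffWithinAt (hc.prodMk_space hv)

theorem contMDiffWithinAt_complex_mul {c c' : P → ℂ} {O : Set P} {p : P}
    (hc : ContMDiffWithinAt J 𝓘(ℝ, ℂ) ∞ c O p) (hc' : ContMDiffWithinAt J 𝓘(ℝ, ℂ) ∞ c' O p) :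
    ContMDiffWithinAt J 𝓘(ℝ, ℂ) ∞ (fun p => c p * c' p) O p :=
  contMDiffWithinAt_complex_smul hc hc'

section Linear

variable [NormedSpace ℂ F] [IsScalarTower ℝ ℂ F] [VectorBundle ℂ F E]

/-- Smoothness at `p` is read in the trivialization around `f p`. It is linear over its base set,
and `f` stays in that set near `p`, so the operation becomes the one of `F`. The same argument
serves scalar multiples and the zero section. -/
theorem SmoothSec.add {f : P → X} {w w' : ∀ p, E (f p)} {O : Set P}
    (h : SmoothSec d F J f w O) (h' : SmoothSec d F J f w' O) :
    SmoothSec d F J f (fun p => w p + w' p) O := by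
  intro p hp
  have h1 := contMDiffWithinAt_totalSpace.1 (h p hp)
  have h2 := contMDiffWithinAt_totalSpace.1 (h' p hp)
  refine contMDiffWithinAt_totalSpace.2 ⟨h1.1, ?_⟩
  have key : ∀ q, f q ∈ (trivializationAt F E (f p)).baseSet →
      ((trivializationAt F E (f p)) (TotalSpace.mk' F (f q) (w q + w' q))).2
      = ((trivializationAt F E (f p)) (TotalSpace.mk' F (f q) (w q))).2
        + ((trivializationAt F E (f p)) (TotalSpace.mk' F (f q) (w' q))).2 := fun q hq =>
    ((trivializationAt F E (f p)).linear ℂ hq).map_add _ _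
  refine (h1.2.add h2.2).congr_of_eventuallyEq ?_ (key p (mem_baseSet_trivializationAt F E (f p)))
  filter_upwards [h1.1.continuousWithinAt.preimage_mem_nhdsWithin
    ((trivializationAt F E (f p)).open_baseSet.mem_nhds
      (mem_baseSet_trivializationAt F E (f p)))] with q hq using key q hq

theorem SmoothSec.smul {f : P → X} {c : P → ℂ} {w : ∀ p, E (f p)} {O : Set P}
    (hc : ContMDiffOn J 𝓘(ℝ, ℂ) ∞ c O) (h : SmoothSec d F J f w O) :
    SmoothSec d F J f (fun p => c p • w p) O := by
  intro p hp
  have h1 := contMDiffWithinAt_totalSpace.1 (h p hp)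
  refine contMDiffWithinAt_totalSpace.2 ⟨h1.1, ?_⟩
  have key : ∀ q, f q ∈ (trivializationAt F E (f p)).baseSet →
      ((trivializationAt F E (f p)) (TotalSpace.mk' F (f q) (c q • w q))).2
      = c q • ((trivializationAt F E (f p)) (TotalSpace.mk' F (f q) (w q))).2 := fun q hq =>
    ((trivializationAt F E (f p)).linear ℂ hq).map_smul _ _
  refine (contMDiffWithinAt_complex_smul (hc p hp) h1.2).congr_of_eventuallyEq ?_
    (key p (mem_baseSet_trivializationAt F E (f p)))
  filter_upwards [h1.1.continuousWithinAt.preimage_mem_nhdsWithin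
    ((trivializationAt F E (f p)).open_baseSet.mem_nhds
      (mem_baseSet_trivializationAt F E (f p)))] with q hq using key q hq

theorem SmoothSec.zero {f : P → X} {O : Set P} (hf : ContMDiffOn J (𝓡 d) ∞ f O) :
    SmoothSec d F J f (fun p => (0 : E (f p))) O := by
  intro p hp
  refine contMDiffWithinAt_totalSpace.2 ⟨hf p hp, ?_⟩
  have key : ∀ q, f q ∈ (trivializationAt F E (f p)).baseSet →
      ((trivializationAt F E (f p)) (TotalSpace.mk' F (f q) (0 : E (f q)))).2 = 0 := fun q hq =>
    ((trivializationAt F E (f p)).linear ℂ hq).map_zero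
  refine (contMDiffWithinAt_const (c := (0 : F))).congr_of_eventuallyEq ?_
    (key p (mem_baseSet_trivializationAt F E (f p)))
  filter_upwards [(hf p hp).continuousWithinAt.preimage_mem_nhdsWithin
    ((trivializationAt F E (f p)).open_baseSet.mem_nhds
      (mem_baseSet_trivializationAt F E (f p)))] with q hq using key q hq

theorem SmoothSec.sum {ι : Type*} (s : Finset ι) {f : P → X} {w : ι → ∀ p, E (f p)} {O : Set P}
    (hf : ContMDiffOn J (𝓡 d) ∞ f O) (h : ∀ i ∈ s, SmoothSec d F J f (w i) O) :
    SmoothSec d F J f (fun p => ∑ i ∈ s, w i p) O := by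
  classical
  induction s using Finset.induction_on with
  | empty => simpa using SmoothSec.zero hf
  | insert a s ha ih =>
    simp only [Finset.sum_insert ha]
    exact (h a (by simp)).add (ih fun i hi => h i (by simp [hi]))

end Linear

theorem SmoothSec.pair {F' : Type*} [NormedAddCommGroup F'] [NormedSpace ℝ F']
    {E' : X → Type*} [∀ x, AddCommGroup (E' x)]
    [TopologicalSpace (TotalSpace F' E')] [∀ x, TopologicalSpace (E' x)] [FiberBundle F' E']
    {f : P → X} {w : ∀ p, E (f p)} {w' : ∀ p, E' (f p)} {O : Set P}
    (h : SmoothSec d F J f w O) (h' : SmoothSec d F' J f w' O) :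
    SmoothSec d (F × F') J (E := E ×ᵇ E') f (fun p => (w p, w' p)) O := by
  intro p hp
  have h1 := contMDiffWithinAt_totalSpace.1 (h p hp)
  have h2 := contMDiffWithinAt_totalSpace.1 (h' p hp)
  exact contMDiffWithinAt_totalSpace.2 ⟨h1.1, h1.2.prodMk_space h2.2⟩

theorem SmoothSec.fst {F' : Type*} [NormedAddCommGroup F'] [NormedSpace ℝ F']
    {E' : X → Type*} [∀ x, AddCommGroup (E' x)]
    [TopologicalSpace (TotalSpace F' E')] [∀ x, TopologicalSpace (E' x)] [FiberBundle F' E']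
    {f : P → X} {w : ∀ p, (E ×ᵇ E') (f p)} {O : Set P}
    (h : SmoothSec d (F × F') J (E := E ×ᵇ E') f w O) :
    SmoothSec d F J f (fun p => (w p).1) O := by
  intro p hp
  have h1 := contMDiffWithinAt_totalSpace.1 (h p hp)
  exact contMDiffWithinAt_totalSpace.2 ⟨h1.1, contDiff_fst.comp_contMDiffWithinAt h1.2⟩

theorem SmoothSec.snd {F' : Type*} [NormedAddCommGroup F'] [NormedSpace ℝ F']
    {E' : X → Type*} [∀ x, AddCommGroup (E' x)]
    [TopologicalSpace (TotalSpace F' E')] [∀ x, TopologicalSpace (E' x)] [FiberBundle F' E']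
    {f : P → X} {w : ∀ p, (E ×ᵇ E') (f p)} {O : Set P}
    (h : SmoothSec d (F × F') J (E := E ×ᵇ E') f w O) :
    SmoothSec d F' J f (fun p => (w p).2) O := by
  intro p hp
  have h1 := contMDiffWithinAt_totalSpace.1 (h p hp)
  exact contMDiffWithinAt_totalSpace.2 ⟨h1.1,
    (contDiff_snd (E := F) (F := F')).comp_contMDiffWithinAt h1.2⟩

/-- Two sections along the same map form one section of the fibre product, which is where the
smoothness of a metric is formulated. -/
theorem HermitianMetric.contMDiffOn_form (h : HermitianMetric d F E)
    {f : P → X} {w w' : ∀ p, E (f p)} {O : Set P}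
    (hw : SmoothSec d F J f w O) (hw' : SmoothSec d F J f w' O) :
    ContMDiffOn J 𝓘(ℝ, ℂ) ∞ (fun p => h.form (f p) (w p) (w' p)) O :=
  h.smooth.comp_contMDiffOn (hw.pair hw')

theorem smoothSec_comp {EQ : Type*} [NormedAddCommGroup EQ] [NormedSpace ℝ EQ] {HQ : Type*}
    [TopologicalSpace HQ] {K : ModelWithCorners ℝ EQ HQ} {Q : Type*} [TopologicalSpace Q]
    [ChartedSpace HQ Q] {f : P → X} {w : ∀ p, E (f p)} {O : Set P} {O' : Set Q}
    (h : SmoothSec d F J f w O) {g : Q → P} (hg : ContMDiffOn K J ∞ g O')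
    (hO : Set.MapsTo g O' O) :
    SmoothSec d F K (fun q => f (g q)) (fun q => w (g q)) O' :=
  ContMDiffOn.comp (g := fun p => TotalSpace.mk' F (f p) (w p)) h hg hO

/-- The vectors with constant coordinates in a local trivialization form a smooth section. -/
theorem smoothSec_symm [∀ x, Module ℝ (E x)] [VectorBundle ℝ F E]
    [ContMDiffVectorBundle ∞ F E (𝓡 d)] (e : Trivialization F (π F E)) [MemTrivializationAtlas e]
    {f : P → X} {O : Set P} (hf : ContMDiffOn J (𝓡 d) ∞ f O) (hO : ∀ p ∈ O, f p ∈ e.baseSet)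
    {c : P → F} (hc : ContMDiffOn J 𝓘(ℝ, F) ∞ c O) :
    SmoothSec d F J f (fun p => e.symm (f p) (c p)) O := by
  have h1 : ContMDiffOn J ((𝓡 d).prod 𝓘(ℝ, F)) ∞
      (fun p => e.toOpenPartialHomeomorph.symm (f p, c p)) O :=
    (e.contMDiffOn_symm (IB := 𝓡 d) (n := ∞)).comp (hf.prodMk hc)
      (fun p hp => e.mem_target.2 (hO p hp))
  refine ContMDiffOn.congr h1 fun p hp => ?_
  exact e.mk_symm (hO p hp) (c p)

end SectionsAlongMaps

/-! ### Linear algebra of positive definite Hermitian forms. -/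

section HermitianForms

variable {V : Type*} [AddCommGroup V] [Module ℂ V] {f : V →ₗ⋆[ℂ] V →ₗ[ℂ] ℂ}

theorem linearIndependent_of_orthonormal_form {ι : Type*} {b : ι → V} [DecidableEq ι]
    (hb : ∀ i j, f (b i) (b j) = if i = j then 1 else 0) : LinearIndependent ℂ b := by
  rw [linearIndependent_iff']
  intro s c hc i hi
  have := congrArg (f (b i)) hc
  simpa [map_sum, hb, hi] using this

theorem eq_sum_of_orthonormal_form {ι : Type*} [Fintype ι] [DecidableEq ι] {b : ι → V}
    (hb : ∀ i j, f (b i) (b j) = if i = j then 1 else 0) {v : V}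
    (hv : v ∈ Submodule.span ℂ (Set.range b)) : v = ∑ j, f (b j) v • b j := by
  obtain ⟨c, rfl⟩ := (Submodule.mem_span_range_iff_exists_fun ℂ).1 hv
  refine Finset.sum_congr rfl fun i _ => ?_
  simp [map_sum, hb]

theorem span_eq_top_of_orthonormal_form {ι : Type*} [Fintype ι] [DecidableEq ι]
    [FiniteDimensional ℂ V] {b : ι → V}
    (hb : ∀ i j, f (b i) (b j) = if i = j then 1 else 0)
    (hcard : Module.finrank ℂ V = Fintype.card ι) : Submodule.span ℂ (Set.range b) = ⊤ :=
  (linearIndependent_of_orthonormal_form hb).span_eq_top_of_card_eq_finrank' hcard.symm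

/-- Only the values of `v` on `s` matter; `s = ∅` gives an arbitrary orthonormal basis, and larger
`s` prescribe part of it. -/
theorem exists_orthonormal_extension_form (hsymm : ∀ v w, starRingEnd ℂ (f v w) = f w v)
    (hpos : ∀ v, v ≠ 0 → 0 < (f v v).re) [FiniteDimensional ℂ V]
    {ι : Type*} [Fintype ι] [DecidableEq ι] (hcard : Module.finrank ℂ V = Fintype.card ι)
    (s : Set ι) (v : ι → V)
    (hv : ∀ i ∈ s, ∀ j ∈ s, f (v i) (v j) = if i = j then 1 else 0) :
    ∃ b : ι → V, (∀ i j, f (b i) (b j) = if i = j then 1 else 0) ∧ ∀ i ∈ s, b i = v i := by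
  -- The form is made into an inner product locally, so that the extension theorem for orthonormal
  -- families applies.
  let core : InnerProductSpace.Core ℂ V :=
    { inner := fun v w => f v w
      conj_inner_symm := fun v w => hsymm w v
      re_inner_nonneg := fun v => by
        by_cases h : v = 0
        · simp [h]
        · exact (hpos v h).le
      add_left := fun u v w => by simp
      smul_left := fun u v c => by simp
      definite := fun v h => by
        by_contra h0
        have := hpos v h0
        change f v v = 0 at h
        simp [h] at this }
  let _ : NormedAddCommGroup V := core.toNormedAddCommGroup
  let _ : InnerProductSpace ℂ V := InnerProductSpace.ofCore core.toCore
  have hin : ∀ v w : V, inner ℂ v w = f v w := fun _ _ => rfl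
  have ho : Orthonormal ℂ (s.domRestrict v) := by
    rw [orthonormal_iff_ite]
    rintro ⟨i, hi⟩ ⟨j, hj⟩
    simp [Set.domRestrict, hin, hv i hi j hj]
  obtain ⟨b, hb⟩ := ho.exists_orthonormalBasis_extension_of_card_eq hcard
  refine ⟨b, fun i j => ?_, hb⟩
  rw [← hin, orthonormal_iff_ite.1 b.orthonormal]

end HermitianForms

/-! ### Gram–Schmidt for smooth sections and local unitary frames. -/

section Frames

variable {d : ℕ} {X : Type*} [TopologicalSpace X] [ChartedSpace (EuclideanSpace ℝ (Fin d)) X]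
  {F : Type*} [NormedAddCommGroup F] [NormedSpace ℝ F]
  {E : X → Type*} [∀ x, AddCommGroup (E x)] [∀ x, Module ℂ (E x)]
  [TopologicalSpace (TotalSpace F E)] [∀ x, TopologicalSpace (E x)] [FiberBundle F E]
  {EP : Type*} [NormedAddCommGroup EP] [NormedSpace ℝ EP] {HP : Type*} [TopologicalSpace HP]
  {J : ModelWithCorners ℝ EP HP} {P : Type*} [TopologicalSpace P] [ChartedSpace HP P]

theorem HermitianMetric.form_self_eq_ofReal (h : HermitianMetric d F E) {x : X} (v : E x) :
    h.form x v v = ((h.form x v v).re : ℂ) :=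
  (Complex.conj_eq_iff_re.1 (h.conj_symm x v v)).symm

theorem contDiffAt_inv_sqrt {t : ℝ} (ht : 0 < t) :
    ContDiffAt ℝ ∞ (fun t : ℝ => (((Real.sqrt t)⁻¹ : ℝ) : ℂ)) t :=
  Complex.ofRealCLM.contDiff.contDiffAt.comp t
    ((contDiffAt_inv ℝ (Real.sqrt_pos.2 ht).ne').comp t (Real.contDiffAt_sqrt ht.ne'))

variable [NormedSpace ℂ F] [IsScalarTower ℝ ℂ F] [VectorBundle ℂ F E]

/-- Gram–Schmidt orthonormalization of smooth sections that are linearly independent at a point. -/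
theorem HermitianMetric.exists_gramSchmidt (h : HermitianMetric d F E) {ι : Type*} [Finite ι]
    [DecidableEq ι] {f : P → X} {w : ι → ∀ p, E (f p)} {O : Set P} (hO : IsOpen O) {p₀ : P}
    (hp₀ : p₀ ∈ O) (hf : ContMDiffOn J (𝓡 d) ∞ f O) (hw : ∀ i, SmoothSec d F J f (w i) O)
    (hli : LinearIndependent ℂ (fun i => w i p₀)) :
    ∃ O' ⊆ O, IsOpen O' ∧ p₀ ∈ O' ∧ ∃ s : ι → ∀ p, E (f p),
      (∀ i, SmoothSec d F J f (s i) O') ∧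
      (∀ p ∈ O', ∀ i j, h.form (f p) (s i p) (s j p) = if i = j then 1 else 0) ∧
      (∀ p ∈ O', ∀ i, s i p ∈ Submodule.span ℂ (Set.range fun i => w i p)) ∧
      ((∀ i j, h.form (f p₀) (w i p₀) (w j p₀) = if i = j then 1 else 0) →
        ∀ i, s i p₀ = w i p₀) := by
  have := Fintype.ofFinite ι
  -- Induction on the set `T` of indices already treated; the neighbourhood shrinks at each step.
  suffices H : ∀ T : Finset ι, ∃ O' ⊆ O, IsOpen O' ∧ p₀ ∈ O' ∧ ∃ s : ι → ∀ p, E (f p),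
      (∀ i ∈ T, SmoothSec d F J f (s i) O') ∧
      (∀ p ∈ O', ∀ i ∈ T, ∀ j ∈ T, h.form (f p) (s i p) (s j p) = if i = j then 1 else 0) ∧
      (∀ p ∈ O', ∀ i ∈ T, s i p ∈ Submodule.span ℂ ((fun i => w i p) '' T)) ∧
      ((∀ i j, h.form (f p₀) (w i p₀) (w j p₀) = if i = j then 1 else 0) →
        ∀ i ∈ T, s i p₀ = w i p₀) by
    obtain ⟨O', hO', ho, hp, s, h1, h2, h3, h4⟩ := H Finset.univ
    exact ⟨O', hO', ho, hp, s, fun i => h1 i (Finset.mem_univ _),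
      fun p hp i j => h2 p hp i (Finset.mem_univ _) j (Finset.mem_univ _),
      fun p hp i => by simpa using h3 p hp i (Finset.mem_univ _),
      fun hh i => h4 hh i (Finset.mem_univ _)⟩
  intro T
  induction T using Finset.induction_on with
  | empty => exact ⟨O, subset_rfl, hO, hp₀, w, by simp, by simp, by simp, by simp⟩
  | insert a T ha ih =>
    obtain ⟨O', hO', ho, hp, s, h1, h2, h3, h4⟩ := ih
    let u : ∀ p, E (f p) := fun p => w a p + ∑ i ∈ T, (-h.form (f p) (s i p) (w a p)) • s i p
    have hu : SmoothSec d F J f u O' := by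
      refine ((hw a).mono hO').add (SmoothSec.sum T (hf.mono hO') fun i hi => ?_)
      exact SmoothSec.smul (h.contMDiffOn_form (h1 i hi) ((hw a).mono hO')).neg (h1 i hi)
    have hsu : ∀ p ∈ O', ∀ i ∈ T, h.form (f p) (s i p) (u p) = 0 := by
      intro p hp i hi
      simp only [u, map_add, map_sum, map_smul, smul_eq_mul]
      rw [Finset.sum_eq_single i]
      · simp [h2 p hp i hi i hi]
      · intro j hj hji
        simp [h2 p hp i hi j hj, hji.symm]
      · exact fun hni => (hni hi).elim
    have hus : ∀ p ∈ O', ∀ i ∈ T, h.form (f p) (u p) (s i p) = 0 := fun p hp i hi => by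
      rw [← h.conj_symm, hsu p hp i hi, map_zero]
    -- Otherwise `w a p₀` would be a combination of the `s i p₀`, hence of the `w i p₀` with `i ∈
    -- T`, against linear independence. Independence at `p₀` suffices, since the new neighbourhood
    -- is cut out by `N > 0`.
    have hu0 : u p₀ ≠ 0 := by
      intro h0
      have hmem : w a p₀ ∈ Submodule.span ℂ ((fun i => w i p₀) '' T) := by
        have hsum : ∑ i ∈ T, (-h.form (f p₀) (s i p₀) (w a p₀)) • s i p₀ ∈
            Submodule.span ℂ ((fun i => w i p₀) '' T) :=
          Submodule.sum_mem _ fun i hi => Submodule.smul_mem _ _ (h3 p₀ hp i hi)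
        rw [eq_neg_of_add_eq_zero_left h0]
        exact Submodule.neg_mem _ hsum
      exact hli.notMem_span_image (s := (T : Set ι)) (x := a) (by simpa using ha) hmem
    let N : P → ℝ := fun p => (h.form (f p) (u p) (u p)).re
    have hN : ContMDiffOn J 𝓘(ℝ, ℝ) ∞ N O' := fun p hp =>
      Complex.reCLM.contDiff.comp_contMDiffWithinAt (h.contMDiffOn_form hu hu p hp)
    have hsqrt : ∀ p, 0 < N p → h.form (f p) (u p) (u p) = (Real.sqrt (N p) : ℂ) ^ 2 := by
      intro p hp
      rw [h.form_self_eq_ofReal, ← Complex.ofReal_pow, Real.sq_sqrt hp.le]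
    let s' : ι → ∀ p, E (f p) := fun i p =>
      if i = a then (((Real.sqrt (N p))⁻¹ : ℝ) : ℂ) • u p else s i p
    have hs'a : ∀ p, s' a p = (((Real.sqrt (N p))⁻¹ : ℝ) : ℂ) • u p := fun p => by simp [s']
    have hs'T : ∀ i ∈ T, s' i = s i := fun i hi => by
      have : i ≠ a := fun e => ha (e ▸ hi)
      funext p
      simp [s', this]
    refine ⟨O' ∩ N ⁻¹' Set.Ioi 0, Set.inter_subset_left.trans hO',
      hN.continuousOn.isOpen_inter_preimage ho isOpen_Ioi, ⟨hp, h.pos_def _ _ hu0⟩, s',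
      ?_, ?_, ?_, ?_⟩
    · intro i hi
      rcases Finset.mem_insert.1 hi with rfl | hi
      · have : SmoothSec d F J f (fun p => (((Real.sqrt (N p))⁻¹ : ℝ) : ℂ) • u p)
            (O' ∩ N ⁻¹' Set.Ioi 0) :=
          SmoothSec.smul (fun p hp => (contDiffAt_inv_sqrt hp.2).comp_contMDiffWithinAt
            ((hN p hp.1).mono Set.inter_subset_left)) (hu.mono Set.inter_subset_left)
        exact this.congr fun p _ => hs'a p
      · rw [hs'T i hi]
        exact (h1 i hi).mono Set.inter_subset_left
    · rintro p ⟨hp, hNp⟩ i hi j hj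
      have hne : (Real.sqrt (N p) : ℂ) ≠ 0 := by
        exact_mod_cast (Real.sqrt_pos.2 hNp).ne'
      rcases Finset.mem_insert.1 hi with hia | hi' <;>
        rcases Finset.mem_insert.1 hj with hja | hj'
      · rw [hia, hja, hs'a]
        simp only [map_smulₛₗ, LinearMap.smul_apply, hsqrt p hNp]
        simp
        field_simp
      · have : a ≠ j := fun e => ha (e ▸ hj')
        rw [hia, hs'a, hs'T j hj']
        simp [hus p hp j hj', this]
      · have : i ≠ a := fun e => ha (e ▸ hi')
        rw [hja, hs'a, hs'T i hi']
        simp [hsu p hp i hi', this]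
      · rw [hs'T i hi', hs'T j hj']
        exact h2 p hp i hi' j hj'
    · rintro p ⟨hp, hNp⟩ i hi
      have hsub : ∀ i ∈ T, s i p ∈ Submodule.span ℂ ((fun i => w i p) '' (insert a T : Finset ι)) :=
        fun i hi => Submodule.span_mono (Set.image_mono (by simp)) (h3 p hp i hi)
      rcases Finset.mem_insert.1 hi with rfl | hi
      · rw [hs'a]
        refine Submodule.smul_mem _ _ (Submodule.add_mem _ (Submodule.subset_span ?_)
          (Submodule.sum_mem _ fun j hj => Submodule.smul_mem _ _ (hsub j hj)))
        exact ⟨i, by simp, rfl⟩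
      · rw [hs'T i hi]
        exact hsub i hi
    -- If the vectors are orthonormal at `p₀`, the projections subtracted there vanish and `N p₀ =
    -- 1`, so nothing changes.
    · intro hort i hi
      rcases Finset.mem_insert.1 hi with rfl | hi
      · have hu' : u p₀ = w i p₀ := by
          simp only [u]
          rw [Finset.sum_eq_zero, add_zero]
          intro j hj
          have : j ≠ i := fun e => ha (e ▸ hj)
          simp [h4 hort j hj, hort, this]
        rw [hs'a]
        simp [N, hu', hort]
      · rw [hs'T i hi]
        exact h4 hort i hi

theorem finiteDimensional_fibre [FiniteDimensional ℂ F] (x : X) : FiniteDimensional ℂ (E x) :=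
  LinearEquiv.finiteDimensional ((trivializationAt F E x).continuousLinearEquivAt ℂ x
    (mem_baseSet_trivializationAt F E x)).toLinearEquiv.symm

variable (F E) in
theorem finrank_fibre (x : X) : Module.finrank ℂ (E x) = Module.finrank ℂ F :=
  LinearEquiv.finrank_eq ((trivializationAt F E x).continuousLinearEquivAt ℂ x
    (mem_baseSet_trivializationAt F E x)).toLinearEquiv

/-- A family of orthonormal bases of the fibres that is smooth over the open set `dom`. -/
structure UnitaryFrame (h : HermitianMetric d F E) (ι : Type) [Fintype ι] [DecidableEq ι] where
  dom : Set X
  isOpen_dom : IsOpen dom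
  vec : ι → ∀ x, E x
  smooth : ∀ i, SmoothSec d F (𝓡 d) (fun x => x) (vec i) dom
  orthonormal : ∀ x i j, h.form x (vec i x) (vec j x) = if i = j then 1 else 0
  repr : ∀ x (v : E x), v = ∑ j, h.form x (vec j x) v • vec j x

theorem HermitianMetric.exists_orthonormal_extension [FiniteDimensional ℂ F]
    (h : HermitianMetric d F E) (x : X) {ι : Type} [Fintype ι] [DecidableEq ι]
    (hcard : Module.finrank ℂ F = Fintype.card ι) (s : Set ι) (v : ι → E x)
    (hv : ∀ i ∈ s, ∀ j ∈ s, h.form x (v i) (v j) = if i = j then 1 else 0) :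
    ∃ b : ι → E x, (∀ i j, h.form x (b i) (b j) = if i = j then 1 else 0) ∧ ∀ i ∈ s, b i = v i :=
  have := finiteDimensional_fibre (F := F) (E := E) x
  exists_orthonormal_extension_form (h.conj_symm x) (h.pos_def x)
    ((finrank_fibre F E x).trans hcard) s v hv

theorem HermitianMetric.repr_of_orthonormal [FiniteDimensional ℂ F]
    (h : HermitianMetric d F E) (x : X) {ι : Type} [Fintype ι] [DecidableEq ι]
    (hcard : Module.finrank ℂ F = Fintype.card ι) {b : ι → E x}
    (hb : ∀ i j, h.form x (b i) (b j) = if i = j then 1 else 0) (v : E x) :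
    v = ∑ j, h.form x (b j) v • b j := by
  have := finiteDimensional_fibre (F := F) (E := E) x
  apply eq_sum_of_orthonormal_form hb
  rw [span_eq_top_of_orthonormal_form hb ((finrank_fibre F E x).trans hcard)]
  trivial

/-- Every orthonormal basis of a fibre extends to a local smooth orthonormal frame. -/
theorem HermitianMetric.exists_unitaryFrame [FiniteDimensional ℂ F] [∀ x, Module ℝ (E x)]
    [VectorBundle ℝ F E] [ContMDiffVectorBundle ∞ F E (𝓡 d)] (h : HermitianMetric d F E)
    {ι : Type} [Fintype ι] [DecidableEq ι] (hcard : Module.finrank ℂ F = Fintype.card ι)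
    (x₀ : X) (b : ι → E x₀) (hb : ∀ i j, h.form x₀ (b i) (b j) = if i = j then 1 else 0) :
    ∃ u : UnitaryFrame h ι, x₀ ∈ u.dom ∧ ∀ i, u.vec i x₀ = b i := by
  classical
  let e := trivializationAt F E x₀
  have hx₀ : x₀ ∈ e.baseSet := mem_baseSet_trivializationAt F E x₀
  -- The basis at `x₀` is spread out with constant coordinates and then orthonormalized;
  -- Gram–Schmidt does not alter it at `x₀`.
  have hw : ∀ i, SmoothSec d F (𝓡 d) (fun x => x) (fun x => e.symm x (e ⟨x₀, b i⟩).2) e.baseSet :=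
    fun i => smoothSec_symm e contMDiffOn_id (fun _ => id) contMDiffOn_const
  have hw0 : ∀ i, e.symm x₀ (e ⟨x₀, b i⟩).2 = b i := fun i => e.symm_apply_apply_mk hx₀ (b i)
  obtain ⟨O, hO, ho, hx, s, h1, h2, h3, h4⟩ := h.exists_gramSchmidt (f := fun x : X => x)
    e.open_baseSet hx₀
    contMDiffOn_id hw (by
      simp only [hw0]
      exact linearIndependent_of_orthonormal_form hb)
  -- A `UnitaryFrame` is orthonormal at every point and smooth only over `dom`; outside `O` any
  -- orthonormal bases will do.
  have hex : ∀ x, ∃ c : ι → E x, ∀ i j, h.form x (c i) (c j) = if i = j then 1 else 0 := fun x => by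
    obtain ⟨c, hc, -⟩ := h.exists_orthonormal_extension x hcard ∅ (fun _ => 0) (by simp)
    exact ⟨c, hc⟩
  choose c hc using hex
  have hort : ∀ x i j, h.form x (if x ∈ O then s i x else c x i) (if x ∈ O then s j x else c x j)
      = if i = j then 1 else 0 := by
    intro x i j
    by_cases hx : x ∈ O
    · simpa only [if_pos hx] using h2 x hx i j
    · simpa only [if_neg hx] using hc x i j
  refine ⟨⟨O, ho, fun i x => if x ∈ O then s i x else c x i, fun i => (h1 i).congr fun x hx => by
    simp [hx], hort, fun x v => h.repr_of_orthonormal x hcard (hort x) v⟩, hx, fun i => ?_⟩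
  simp only [if_pos hx]
  rw [h4 (by simpa only [hw0] using hb), hw0]

end Frames

/-! ### Manifold structures from local products with an open part of the base. -/

section LocalProducts

variable {d : ℕ} {X : Type*} [TopologicalSpace X] [ChartedSpace (EuclideanSpace ℝ (Fin d)) X]
  [IsManifold (𝓡 d) ∞ X] {V : Type*} [NormedAddCommGroup V] [NormedSpace ℝ V]

/-- The chart of `X × V` given by a chart of `X` and a linear isomorphism. -/
noncomputable def productChart {m : ℕ}
    (T : (EuclideanSpace ℝ (Fin d) × V) ≃L[ℝ] EuclideanSpace ℝ (Fin m)) (x : X) :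
    OpenPartialHomeomorph (X × V) (EuclideanSpace ℝ (Fin m)) :=
  ((chartAt (EuclideanSpace ℝ (Fin d)) x).prod (OpenPartialHomeomorph.refl V)).trans
    T.toHomeomorph.toOpenPartialHomeomorph

variable {m : ℕ} (T : (EuclideanSpace ℝ (Fin d) × V) ≃L[ℝ] EuclideanSpace ℝ (Fin m))

theorem mem_productChart_source {x : X} {z : X × V} :
    z ∈ (productChart T x).source ↔ z.1 ∈ (chartAt (EuclideanSpace ℝ (Fin d)) x).source := by
  simp [productChart]

theorem contMDiffOn_productChart (x : X) :
    ContMDiffOn ((𝓡 d).prod 𝓘(ℝ, V)) (𝓡 m) ∞ (productChart T x) (productChart T x).source := by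
  have h1 : ContMDiffOn ((𝓡 d).prod 𝓘(ℝ, V)) 𝓘(ℝ, EuclideanSpace ℝ (Fin d) × V) ∞
      (fun z : X × V => (chartAt (EuclideanSpace ℝ (Fin d)) x z.1, z.2))
      (productChart T x).source :=
    ((contMDiffOn_chart (I := 𝓡 d) (n := ∞) (x := x)).comp contMDiffOn_fst
      (fun z hz => (mem_productChart_source T).1 hz)).prodMk_space contMDiffOn_snd
  exact (T.contDiff (n := ∞)).contMDiff.comp_contMDiffOn h1

theorem contMDiffOn_productChart_symm (x : X) :
    ContMDiffOn (𝓡 m) ((𝓡 d).prod 𝓘(ℝ, V)) ∞ (productChart T x).symm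
      (productChart T x).target := by
  have h0 : ContMDiff (𝓡 m) 𝓘(ℝ, EuclideanSpace ℝ (Fin d) × V) ∞ T.symm :=
    T.symm.contDiff.contMDiff
  have h1 : ContMDiff (𝓡 m) (𝓡 d) ∞ (fun z => (T.symm z).1) :=
    contDiff_fst.comp_contMDiff h0
  have h2 : ContMDiff (𝓡 m) 𝓘(ℝ, V) ∞ (fun z => (T.symm z).2) :=
    contDiff_snd.comp_contMDiff h0
  refine ((contMDiffOn_chart_symm (I := 𝓡 d) (n := ∞) (x := x)).comp h1.contMDiffOn ?_).prodMk
    h2.contMDiffOn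
  intro z hz
  simpa [productChart] using hz

/-- A topological space that is locally homeomorphic to `X × V`, with smooth transition maps, is a
smooth manifold. -/
theorem exists_chartedSpace_of_local_products [FiniteDimensional ℝ V] {L : Type*}
    [TopologicalSpace L] {ι : Type*} (Λ : ι → OpenPartialHomeomorph L (X × V))
    (hcover : ∀ z, ∃ i, z ∈ (Λ i).source)
    (hcompat : ∀ i j, ContMDiffOn ((𝓡 d).prod 𝓘(ℝ, V)) ((𝓡 d).prod 𝓘(ℝ, V)) ∞
      (fun z => Λ j ((Λ i).symm z)) ((Λ i).target ∩ (Λ i).symm ⁻¹' (Λ j).source))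
    (hm : d + Module.finrank ℝ V = m) :
    ∃ _ : ChartedSpace (EuclideanSpace ℝ (Fin m)) L, IsManifold (𝓡 m) ∞ L ∧
      ∀ i, ContMDiffOn (𝓡 m) ((𝓡 d).prod 𝓘(ℝ, V)) ∞ (Λ i) (Λ i).source ∧
        ContMDiffOn ((𝓡 d).prod 𝓘(ℝ, V)) (𝓡 m) ∞ (Λ i).symm (Λ i).target := by
  have T : (EuclideanSpace ℝ (Fin d) × V) ≃L[ℝ] EuclideanSpace ℝ (Fin m) :=
    ContinuousLinearEquiv.ofFinrankEq (by simp [hm])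
  choose idx hidx using hcover
  -- Each local product is composed with every chart of `X`, so the atlas is indexed by pairs.
  let c : ι × X → OpenPartialHomeomorph L (EuclideanSpace ℝ (Fin m)) :=
    fun p => (Λ p.1).trans (productChart T p.2)
  have hc : ∀ i z, z ∈ (Λ i).source → z ∈ (c (i, (Λ i z).1)).source := fun i z hz => by
    simp only [c, OpenPartialHomeomorph.trans_source]
    exact ⟨hz, (mem_productChart_source T).2 (mem_chart_source _ _)⟩
  let cs : ChartedSpace (EuclideanSpace ℝ (Fin m)) L :=
    { atlas := Set.range c
      chartAt := fun z => c (idx z, (Λ (idx z) z).1)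
      mem_chart_source := fun z => hc _ z (hidx z)
      chart_mem_atlas := fun z => ⟨_, rfl⟩ }
  have hM : IsManifold (𝓡 m) ∞ L := by
    apply isManifold_of_contDiffOn
    rintro _ _ ⟨⟨i, x⟩, rfl⟩ ⟨⟨j, y⟩, rfl⟩
    rw [← contMDiffOn_iff_contDiffOn]
    have key : ContMDiffOn (𝓡 m) (𝓡 m) ∞
        (fun z => productChart T y (Λ j ((Λ i).symm ((productChart T x).symm z))))
        ((c (i, x)).symm.trans (c (j, y))).source := by
      refine (contMDiffOn_productChart T y).comp ((hcompat i j).comp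
        ((contMDiffOn_productChart_symm T x).mono ?_) ?_) ?_
      · intro z hz
        exact hz.1.1
      · intro z hz
        exact ⟨hz.1.2, hz.2.1⟩
      · intro z hz
        exact hz.2.2
    refine key.mono ?_
    rintro z ⟨hz, -⟩
    exact hz
  refine ⟨cs, hM, fun i => ⟨fun z hz => ContMDiffAt.contMDiffWithinAt ?_,
    fun w hw => ContMDiffAt.contMDiffWithinAt ?_⟩⟩
  -- Near `z`, `Λ i` is the chart `e` followed by the inverse of a product chart, and both are
  -- smooth.
  · have hz' := hc i z hz
    set e := c (i, (Λ i z).1) with he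
    have hmem : e ∈ IsManifold.maximalAtlas (𝓡 m) ∞ L :=
      IsManifold.subset_maximalAtlas (Set.mem_range_self _)
    have h1 : ContMDiffAt (𝓡 m) (𝓡 m) ∞ e z :=
      (contMDiffOn_of_mem_maximalAtlas hmem).contMDiffAt
        (e.open_source.mem_nhds hz')
    have h2 : ContMDiffAt (𝓡 m) ((𝓡 d).prod 𝓘(ℝ, V)) ∞ (productChart T (Λ i z).1).symm (e z) :=
      (contMDiffOn_productChart_symm T _).contMDiffAt
        ((productChart T _).open_target.mem_nhds ((productChart T _).map_source hz'.2))
    refine (h2.comp z h1).congr_of_eventuallyEq ?_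
    filter_upwards [e.open_source.mem_nhds hz'] with y hy
    exact ((productChart T _).left_inv hy.2).symm
  · have hz := (Λ i).map_target hw
    have hz' := hc i _ hz
    rw [(Λ i).right_inv hw] at hz'
    set e := c (i, w.1) with he
    have hmem : e ∈ IsManifold.maximalAtlas (𝓡 m) ∞ L :=
      IsManifold.subset_maximalAtlas (Set.mem_range_self _)
    have hwm : w ∈ (productChart T w.1).source :=
      (mem_productChart_source T).2 (mem_chart_source _ _)
    have hwe : productChart T w.1 w ∈ e.target := by
      have := e.map_source hz'
      simpa [e, c, (Λ i).right_inv hw] using this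
    have h1 : ContMDiffAt (𝓡 m) (𝓡 m) ∞ e.symm (productChart T w.1 w) :=
      (contMDiffOn_symm_of_mem_maximalAtlas hmem).contMDiffAt
        (e.open_target.mem_nhds hwe)
    have h2 : ContMDiffAt ((𝓡 d).prod 𝓘(ℝ, V)) (𝓡 m) ∞ (productChart T w.1) w :=
      (contMDiffOn_productChart T _).contMDiffAt ((productChart T _).open_source.mem_nhds hwm)
    refine (h1.comp w h2).congr_of_eventuallyEq ?_
    filter_upwards [(productChart T w.1).open_source.mem_nhds hwm] with y hy
    simp [e, c, (productChart T w.1).left_inv hy]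

end LocalProducts

/-! ### Matrices with smooth entries. -/

section SmoothMatrices

variable {W : Type*} [NormedAddCommGroup W] [NormedSpace ℝ W] {O : Set W}
  {a b c : Type*} [Fintype a] [Fintype b] [Fintype c] [DecidableEq a] [DecidableEq b]

/-- The entries of `S` are smooth functions. -/
def SmoothEntries (S : W → Matrix a b ℂ) (O : Set W) : Prop :=
  ∀ i j, ContDiffOn ℝ ∞ (fun w => S w i j) O

theorem SmoothEntries.add {S T : W → Matrix a b ℂ} (hS : SmoothEntries S O)
    (hT : SmoothEntries T O) : SmoothEntries (fun w => S w + T w) O :=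
  fun i j => (hS i j).add (hT i j)

theorem SmoothEntries.sub {S T : W → Matrix a b ℂ} (hS : SmoothEntries S O)
    (hT : SmoothEntries T O) : SmoothEntries (fun w => S w - T w) O :=
  fun i j => (hS i j).sub (hT i j)

theorem SmoothEntries.const (S : Matrix a b ℂ) : SmoothEntries (fun _ : W => S) O :=
  fun _ _ => contDiffOn_const

theorem SmoothEntries.smul (z : ℂ) {S : W → Matrix a b ℂ} (hS : SmoothEntries S O) :
    SmoothEntries (fun w => z • S w) O :=
  fun i j => contDiffOn_const.mul (hS i j)

theorem SmoothEntries.mul {S : W → Matrix a b ℂ} {T : W → Matrix b c ℂ} (hS : SmoothEntries S O)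
    (hT : SmoothEntries T O) : SmoothEntries (fun w => S w * T w) O := by
  intro i j
  simp only [Matrix.mul_apply]
  exact ContDiffOn.sum fun l _ => (hS i l).mul (hT l j)

theorem SmoothEntries.conjTranspose {S : W → Matrix a b ℂ} (hS : SmoothEntries S O) :
    SmoothEntries (fun w => (S w).conjTranspose) O :=
  fun i j => Complex.conjCLE.contDiff.comp_contDiffOn (hS j i)

theorem SmoothEntries.det {S : W → Matrix a a ℂ} (hS : SmoothEntries S O) :
    ContDiffOn ℝ ∞ (fun w => (S w).det) O := by
  simp only [Matrix.det_apply']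
  exact ContDiffOn.sum fun σ _ => contDiffOn_const.mul (contDiffOn_prod fun i _ => hS _ _)

/-- Cramer's rule: the inverse is the adjugate divided by the determinant, and the entries of the
adjugate are determinants of matrices with one row replaced by a constant row. -/
theorem SmoothEntries.inv {S : W → Matrix a a ℂ} (hS : SmoothEntries S O)
    (h0 : ∀ w ∈ O, (S w).det ≠ 0) : SmoothEntries (fun w => (S w)⁻¹) O := by
  intro i j
  have h1 : ContDiffOn ℝ ∞ (fun w => (S w).adjugate i j) O := by
    simp only [Matrix.adjugate_apply]
    refine SmoothEntries.det fun i' j' => ?_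
    by_cases h : i' = j
    · subst h
      simpa using contDiffOn_const
    · simpa [Matrix.updateRow_ne h] using hS i' j'
  refine ((hS.det.inv h0).mul h1).congr fun w _ => ?_
  simp [Matrix.inv_def, Ring.inverse_eq_inv']

end SmoothMatrices

/-! ### The Cayley parametrization of isometric matrices, and slopes of graphs. -/

section CayleyChart

open Matrix
open scoped ComplexOrder

variable {k r : ℕ}

/-- The parameter space of the Stiefel manifold of `k`-frames in `ℂ ^ (k + r)`. -/
abbrev StiefelParam (k r : ℕ) : Type := (Fin k → Fin k → ℝ) × (Fin r → Fin k → ℂ)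

/-- The space of `k`-tuples of vectors in `ℂ ^ (k + r)`. -/
abbrev FrameMatrix (k r : ℕ) : Type := Fin k ⊕ Fin r → Fin k → ℂ

theorem finrank_stiefelParam : Module.finrank ℝ (StiefelParam k r) = k * (k + 2 * r) := by
  simp only [Module.finrank_prod, Module.finrank_pi_fintype, Finset.sum_const, Finset.card_univ,
    Fintype.card_fin, Complex.finrank_real_complex, Module.finrank_self, smul_eq_mul]
  ring

/-- The upper square block. -/
def topBlock (S : FrameMatrix k r) : Matrix (Fin k) (Fin k) ℂ := fun i j => S (Sum.inl i) j

/-- The lower block. -/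
def botBlock (S : FrameMatrix k r) : Matrix (Fin r) (Fin k) ℂ := fun i j => S (Sum.inr i) j

/-- The skew-Hermitian matrix with given sum of real and imaginary part. -/
noncomputable def skewOfReal (M : Fin k → Fin k → ℝ) : Matrix (Fin k) (Fin k) ℂ :=
  fun i j => ((M i j - M j i : ℝ) : ℂ) / 2 + Complex.I * ((M i j + M j i : ℝ) : ℂ) / 2

/-- The sum of the real and the imaginary part of a matrix. -/
def reAddIm (A : Matrix (Fin k) (Fin k) ℂ) : Fin k → Fin k → ℝ := fun i j => (A i j).re + (A i j).im

theorem conjTranspose_skewOfReal (M : Fin k → Fin k → ℝ) :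
    (skewOfReal M)ᴴ = -skewOfReal M := by
  ext i j
  simp [skewOfReal, conjTranspose_apply]
  ring

theorem reAddIm_skewOfReal (M : Fin k → Fin k → ℝ) : reAddIm (skewOfReal M) = M := by
  funext i j
  simp [reAddIm, skewOfReal]
  ring

/-- The real part of a skew-Hermitian matrix is antisymmetric and the imaginary part symmetric, so
their sum determines both. Skew-Hermitian matrices are thereby parametrized by all real square
matrices. -/
theorem skewOfReal_reAddIm {A : Matrix (Fin k) (Fin k) ℂ} (hA : Aᴴ = -A) :
    skewOfReal (reAddIm A) = A := by
  ext i j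
  have h : star (A j i) = -A i j := congrFun (congrFun hA i) j
  have h' : A j i = -star (A i j) := by rw [← star_star (A j i), h, star_neg]
  apply Complex.ext
  · simp [skewOfReal, reAddIm, h']
  · simp [skewOfReal, reAddIm, h']
    ring

/-- The Cayley denominator. -/
noncomputable def cayleyDen (v : StiefelParam k r) : Matrix (Fin k) (Fin k) ℂ :=
  1 + (of v.2)ᴴ * of v.2 - skewOfReal v.1

theorem cayleyDen_add_conjTranspose (v : StiefelParam k r) :
    cayleyDen v + (cayleyDen v)ᴴ = 2 • (1 + (of v.2)ᴴ * of v.2) := by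
  simp only [cayleyDen, conjTranspose_sub, conjTranspose_add, conjTranspose_one,
    conjTranspose_mul, conjTranspose_conjTranspose, conjTranspose_skewOfReal]
  rw [two_smul]
  abel

/-- For x in the kernel of N, both Nx and x*N* vanish, so x*(N + N*)x = 0. But N + N* = 2(1 + b*b)
is positive definite, the skew part having cancelled. -/
theorem det_cayleyDen_ne_zero (v : StiefelParam k r) : (cayleyDen v).det ≠ 0 := by
  intro h
  obtain ⟨x, hx, hNx⟩ := exists_mulVec_eq_zero_iff.2 h
  have h1 : star x ⬝ᵥ ((cayleyDen v + (cayleyDen v)ᴴ) *ᵥ x) = 0 := by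
    rw [add_mulVec, dotProduct_add, hNx, dotProduct_zero, zero_add, dotProduct_mulVec,
      ← star_mulVec, hNx]
    simp
  rw [cayleyDen_add_conjTranspose] at h1
  have hpd : (1 + (of v.2)ᴴ * of v.2).PosDef :=
    PosDef.one.add_posSemidef (posSemidef_conjTranspose_mul_self _)
  have h2 := hpd.dotProduct_mulVec_pos hx
  rw [two_smul, add_mulVec, dotProduct_add, ← two_mul] at h1
  rcases mul_eq_zero.1 h1 with h3 | h3
  · norm_num at h3
  · exact h2.ne' h3

/-- The orthonormal frame with a given parameter. -/
noncomputable def frameOfParam (v : StiefelParam k r) : FrameMatrix k r :=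
  Sum.elim ((2 : ℂ) • (cayleyDen v)⁻¹ - 1 : Matrix (Fin k) (Fin k) ℂ)
    ((2 : ℂ) • (of v.2 * (cayleyDen v)⁻¹) : Matrix (Fin r) (Fin k) ℂ)

/-- The parameter of an orthonormal frame. -/
noncomputable def paramOfFrame (S : FrameMatrix k r) : StiefelParam k r :=
  (reAddIm (((1 + topBlock S)⁻¹)ᴴ - (1 + topBlock S)⁻¹),
    (botBlock S * (1 + topBlock S)⁻¹ : Matrix (Fin r) (Fin k) ℂ))

theorem topBlock_frameOfParam (v : StiefelParam k r) :
    topBlock (frameOfParam v) = (2 : ℂ) • (cayleyDen v)⁻¹ - 1 := rfl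

theorem botBlock_frameOfParam (v : StiefelParam k r) :
    botBlock (frameOfParam v) = (2 : ℂ) • (of v.2 * (cayleyDen v)⁻¹) := rfl

theorem conjTranspose_mul_self_eq (S : FrameMatrix k r) :
    (of S)ᴴ * of S = (topBlock S)ᴴ * topBlock S + (botBlock S)ᴴ * botBlock S := by
  ext i j
  simp [mul_apply, topBlock, botBlock]

theorem one_add_topBlock_frameOfParam (v : StiefelParam k r) :
    1 + topBlock (frameOfParam v) = (2 : ℂ) • (cayleyDen v)⁻¹ := by
  rw [topBlock_frameOfParam]
  abel

theorem det_frameOfParam_ne_zero (v : StiefelParam k r) :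
    (1 + topBlock (frameOfParam v)).det ≠ 0 := by
  rw [one_add_topBlock_frameOfParam, det_smul, det_nonsing_inv, Ring.inverse_eq_inv']
  exact mul_ne_zero (pow_ne_zero _ two_ne_zero) (inv_ne_zero (det_cayleyDen_ne_zero v))

/-- Expanding B*B + Z*Z for B = 2N⁻¹ - 1 and Z = 2bN⁻¹ gives 4N⁻*(1 + b*b)N⁻¹ - 2N⁻¹ - 2N⁻* + 1.
Since 2(1 + b*b) = N + N*, the first term is 2N⁻¹ + 2N⁻* and only 1 remains. -/
theorem frameOfParam_orthonormal (v : StiefelParam k r) :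
    (of (frameOfParam v))ᴴ * of (frameOfParam v) = 1 := by
  have hu : IsUnit (cayleyDen v).det := (det_cayleyDen_ne_zero v).isUnit
  rw [conjTranspose_mul_self_eq, topBlock_frameOfParam, botBlock_frameOfParam]
  have h2 := cayleyDen_add_conjTranspose v
  set N := cayleyDen v
  set b : Matrix (Fin r) (Fin k) ℂ := of v.2
  have hN : N⁻¹ * N = 1 := nonsing_inv_mul _ hu
  have hN' : N * N⁻¹ = 1 := mul_nonsing_inv _ hu
  have hNs : N⁻¹ᴴ * Nᴴ = 1 := by rw [← conjTranspose_mul, hN', conjTranspose_one]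
  have key : (2 : ℂ) • (N⁻¹ᴴ * (1 + bᴴ * b) * N⁻¹) = N⁻¹ + N⁻¹ᴴ := by
    have h3 : (2 : ℂ) • (1 + bᴴ * b) = N + Nᴴ := by
      rw [h2, two_smul, two_smul]
    rw [← smul_mul_assoc, ← mul_smul_comm, h3, mul_add, add_mul, hNs, mul_assoc, hN']
    simp [add_comm]
  have e1 : ((2 : ℂ) • N⁻¹ - 1)ᴴ * ((2 : ℂ) • N⁻¹ - 1)
      + ((2 : ℂ) • (b * N⁻¹))ᴴ * ((2 : ℂ) • (b * N⁻¹))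
      = (2 : ℂ) • ((2 : ℂ) • (N⁻¹ᴴ * (1 + bᴴ * b) * N⁻¹)) - (2 : ℂ) • N⁻¹ - (2 : ℂ) • N⁻¹ᴴ + 1 := by
    simp only [conjTranspose_sub, conjTranspose_smul, conjTranspose_one, conjTranspose_mul,
      mul_add, add_mul, mul_sub, sub_mul, Matrix.smul_mul, Matrix.mul_smul, one_mul, mul_one,
      smul_add, Matrix.mul_assoc]
    simp only [star_ofNat]
    abel
  rw [e1, key, smul_add]
  abel

/-- With D = 1 + B = 2N⁻¹ one has D⁻¹ = N/2. Hence D⁻* - D⁻¹ = (N* - N)/2 is the skew part of the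
parameter and ZD⁻¹ is b. -/
theorem paramOfFrame_frameOfParam (v : StiefelParam k r) : paramOfFrame (frameOfParam v) = v := by
  have hu : IsUnit (cayleyDen v).det := (det_cayleyDen_ne_zero v).isUnit
  have hinv : (1 + topBlock (frameOfParam v))⁻¹ = (2⁻¹ : ℂ) • cayleyDen v := by
    rw [one_add_topBlock_frameOfParam]
    apply inv_eq_right_inv
    rw [smul_mul_smul_comm, nonsing_inv_mul _ hu]
    simp
  refine Prod.ext ?_ ?_
  · have : ((1 + topBlock (frameOfParam v))⁻¹)ᴴ - (1 + topBlock (frameOfParam v))⁻¹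
        = skewOfReal v.1 := by
      have h2 : (cayleyDen v)ᴴ - cayleyDen v = (2 : ℂ) • skewOfReal v.1 := by
        simp only [cayleyDen, conjTranspose_sub, conjTranspose_add, conjTranspose_one,
          conjTranspose_mul, conjTranspose_conjTranspose, conjTranspose_skewOfReal, two_smul]
        abel
      have h3 : star (2⁻¹ : ℂ) = 2⁻¹ := by simp
      rw [hinv, conjTranspose_smul, h3, ← smul_sub, h2, smul_smul]
      norm_num
    simp only [paramOfFrame, this, reAddIm_skewOfReal]
  · have : botBlock (frameOfParam v) * (1 + topBlock (frameOfParam v))⁻¹ = of v.2 := by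
      rw [hinv, botBlock_frameOfParam, Matrix.smul_mul, Matrix.mul_smul, Matrix.mul_assoc,
        nonsing_inv_mul _ hu, Matrix.mul_one, smul_smul]
      norm_num
    exact this

/-- With D = 1 + B, orthonormality reads Z*Z = D + D* - D*D. Inserting this and a = D⁻* - D⁻¹ into
the Cayley denominator gives 2D⁻¹, from which both blocks are recovered. -/
theorem frameOfParam_paramOfFrame {S : FrameMatrix k r} (hS : (of S)ᴴ * of S = 1)
    (hdet : (1 + topBlock S).det ≠ 0) : frameOfParam (paramOfFrame S) = S := by
  have hu : IsUnit (1 + topBlock S).det := hdet.isUnit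
  rw [conjTranspose_mul_self_eq] at hS
  set D := 1 + topBlock S with hD
  have hB : topBlock S = D - 1 := by rw [hD]; abel
  have hinv : D⁻¹ * D = 1 := nonsing_inv_mul _ hu
  have hinv' : D * D⁻¹ = 1 := mul_nonsing_inv _ hu
  have hinvs : D⁻¹ᴴ * Dᴴ = 1 := by rw [← conjTranspose_mul, hinv', conjTranspose_one]
  have hskew : (D⁻¹ᴴ - D⁻¹)ᴴ = -(D⁻¹ᴴ - D⁻¹) := by
    simp
  have h1 : skewOfReal (paramOfFrame S).1 = D⁻¹ᴴ - D⁻¹ := skewOfReal_reAddIm hskew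
  have h2 : (of (paramOfFrame S).2) = botBlock S * D⁻¹ := rfl
  have hZ : (botBlock S)ᴴ * botBlock S = D + Dᴴ - Dᴴ * D := by
    rw [eq_sub_of_add_eq' hS, hB]
    simp only [conjTranspose_sub, conjTranspose_one, mul_sub, sub_mul, one_mul, mul_one]
    abel
  have hden : cayleyDen (paramOfFrame S) = (2 : ℂ) • D⁻¹ := by
    rw [cayleyDen, h1, h2, conjTranspose_mul, Matrix.mul_assoc, ← Matrix.mul_assoc _ (botBlock S),
      hZ]
    simp only [mul_add, mul_sub, add_mul, sub_mul, mul_assoc, hinv']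
    simp only [← mul_assoc, hinvs, two_smul, mul_one, one_mul]
    abel
  have hdeninv : (cayleyDen (paramOfFrame S))⁻¹ = (2⁻¹ : ℂ) • D := by
    rw [hden]
    apply inv_eq_right_inv
    rw [smul_mul_smul_comm, hinv]
    simp
  funext i j
  rcases i with i | i
  · change ((2 : ℂ) • (cayleyDen (paramOfFrame S))⁻¹ - 1) i j = topBlock S i j
    rw [hdeninv, hB]
    simp
  · have : (2 : ℂ) • (of (paramOfFrame S).2 * (cayleyDen (paramOfFrame S))⁻¹) = botBlock S := by
      rw [hdeninv, h2, Matrix.mul_smul, Matrix.mul_assoc, hinv, Matrix.mul_one, smul_smul]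
      norm_num
    exact congrFun (congrFun this i) j

theorem smoothEntries_topBlock {O : Set (FrameMatrix k r)} :
    SmoothEntries (fun S : FrameMatrix k r => topBlock S) O :=
  fun i j => (contDiff_apply_apply ℝ ℂ (Sum.inl i) j).contDiffOn

theorem smoothEntries_botBlock {O : Set (FrameMatrix k r)} :
    SmoothEntries (fun S : FrameMatrix k r => botBlock S) O :=
  fun i j => (contDiff_apply_apply ℝ ℂ (Sum.inr i) j).contDiffOn

theorem contDiff_frameOfParam : ContDiff ℝ ∞ (frameOfParam : StiefelParam k r → _) := by
  rw [← contDiffOn_univ]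
  have hb : SmoothEntries (fun v : StiefelParam k r => (of v.2 : Matrix (Fin r) (Fin k) ℂ))
      Set.univ :=
    fun i j => ((contDiff_apply_apply ℝ ℂ i j).comp contDiff_snd).contDiffOn
  have hr : ∀ i j, ContDiff ℝ ∞ (fun v : StiefelParam k r => v.1 i j) := fun i j =>
    (contDiff_apply_apply ℝ ℝ i j).comp contDiff_fst
  have ha : SmoothEntries (fun v : StiefelParam k r => skewOfReal v.1) Set.univ := fun i j =>
    (((Complex.ofRealCLM.contDiff.comp ((hr i j).sub (hr j i))).div_const 2).add
      ((contDiff_const.mul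
        (Complex.ofRealCLM.contDiff.comp ((hr i j).add (hr j i)))).div_const 2)).contDiffOn
  have hN : SmoothEntries (fun v : StiefelParam k r => cayleyDen v) Set.univ :=
    ((SmoothEntries.const 1).add (hb.conjTranspose.mul hb)).sub ha
  have hNi := hN.inv fun v _ => det_cayleyDen_ne_zero v
  refine contDiffOn_pi.2 fun i => contDiffOn_pi.2 fun j => ?_
  rcases i with i | i
  · exact ((hNi.smul 2).sub (SmoothEntries.const 1)) i j
  · exact ((hb.mul hNi).smul 2) i j

theorem contDiffOn_paramOfFrame :
    ContDiffOn ℝ ∞ (paramOfFrame : FrameMatrix k r → _) {S | (1 + topBlock S).det ≠ 0} := by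
  have hD : SmoothEntries (fun S : FrameMatrix k r => (1 + topBlock S)⁻¹)
      {S | (1 + topBlock S).det ≠ 0} :=
    ((SmoothEntries.const 1).add smoothEntries_topBlock).inv fun S hS => hS
  have ha := hD.conjTranspose.sub hD
  refine ContDiffOn.prodMk (contDiffOn_pi.2 fun i => contDiffOn_pi.2 fun j => ?_)
    (contDiffOn_pi.2 fun i => contDiffOn_pi.2 fun j => (smoothEntries_botBlock.mul hD) i j)
  exact (Complex.reCLM.contDiff.comp_contDiffOn (ha i j)).add
    (Complex.imCLM.contDiff.comp_contDiffOn (ha i j))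

theorem isOpen_det_one_add_topBlock_ne_zero :
    IsOpen {S : FrameMatrix k r | (1 + topBlock S).det ≠ 0} := by
  have h : ContDiffOn ℝ ∞ (fun S : FrameMatrix k r => (1 + topBlock S).det) Set.univ :=
    SmoothEntries.det ((SmoothEntries.const 1).add smoothEntries_topBlock)
  exact isOpen_ne.preimage (continuousOn_univ.1 h.continuousOn)

/-- The slope of the subspace generated by a frame. -/
noncomputable def frameSlope (S : FrameMatrix k r) : Fin r → Fin k → ℂ :=
  (botBlock S * (topBlock S)⁻¹ : Matrix (Fin r) (Fin k) ℂ)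

/-- The standard frame of the subspace with a given slope. -/
def graphFrame (A : Fin r → Fin k → ℂ) : FrameMatrix k r :=
  Sum.elim (1 : Matrix (Fin k) (Fin k) ℂ) A

theorem contDiffOn_frameSlope :
    ContDiffOn ℝ ∞ (frameSlope : FrameMatrix k r → _) {S | (topBlock S).det ≠ 0} :=
  contDiffOn_pi.2 fun i => contDiffOn_pi.2 fun j =>
    (smoothEntries_botBlock.mul (smoothEntries_topBlock.inv fun _ hS => hS)) i j

theorem isOpen_det_topBlock_ne_zero : IsOpen {S : FrameMatrix k r | (topBlock S).det ≠ 0} := by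
  have h : ContDiffOn ℝ ∞ (fun S : FrameMatrix k r => (topBlock S).det) Set.univ :=
    SmoothEntries.det smoothEntries_topBlock
  exact isOpen_ne.preimage (continuousOn_univ.1 h.continuousOn)

theorem contDiff_graphFrame : ContDiff ℝ ∞ (graphFrame : (Fin r → Fin k → ℂ) → _) := by
  refine contDiff_pi.2 fun i => contDiff_pi.2 fun j => ?_
  rcases i with i | i
  · exact contDiff_const
  · exact contDiff_apply_apply ℝ ℂ i j

end CayleyChart

/-! ### Local product charts of the Stiefel bundle. -/

section StiefelCharts

open Matrix

variable {d : ℕ} {X : Type*} [TopologicalSpace X] [ChartedSpace (EuclideanSpace ℝ (Fin d)) X]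
  {F : Type*} [NormedAddCommGroup F] [NormedSpace ℝ F]
  {E : X → Type*} [∀ x, AddCommGroup (E x)] [∀ x, Module ℂ (E x)]
  [TopologicalSpace (TotalSpace F E)] [∀ x, TopologicalSpace (E x)] [FiberBundle F E]
  {EP : Type*} [NormedAddCommGroup EP] [NormedSpace ℝ EP] {HP : Type*} [TopologicalSpace HP]
  {J : ModelWithCorners ℝ EP HP} {P : Type*} [TopologicalSpace P] [ChartedSpace HP P]
  [NormedSpace ℂ F] [IsScalarTower ℝ ℂ F] [VectorBundle ℂ F E]
  {h : HermitianMetric d F E} {k r : ℕ}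

namespace UnitaryFrame

variable {ι : Type} [Fintype ι] [DecidableEq ι] (u : UnitaryFrame h ι)

/-- The coordinates of a `k`-tuple of vectors with respect to a unitary frame. -/
def coords (x : X) (w : Fin k → E x) : ι → Fin k → ℂ := fun j i => h.form x (u.vec j x) (w i)

/-- The vectors with given coordinates with respect to a unitary frame. -/
def comb (x : X) (S : ι → Fin k → ℂ) : Fin k → E x := fun i => ∑ j, S j i • u.vec j x

theorem coords_comb (x : X) (S : ι → Fin k → ℂ) : u.coords x (u.comb x S) = S := by
  funext j i
  simp [coords, comb, map_sum, u.orthonormal]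

theorem comb_coords (x : X) (w : Fin k → E x) : u.comb x (u.coords x w) = w := by
  funext i
  exact (u.repr x (w i)).symm

theorem form_comb (x : X) (S T : ι → Fin k → ℂ) (i j : Fin k) :
    h.form x (u.comb x S i) (u.comb x T j) = ((of S)ᴴ * of T) i j := by
  simp [comb, map_sum, u.orthonormal, mul_apply, mul_comm]

theorem conjTranspose_mul_coords (x : X) (w : Fin k → E x) :
    ((of (u.coords x w))ᴴ * of (u.coords x w)) = fun i j => h.form x (w i) (w j) := by
  funext i j
  rw [← u.form_comb, u.comb_coords]

theorem contMDiffOn_coords {f : P → X} {w : ∀ p, Fin k → E (f p)} {O : Set P}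
    (hw : ∀ i, SmoothSec d F J f (fun p => w p i) O) (hf : ContMDiffOn J (𝓡 d) ∞ f O)
    (hO : ∀ p ∈ O, f p ∈ u.dom) :
    ContMDiffOn J 𝓘(ℝ, ι → Fin k → ℂ) ∞ (fun p => u.coords (f p) (w p)) O :=
  contMDiffOn_pi_space.2 fun j => contMDiffOn_pi_space.2 fun i =>
    h.contMDiffOn_form (smoothSec_comp (u.smooth j) hf hO) (hw i)

theorem smoothSec_comb {f : P → X} {S : P → ι → Fin k → ℂ} {O : Set P}
    (hf : ContMDiffOn J (𝓡 d) ∞ f O) (hO : ∀ p ∈ O, f p ∈ u.dom)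
    (hS : ContMDiffOn J 𝓘(ℝ, ι → Fin k → ℂ) ∞ S O) (i : Fin k) :
    SmoothSec d F J f (fun p => u.comb (f p) (S p) i) O :=
  SmoothSec.sum Finset.univ hf fun j _ => SmoothSec.smul
    (contMDiffOn_pi_space.1 (contMDiffOn_pi_space.1 hS j) i) (smoothSec_comp (u.smooth j) hf hO)

theorem contMDiffOn_form_vec (j : ι) :
    ContMDiffOn ((𝓡 d).prod 𝓘(ℝ, F)) 𝓘(ℝ, ℂ) ∞
      (fun z : TotalSpace F E => h.form z.proj (u.vec j z.proj) z.2)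
      (TotalSpace.proj ⁻¹' u.dom) :=
  h.contMDiffOn_form (smoothSec_comp (u.smooth j) (contMDiffOn_proj E) fun _ => id) contMDiffOn_id

theorem linearIndependent_comb (x : X) {S : ι → Fin k → ℂ}
    (hS : LinearIndependent ℂ (of S).col) : LinearIndependent ℂ (u.comb x S) := by
  rw [Fintype.linearIndependent_iff] at hS ⊢
  intro c hc
  apply hS c
  funext j
  have := congrArg (h.form x (u.vec j x)) hc
  simpa [comb, map_sum, u.orthonormal, Finset.sum_apply] using this

end UnitaryFrame

namespace StiefelBundle

/-- The vector with index 0 records the base point; this is where `k ≥ 1` enters. -/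
theorem vec_ext [NeZero k] {e e' : StiefelBundle h k} (he : ∀ i, e.vec i = e'.vec i) : e = e' := by
  obtain ⟨x, w, hw⟩ := e
  obtain ⟨x', w', hw'⟩ := e'
  obtain rfl : x = x' := congrArg TotalSpace.proj (he 0)
  obtain rfl : w = w' := funext fun i => by simpa [vec] using he i
  rfl

theorem isInducing_vec :
    IsInducing (fun e i => e.vec i : StiefelBundle h k → Fin k → TotalSpace F E) := ⟨rfl⟩

theorem continuous_vec (i : Fin k) : Continuous (fun e : StiefelBundle h k => e.vec i) :=
  (continuous_apply i).comp isInducing_vec.continuous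

theorem continuous_base [NeZero k] : Continuous (base : StiefelBundle h k → X) :=
  (FiberBundle.continuous_proj F E).comp (continuous_vec 0)

/-- The orthonormal frame with given coordinates. -/
def ofCoords (u : UnitaryFrame h (Fin k ⊕ Fin r)) (x : X) (S : FrameMatrix k r)
    (hS : (of S)ᴴ * of S = 1) : StiefelBundle h k where
  base := x
  frame := u.comb x S
  orthonormal i j := by rw [u.form_comb, hS, one_apply]

theorem coords_orthonormal (u : UnitaryFrame h (Fin k ⊕ Fin r)) (e : StiefelBundle h k) :
    (of (u.coords e.base e.frame))ᴴ * of (u.coords e.base e.frame) = 1 := by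
  rw [u.conjTranspose_mul_coords]
  ext i j
  rw [e.orthonormal, one_apply]

theorem continuousOn_coords [NeZero k] {ι : Type} [Fintype ι] [DecidableEq ι]
    (u : UnitaryFrame h ι) :
    ContinuousOn (fun e : StiefelBundle h k => u.coords e.base e.frame) (base ⁻¹' u.dom) := by
  refine continuousOn_pi.2 fun j => continuousOn_pi.2 fun i => ?_
  exact (u.contMDiffOn_form_vec j).continuousOn.comp (continuous_vec i).continuousOn
    fun e he => he

/-- The local product structure of the Stiefel bundle given by a unitary frame and the Cayley
parametrization of the unitary frames. -/
noncomputable def chart [NeZero k] (u : UnitaryFrame h (Fin k ⊕ Fin r)) :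
    OpenPartialHomeomorph (StiefelBundle h k) (X × StiefelParam k r) where
  toFun e := (e.base, paramOfFrame (u.coords e.base e.frame))
  invFun z := ofCoords u z.1 (frameOfParam z.2) (frameOfParam_orthonormal z.2)
  source := base ⁻¹' u.dom ∩
    (fun e => u.coords e.base e.frame) ⁻¹' {S | (1 + topBlock S).det ≠ 0}
  target := u.dom ×ˢ Set.univ
  map_source' e he := ⟨he.1, trivial⟩
  map_target' z hz := ⟨hz.1, by
    simp only [ofCoords, Set.mem_preimage, u.coords_comb]
    exact det_frameOfParam_ne_zero z.2⟩
  left_inv' e he := by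
    apply vec_ext
    intro i
    simp only [ofCoords, vec]
    rw [frameOfParam_paramOfFrame (coords_orthonormal u e) he.2, u.comb_coords]
  right_inv' z hz := by
    simp only [ofCoords, u.coords_comb, paramOfFrame_frameOfParam]
  open_source := (continuousOn_coords u).isOpen_inter_preimage
    (u.isOpen_dom.preimage continuous_base) isOpen_det_one_add_topBlock_ne_zero
  open_target := u.isOpen_dom.prod isOpen_univ
  continuousOn_toFun := continuous_base.continuousOn.prodMk
    (contDiffOn_paramOfFrame.continuousOn.comp
      ((continuousOn_coords u).mono Set.inter_subset_left) fun e he => he.2)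
  continuousOn_invFun := by
    -- The topology is induced by the vectors, so it is enough that each of them depends
    -- continuously on the point.
    rw [isInducing_vec.continuousOn_iff]
    refine continuousOn_pi.2 fun i => ?_
    exact (u.smoothSec_comb (J := (𝓡 d).prod 𝓘(ℝ, StiefelParam k r)) contMDiffOn_fst
      (fun p hp => hp.1) (contDiff_frameOfParam.contMDiff.comp_contMDiffOn contMDiffOn_snd)
      i).continuousOn

theorem contMDiffOn_chart_comp [NeZero k] (u : UnitaryFrame h (Fin k ⊕ Fin r))
    {f : P → StiefelBundle h k} {O : Set P}
    (hf : ∀ i, ContMDiffOn J ((𝓡 d).prod 𝓘(ℝ, F)) ∞ (fun p => (f p).vec i) O)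
    (hO : ∀ p ∈ O, f p ∈ (chart u).source) :
    ContMDiffOn J ((𝓡 d).prod 𝓘(ℝ, StiefelParam k r)) ∞ (fun p => chart u (f p)) O := by
  have hb : ContMDiffOn J (𝓡 d) ∞ (fun p => (f p).base) O := SmoothSec.base (hf 0)
  refine hb.prodMk (ContMDiffOn.comp (contMDiffOn_iff_contDiffOn.2 contDiffOn_paramOfFrame)
    (u.contMDiffOn_coords (w := fun p => (f p).frame) (fun i => hf i) hb fun p hp => (hO p hp).1)
    fun p hp => (hO p hp).2)

theorem contMDiffOn_vec_chart_symm [NeZero k] (u : UnitaryFrame h (Fin k ⊕ Fin r)) (i : Fin k) :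
    ContMDiffOn ((𝓡 d).prod 𝓘(ℝ, StiefelParam k r)) ((𝓡 d).prod 𝓘(ℝ, F)) ∞
      (fun z => ((chart u).symm z).vec i) (chart u).target :=
  u.smoothSec_comb (J := (𝓡 d).prod 𝓘(ℝ, StiefelParam k r)) contMDiffOn_fst
      (fun _ hp => hp.1) (contDiff_frameOfParam.contMDiff.comp_contMDiffOn contMDiffOn_snd) i

variable [FiniteDimensional ℂ F] [∀ x, Module ℝ (E x)]
    [VectorBundle ℝ F E] [ContMDiffVectorBundle ∞ F E (𝓡 d)]

/-- A unitary frame adapted to `e`: complete `e` to an orthonormal basis of its fibre and extend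
that basis smoothly. In it `e` has upper block 1 and lower block 0. -/
theorem exists_unitaryFrame (hr : Module.finrank ℂ F = k + r) (e : StiefelBundle h k) :
    ∃ u : UnitaryFrame h (Fin k ⊕ Fin r), e.base ∈ u.dom ∧
      ∀ i, u.vec (Sum.inl i) e.base = e.frame i := by
  have hcard : Module.finrank ℂ F = Fintype.card (Fin k ⊕ Fin r) := by simp [hr]
  obtain ⟨b, hb, hbe⟩ := h.exists_orthonormal_extension e.base hcard (Set.range Sum.inl)
    (Sum.elim e.frame 0) (by
      rintro _ ⟨i, rfl⟩ _ ⟨j, rfl⟩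
      simp [e.orthonormal])
  obtain ⟨u, hu, hub⟩ := h.exists_unitaryFrame hcard e.base b hb
  refine ⟨u, hu, fun i => ?_⟩
  rw [hub, hbe _ ⟨i, rfl⟩]
  rfl

theorem coords_of_vec_eq (u : UnitaryFrame h (Fin k ⊕ Fin r)) (e : StiefelBundle h k)
    (hu : ∀ i, u.vec (Sum.inl i) e.base = e.frame i) : topBlock (u.coords e.base e.frame) = 1 := by
  ext i j
  rw [topBlock, UnitaryFrame.coords, hu, e.orthonormal, one_apply]

theorem exists_mem_chart_source [NeZero k] (hr : Module.finrank ℂ F = k + r)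
    (e : StiefelBundle h k) :
    ∃ u : UnitaryFrame h (Fin k ⊕ Fin r), e ∈ (chart u).source := by
  obtain ⟨u, hu, hue⟩ := exists_unitaryFrame hr e
  refine ⟨u, hu, ?_⟩
  -- In the adapted frame 1 + B is twice the identity, with determinant 2 ^ k.
  simp only [Set.mem_preimage, Set.mem_ofPred_eq, coords_of_vec_eq u e hue]
  have : (1 + 1 : Matrix (Fin k) (Fin k) ℂ) = (2 : ℂ) • 1 := by rw [two_smul]
  rw [this, det_smul, det_one, mul_one]
  exact pow_ne_zero _ two_ne_zero

/-- The smooth structure is the one given by the charts `StiefelBundle.chart`. -/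
structure IsAdapted [NeZero k] (m r : ℕ) (h : HermitianMetric d F E)
    [ChartedSpace (EuclideanSpace ℝ (Fin m)) (StiefelBundle h k)] : Prop where
  isManifold : IsManifold (𝓡 m) ∞ (StiefelBundle h k)
  smooth : ∀ u : UnitaryFrame h (Fin k ⊕ Fin r),
    ContMDiffOn (𝓡 m) ((𝓡 d).prod 𝓘(ℝ, StiefelParam k r)) ∞ (chart u) (chart u).source
  smooth_symm : ∀ u : UnitaryFrame h (Fin k ⊕ Fin r),
    ContMDiffOn ((𝓡 d).prod 𝓘(ℝ, StiefelParam k r)) (𝓡 m) ∞ (chart u).symm (chart u).target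

-- Transition maps are smooth because a chart is smooth along every map with smooth vectors, and the
-- inverse of a chart has smooth vectors.
variable (h) in
theorem exists_isAdapted [NeZero k] [IsManifold (𝓡 d) ∞ X] (hr : Module.finrank ℂ F = k + r)
    {m : ℕ} (hm : m = d + k * (k + 2 * r)) :
    ∃ _ : ChartedSpace (EuclideanSpace ℝ (Fin m)) (StiefelBundle h k), IsAdapted (k := k) m r h := by
  obtain ⟨cs, h1, h2⟩ := exists_chartedSpace_of_local_products (d := d) (m := m)
    (fun u : UnitaryFrame h (Fin k ⊕ Fin r) => chart (h := h) (k := k) u)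
    (exists_mem_chart_source hr) (fun u v => contMDiffOn_chart_comp v
      (fun i => (contMDiffOn_vec_chart_symm u i).mono Set.inter_subset_left) fun p hp => hp.2)
    (by rw [finrank_stiefelParam, hm])
  exact ⟨cs, h1, fun u => (h2 u).1, fun u => (h2 u).2⟩

section Adapted

variable [NeZero k] {m : ℕ} [ChartedSpace (EuclideanSpace ℝ (Fin m)) (StiefelBundle h k)]

theorem IsAdapted.contMDiff_vec (ha : IsAdapted (k := k) m r h) (hr : Module.finrank ℂ F = k + r)
    (i : Fin k) :
    ContMDiff (𝓡 m) ((𝓡 d).prod 𝓘(ℝ, F)) ∞ (vec i : StiefelBundle h k → TotalSpace F E) := by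
  intro e
  obtain ⟨u, hu⟩ := exists_mem_chart_source hr e
  have h1 := ((contMDiffOn_vec_chart_symm u i).comp (ha.smooth u)
    (chart u).mapsTo).contMDiffAt ((chart u).open_source.mem_nhds hu)
  refine h1.congr_of_eventuallyEq ?_
  filter_upwards [(chart u).open_source.mem_nhds hu] with e' he'
  simp only [Function.comp, (chart u).left_inv he']

/-- The universal property of an embedded submanifold: continuity comes from the induced topology,
smoothness from the charts. It is used for every smooth map into the Stiefel bundle. -/
theorem IsAdapted.contMDiffOn (ha : IsAdapted (k := k) m r h) (hr : Module.finrank ℂ F = k + r)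
    {f : P → StiefelBundle h k} {O : Set P} (hO : IsOpen O)
    (hf : ∀ i, ContMDiffOn J ((𝓡 d).prod 𝓘(ℝ, F)) ∞ (fun p => (f p).vec i) O) :
    ContMDiffOn J (𝓡 m) ∞ f O := by
  have hc : ContinuousOn f O := by
    rw [isInducing_vec.continuousOn_iff]
    exact continuousOn_pi.2 fun i => (hf i).continuousOn
  intro p hp
  obtain ⟨u, hu⟩ := exists_mem_chart_source hr (f p)
  have hO' : IsOpen (O ∩ f ⁻¹' (chart u).source) :=
    hc.isOpen_inter_preimage hO (chart u).open_source
  have h1 := ((ha.smooth_symm u).comp (contMDiffOn_chart_comp u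
    (fun i => (hf i).mono Set.inter_subset_left) fun p hp => hp.2)
      (fun p hp => (chart u).map_source hp.2)).contMDiffAt (hO'.mem_nhds ⟨hp, hu⟩)
  refine (h1.congr_of_eventuallyEq ?_).contMDiffWithinAt
  filter_upwards [hO'.mem_nhds ⟨hp, hu⟩] with q hq
  exact ((chart u).left_inv hq.2).symm

end Adapted

end StiefelBundle

end StiefelCharts

/-! ### Separation and countability of total spaces. -/

section TotalSpaceTopology

variable {B F : Type*} [TopologicalSpace B] [TopologicalSpace F] (E : B → Type*)
  [TopologicalSpace (TotalSpace F E)] [∀ x, TopologicalSpace (E x)] [FiberBundle F E]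

-- Points of one fibre are separated inside a trivialization, points of different fibres by the
-- projection.
variable (F) in
theorem t2Space_totalSpace [T2Space B] [T2Space F] : T2Space (TotalSpace F E) := by
  refine ⟨fun z z' hzz => ?_⟩
  by_cases hb : z.proj = z'.proj
  · let e := trivializationAt F E z.proj
    have hz : z ∈ e.source := e.mem_source.2 (mem_baseSet_trivializationAt F E z.proj)
    have hz' : z' ∈ e.source := e.mem_source.2 (hb ▸ mem_baseSet_trivializationAt F E z.proj)
    have hne : e z ≠ e z' := fun h => hzz (e.injOn hz hz' h)
    obtain ⟨U, V, hU, hV, hzU, hzV, hUV⟩ := t2_separation hne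
    exact ⟨e.source ∩ e ⁻¹' U, e.source ∩ e ⁻¹' V,
      e.continuousOn.isOpen_inter_preimage e.open_source hU,
      e.continuousOn.isOpen_inter_preimage e.open_source hV, ⟨hz, hzU⟩, ⟨hz', hzV⟩,
      (hUV.preimage e).mono Set.inter_subset_right Set.inter_subset_right⟩
  · exact separated_by_continuous (FiberBundle.continuous_proj F E) hb

-- Countably many trivializations suffice, because the base is second countable.
variable (F) in
theorem secondCountableTopology_totalSpace [SecondCountableTopology B]
    [SecondCountableTopology F] : SecondCountableTopology (TotalSpace F E) := by
  obtain ⟨s, hs, hsU⟩ := TopologicalSpace.countable_cover_nhds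
    (f := fun x : B => (trivializationAt F E x).baseSet) fun x =>
      (trivializationAt F E x).open_baseSet.mem_nhds (mem_baseSet_trivializationAt F E x)
  have := hs.to_subtype
  have : ∀ x : s, SecondCountableTopology (trivializationAt F E x.1).source := fun x =>
    (trivializationAt F E x.1).toOpenPartialHomeomorph.secondCountableTopology_source
  refine TopologicalSpace.secondCountableTopology_of_countable_cover
    (fun x : s => (trivializationAt F E x.1).open_source) ?_
  rw [Set.eq_univ_iff_forall] at hsU ⊢
  intro z
  obtain ⟨x, hx, hz⟩ := Set.mem_iUnion₂.1 (hsU z.proj)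
  exact Set.mem_iUnion.2 ⟨⟨x, hx⟩, (trivializationAt F E x).mem_source.2 hz⟩

end TotalSpaceTopology

/-! ### Vectors killed by a differential. -/

section Differentials

variable {E₁ H₁ M₁ E₂ H₂ M₂ E₃ H₃ M₃ : Type*}
  [NormedAddCommGroup E₁] [NormedSpace ℝ E₁] [TopologicalSpace H₁] [TopologicalSpace M₁]
  [ChartedSpace H₁ M₁] {I₁ : ModelWithCorners ℝ E₁ H₁}
  [NormedAddCommGroup E₂] [NormedSpace ℝ E₂] [TopologicalSpace H₂] [TopologicalSpace M₂]
  [ChartedSpace H₂ M₂] {I₂ : ModelWithCorners ℝ E₂ H₂}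
  [NormedAddCommGroup E₃] [NormedSpace ℝ E₃] [TopologicalSpace H₃] [TopologicalSpace M₃]
  [ChartedSpace H₃ M₃] {I₃ : ModelWithCorners ℝ E₃ H₃}

theorem mfderiv_comp_apply_eq_zero {f : M₁ → M₂} {g : M₂ → M₃} {x : M₁}
    (hg : MDifferentiableAt I₂ I₃ g (f x)) (hf : MDifferentiableAt I₁ I₂ f x)
    {v : TangentSpace I₁ x} (hv : mfderiv I₁ I₂ f x v = 0) :
    mfderiv I₁ I₃ (fun y => g (f y)) x v = 0 := by
  have h := mfderiv_comp x hg hf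
  change mfderiv I₁ I₃ (g ∘ f) x v = 0
  rw [h, ContinuousLinearMap.comp_apply, hv, map_zero]

end Differentials

/-! ### The Stiefel bundle as an embedded submanifold. -/

namespace StiefelBundle

open Matrix

variable {d : ℕ} {X : Type*} [TopologicalSpace X] [ChartedSpace (EuclideanSpace ℝ (Fin d)) X]
  {F : Type*} [NormedAddCommGroup F] [NormedSpace ℝ F]
  {E : X → Type*} [∀ x, AddCommGroup (E x)] [∀ x, Module ℂ (E x)]
  [TopologicalSpace (TotalSpace F E)] [∀ x, TopologicalSpace (E x)] [FiberBundle F E]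
  [NormedSpace ℂ F] [IsScalarTower ℝ ℂ F] [VectorBundle ℂ F E]
  {h : HermitianMetric d F E} {k r : ℕ}
  [FiniteDimensional ℂ F] [∀ x, Module ℝ (E x)]
  [VectorBundle ℝ F E] [ContMDiffVectorBundle ∞ F E (𝓡 d)] [NeZero k]

variable (h k) in
theorem t2Space [T2Space X] : T2Space (StiefelBundle h k) := by
  have := t2Space_totalSpace F E
  exact T2Space.of_injective_continuous
    (f := fun e i => e.vec i) (fun e e' he => vec_ext (congrFun he)) isInducing_vec.continuous

variable (h k) in
theorem secondCountableTopology [SecondCountableTopology X] :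
    SecondCountableTopology (StiefelBundle h k) := by
  have : ProperSpace F := FiniteDimensional.proper ℂ F
  have := secondCountableTopology_totalSpace F E
  exact isInducing_vec.secondCountableTopology

variable {m : ℕ} [ChartedSpace (EuclideanSpace ℝ (Fin m)) (StiefelBundle h k)]

/-- The identity near `e` factors smoothly through the base point and the coordinate matrix, both of
which are smooth functions of the vectors. A tangent vector killed by the differentials of all
vectors is therefore killed by the identity. -/
theorem IsAdapted.immersion (ha : IsAdapted (k := k) m r h) (hr : Module.finrank ℂ F = k + r)
    (e : StiefelBundle h k) (v : TangentSpace (𝓡 m) e)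
    (hv : ∀ i, mfderiv (𝓡 m) ((𝓡 d).prod 𝓘(ℝ, F))
      (StiefelBundle.vec i : StiefelBundle h k → TotalSpace F E) e v = 0) : v = 0 := by
  obtain ⟨u, hu⟩ := exists_mem_chart_source hr e
  have hvec : ∀ i, MDifferentiableAt (𝓡 m) ((𝓡 d).prod 𝓘(ℝ, F))
      (vec i : StiefelBundle h k → TotalSpace F E) e := fun i =>
    (ha.contMDiff_vec hr i e).mdifferentiableAt (by simp)
  have hb : ContMDiff (𝓡 m) (𝓡 d) ∞ (base : StiefelBundle h k → X) := fun e =>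
    (contMDiffAt_totalSpace.1 (ha.contMDiff_vec hr 0 e)).1
  have hbase : mfderiv (𝓡 m) (𝓡 d) (base : StiefelBundle h k → X) e v = 0 :=
    mfderiv_comp_apply_eq_zero (g := (TotalSpace.proj : TotalSpace F E → X))
      (((contMDiff_proj E (n := ∞)) _).mdifferentiableAt (by simp)) (hvec 0) (hv 0)
  have hcoords : ContMDiffAt (𝓡 m) 𝓘(ℝ, FrameMatrix k r) ∞
      (fun e : StiefelBundle h k => u.coords e.base e.frame) e :=
    (u.contMDiffOn_coords (w := fun e : StiefelBundle h k => e.frame)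
      (fun i => (ha.contMDiff_vec hr i).contMDiffOn) hb.contMDiffOn
      fun p hp => hp).contMDiffAt ((u.isOpen_dom.preimage continuous_base).mem_nhds hu.1)
  have hcoords' := hcoords.mdifferentiableAt (by simp : (∞ : WithTop ℕ∞) ≠ 0)
  -- Entry by entry: the entry `(j, i)` depends on the `i`-th vector only.
  have hcv : mfderiv (𝓡 m) 𝓘(ℝ, FrameMatrix k r)
      (fun e : StiefelBundle h k => u.coords e.base e.frame) e v = (0 : FrameMatrix k r) := by
    funext j i
    let φ : FrameMatrix k r →L[ℝ] ℂ :=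
      (ContinuousLinearMap.proj (R := ℝ) (φ := fun _ : Fin k => ℂ) i).comp
        (ContinuousLinearMap.proj (R := ℝ) (φ := fun _ : Fin k ⊕ Fin r => Fin k → ℂ) j)
    have h1 : mfderiv (𝓡 m) 𝓘(ℝ, ℂ)
        (fun e : StiefelBundle h k => h.form e.base (u.vec j e.base) (e.frame i)) e v = 0 :=
      mfderiv_comp_apply_eq_zero
        (g := fun z : TotalSpace F E => h.form z.proj (u.vec j z.proj) z.2)
        (((u.contMDiffOn_form_vec j).contMDiffAt ((u.isOpen_dom.preimage
          (FiberBundle.continuous_proj F E)).mem_nhds hu.1)).mdifferentiableAt (by simp))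
        (hvec i) (hv i)
    have h2 := (φ.hasMFDerivAt.comp e hcoords'.hasMFDerivAt).mfderiv
    have h3 : mfderiv (𝓡 m) 𝓘(ℝ, ℂ)
        (fun e : StiefelBundle h k => h.form e.base (u.vec j e.base) (e.frame i)) e v
        = φ (mfderiv (𝓡 m) 𝓘(ℝ, FrameMatrix k r)
          (fun e : StiefelBundle h k => u.coords e.base e.frame) e v) :=
      DFunLike.congr_fun h2 v
    exact h3.symm.trans h1
  -- `paramOfFrame` is smooth on an open set of arbitrary matrices, not merely on isometric ones, so
  -- the reconstruction map is defined on an open set of the ambient space.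
  have hG : ContMDiffAt ((𝓡 d).prod 𝓘(ℝ, FrameMatrix k r)) (𝓡 m) ∞
      (fun z : X × FrameMatrix k r => (chart u).symm (z.1, paramOfFrame z.2))
      (e.base, u.coords e.base e.frame) := by
    have h1 : ContMDiffAt ((𝓡 d).prod 𝓘(ℝ, FrameMatrix k r))
        ((𝓡 d).prod 𝓘(ℝ, StiefelParam k r)) ∞
        (fun z : X × FrameMatrix k r => (z.1, paramOfFrame z.2))
        (e.base, u.coords e.base e.frame) :=
      contMDiffAt_fst.prodMk (ContMDiffAt.comp (e.base, u.coords e.base e.frame)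
        (contDiffOn_paramOfFrame.contDiffAt
          (isOpen_det_one_add_topBlock_ne_zero.mem_nhds hu.2)).contMDiffAt contMDiffAt_snd)
    exact ContMDiffAt.comp (e.base, u.coords e.base e.frame)
      ((ha.smooth_symm u).contMDiffAt
        ((chart u).open_target.mem_nhds ((chart u).map_source hu))) h1
  have hpair : mfderiv (𝓡 m) ((𝓡 d).prod 𝓘(ℝ, FrameMatrix k r))
      (fun e : StiefelBundle h k => (e.base, u.coords e.base e.frame)) e v = 0 := by
    rw [mfderiv_prodMk ((hb e).mdifferentiableAt (by simp)) hcoords']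
    exact Prod.ext hbase hcv
  have hfin := mfderiv_comp_apply_eq_zero
    (f := fun e : StiefelBundle h k => (e.base, u.coords e.base e.frame)) (hG.mdifferentiableAt (by simp))
    (((hb e).mdifferentiableAt (by simp)).prodMk hcoords') hpair
  have hid : (fun y : StiefelBundle h k =>
      (chart u).symm (y.base, paramOfFrame (u.coords y.base y.frame))) =ᶠ[𝓝 e] id := by
    filter_upwards [(chart u).open_source.mem_nhds hu] with y hy
    exact (chart u).left_inv hy
  rw [hid.mfderiv_eq, mfderiv_id] at hfin
  exact hfin

theorem IsAdapted.isSmoothManifold [T2Space X] [SecondCountableTopology X]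
    (ha : IsAdapted (k := k) m r h) : IsSmoothManifold m (StiefelBundle h k) :=
  ⟨t2Space h k, secondCountableTopology h k, ha.isManifold⟩

theorem IsAdapted.isStiefelManifold [T2Space X] [SecondCountableTopology X]
    (ha : IsAdapted (k := k) m r h) (hr : Module.finrank ℂ F = k + r) : IsStiefelManifold m h k :=
  ⟨ha.isSmoothManifold, ha.contMDiff_vec hr, ha.immersion hr⟩

end StiefelBundle

/-! ### Slopes of subspaces and the quotient topology of the Grassmann bundle. -/

section GrassmannCharts

open Matrix

/-- Each family is expressed through the other; comparing coefficients in the independent family `v`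
shows that the two matrices are mutually inverse. -/
theorem exists_change_of_frame {V : Type*} [AddCommGroup V] [Module ℂ V] {k : ℕ}
    {v v' : Fin k → V} (hv : LinearIndependent ℂ v)
    (hspan : Submodule.span ℂ (Set.range v) = Submodule.span ℂ (Set.range v')) :
    ∃ g : Matrix (Fin k) (Fin k) ℂ, g.det ≠ 0 ∧ ∀ i, v' i = ∑ l, g l i • v l := by
  have h1 : ∀ i, ∃ c : Fin k → ℂ, ∑ l, c l • v l = v' i := fun i =>
    (Submodule.mem_span_range_iff_exists_fun ℂ).1 (hspan ▸ Submodule.subset_span ⟨i, rfl⟩)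
  have h2 : ∀ i, ∃ c : Fin k → ℂ, ∑ l, c l • v' l = v i := fun i =>
    (Submodule.mem_span_range_iff_exists_fun ℂ).1 (hspan ▸ Submodule.subset_span ⟨i, rfl⟩)
  choose g hg using h1
  choose g' hg' using h2
  refine ⟨fun l i => g i l, ?_, fun i => (hg i).symm⟩
  have hmul : (of fun l i => g i l : Matrix (Fin k) (Fin k) ℂ) * (of fun l i => g' i l) = 1 := by
    ext l i
    have h3 : ∑ l, (∑ m, g' i m * g m l) • v l = ∑ l, (if l = i then (1 : ℂ) else 0) • v l := by
      simp only [ite_smul, one_smul, zero_smul, Finset.sum_ite_eq', Finset.mem_univ, if_true]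
      rw [← hg' i]
      simp only [← hg, Finset.sum_smul, Finset.smul_sum, smul_smul]
      exact Finset.sum_comm
    have h4 := Fintype.linearIndependent_iff.1 hv
      (fun l => (∑ m, g' i m * g m l) - if l = i then (1 : ℂ) else 0) (by
        simp only [sub_smul, Finset.sum_sub_distrib]
        exact sub_eq_zero.2 h3) l
    rw [mul_apply, one_apply, ← sub_eq_zero.1 h4]
    exact Finset.sum_congr rfl fun m _ => mul_comm _ _
  intro h0
  have := congrArg det hmul
  rw [det_mul, det_one] at this
  change det (of fun l i => g i l) * _ = 1 at this
  rw [show det (of fun l i => g i l : Matrix (Fin k) (Fin k) ℂ) = 0 from h0, zero_mul] at this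
  exact zero_ne_one this

/-- The change of a frame by a square matrix. -/
def frameMul {k r : ℕ} (S : FrameMatrix k r) (g : Matrix (Fin k) (Fin k) ℂ) : FrameMatrix k r :=
  (of S * g : Matrix (Fin k ⊕ Fin r) (Fin k) ℂ)

theorem topBlock_frameMul {k r : ℕ} (S : FrameMatrix k r) (g : Matrix (Fin k) (Fin k) ℂ) :
    topBlock (frameMul S g) = topBlock S * g := rfl

theorem botBlock_frameMul {k r : ℕ} (S : FrameMatrix k r) (g : Matrix (Fin k) (Fin k) ℂ) :
    botBlock (frameMul S g) = botBlock S * g := rfl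

/-- Zg(Bg)⁻¹ = ZB⁻¹: this is why the slope belongs to the subspace and not to the frame. -/
theorem frameSlope_frameMul {k r : ℕ} (S : FrameMatrix k r) (g : Matrix (Fin k) (Fin k) ℂ)
    (hg : g.det ≠ 0) : frameSlope (frameMul S g) = frameSlope S := by
  have : botBlock (frameMul S g) * (topBlock (frameMul S g))⁻¹
      = botBlock S * (topBlock S)⁻¹ := by
    rw [topBlock_frameMul, botBlock_frameMul, Matrix.mul_inv_rev, Matrix.mul_assoc, ← Matrix.mul_assoc g,
      mul_nonsing_inv _ hg.isUnit, Matrix.one_mul]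
  exact this

theorem frameMul_graphFrame_frameSlope {k r : ℕ} {S : FrameMatrix k r}
    (hS : (topBlock S).det ≠ 0) : frameMul (graphFrame (frameSlope S)) (topBlock S) = S := by
  have h2 : (botBlock S * (topBlock S)⁻¹) * topBlock S = botBlock S := by
    rw [Matrix.mul_assoc, nonsing_inv_mul _ hS.isUnit, Matrix.mul_one]
  have h1 : (1 : Matrix (Fin k) (Fin k) ℂ) * topBlock S = topBlock S := Matrix.one_mul _
  funext i j
  rcases i with i | i
  · exact congrFun (congrFun h1 i) j
  · exact congrFun (congrFun h2 i) j

theorem frameSlope_graphFrame {k r : ℕ} (A : Fin r → Fin k → ℂ) :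
    frameSlope (graphFrame A) = A := by
  change (of A * (1 : Matrix (Fin k) (Fin k) ℂ)⁻¹ : Matrix (Fin r) (Fin k) ℂ) = A
  rw [inv_one, Matrix.mul_one]
  rfl

theorem det_topBlock_graphFrame {k r : ℕ} (A : Fin r → Fin k → ℂ) :
    (topBlock (graphFrame A)).det ≠ 0 := by
  change (1 : Matrix (Fin k) (Fin k) ℂ).det ≠ 0
  simp

theorem linearIndependent_col_graphFrame {k r : ℕ} (A : Fin r → Fin k → ℂ) :
    LinearIndependent ℂ (of (graphFrame A)).col := by
  rw [Fintype.linearIndependent_iff]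
  intro c hc i
  have h1 : (∑ j, c j • (of (graphFrame A)).col j) (Sum.inl i) = 0 := congrFun hc (Sum.inl i)
  have h2 : ∀ j, graphFrame A (Sum.inl i) j = if i = j then (1 : ℂ) else 0 := fun j => one_apply
  simpa [Finset.sum_apply, h2] using h1

theorem finrank_grassmannParam (k r : ℕ) :
    Module.finrank ℝ (Fin r → Fin k → ℂ) = 2 * (k * r) := by
  simp only [Module.finrank_pi_fintype, Finset.sum_const, Finset.card_univ,
    Fintype.card_fin, Complex.finrank_real_complex, smul_eq_mul]
  ring

variable {d : ℕ} {X : Type*} [TopologicalSpace X] [ChartedSpace (EuclideanSpace ℝ (Fin d)) X]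
  {F : Type*} [NormedAddCommGroup F] [NormedSpace ℝ F]
  {E : X → Type*} [∀ x, AddCommGroup (E x)] [∀ x, Module ℂ (E x)]
  [TopologicalSpace (TotalSpace F E)] [∀ x, TopologicalSpace (E x)] [FiberBundle F E]
  {EP : Type*} [NormedAddCommGroup EP] [NormedSpace ℝ EP] {HP : Type*} [TopologicalSpace HP]
  {J : ModelWithCorners ℝ EP HP} {P : Type*} [TopologicalSpace P] [ChartedSpace HP P]
  {h : HermitianMetric d F E} {k r : ℕ}

namespace GrassmannBundle

/-- A subspace contains the zero vector, so its set of vectors remembers the base point. Identities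
between subspaces of varying fibres can thus be checked on sets in the total space. -/
theorem vectors_injective : Function.Injective
    (vectors : GrassmannBundle h k → Set (TotalSpace F E)) := by
  rintro ⟨x, S, hS⟩ ⟨x', S', hS'⟩ hv
  have h0 : (⟨x, 0⟩ : TotalSpace F E) ∈ vectors (⟨x', S', hS'⟩ : GrassmannBundle h k) := by
    rw [← hv]
    exact ⟨0, S.zero_mem, rfl⟩
  obtain ⟨v, -, hv0⟩ := h0
  obtain rfl : x' = x := congrArg TotalSpace.proj hv0
  have : S = S' := by
    ext v
    have hinj : Function.Injective (fun v : E x' => (⟨x', v⟩ : TotalSpace F E)) :=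
      TotalSpace.mk_injective x'
    have := congrArg (fun s => (⟨x', v⟩ : TotalSpace F E) ∈ s) hv
    simp only [vectors] at this
    simpa [hinj.eq_iff] using this
  subst this
  rfl

/-- The subspace generated by linearly independent vectors in a fibre. -/
def ofFrame (x : X) (w : Fin k → E x) (hw : LinearIndependent ℂ w) : GrassmannBundle h k where
  base := x
  space := Submodule.span ℂ (Set.range w)
  finrank_eq := by simpa using finrank_span_eq_card hw

/-- A basis of a subspace of a fibre. -/
noncomputable def frame [NeZero k] (W : GrassmannBundle h k) (i : Fin k) : E W.base :=
  haveI := Module.finite_of_finrank_pos (W.finrank_eq.symm ▸ NeZero.pos k)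
  (Module.finBasisOfFinrankEq ℂ W.space W.finrank_eq i : E W.base)

theorem linearIndependent_frame [NeZero k] (W : GrassmannBundle h k) :
    LinearIndependent ℂ W.frame :=
  haveI := Module.finite_of_finrank_pos (W.finrank_eq.symm ▸ NeZero.pos k)
  (Module.finBasisOfFinrankEq ℂ W.space W.finrank_eq).linearIndependent.map' W.space.subtype
    (Submodule.ker_subtype _)

theorem space_eq_span [NeZero k] (W : GrassmannBundle h k) {w : Fin k → E W.base}
    (hw : LinearIndependent ℂ w) (hmem : ∀ i, w i ∈ W.space) :
    W.space = Submodule.span ℂ (Set.range w) := by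
  have := Module.finite_of_finrank_pos (W.finrank_eq.symm ▸ NeZero.pos k)
  refine (Submodule.eq_of_le_of_finrank_eq (Submodule.span_le.2 ?_) ?_).symm
  · rintro _ ⟨i, rfl⟩
    exact hmem i
  · rw [W.finrank_eq]
    simpa using finrank_span_eq_card hw

theorem span_frame [NeZero k] (W : GrassmannBundle h k) :
    Submodule.span ℂ (Set.range W.frame) = W.space := by
  refine (W.space_eq_span W.linearIndependent_frame fun i => ?_).symm
  exact Subtype.property _

theorem eq_ofFrame [NeZero k] (W : GrassmannBundle h k) {w : Fin k → E W.base}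
    (hw : LinearIndependent ℂ w) (hmem : ∀ i, w i ∈ W.space) : W = ofFrame W.base w hw := by
  obtain ⟨x, S, hS⟩ := W
  have := space_eq_span ⟨x, S, hS⟩ hw hmem
  simp only [ofFrame, mk.injEq, heq_eq_eq, true_and]
  exact this

/-- Restrict the metric to the subspace and take an orthonormal basis there. -/
theorem span_surjective [NeZero k] :
    Function.Surjective (StiefelBundle.span : StiefelBundle h k → GrassmannBundle h k) := by
  intro W
  have := Module.finite_of_finrank_pos (W.finrank_eq.symm ▸ NeZero.pos k)
  let f : W.space →ₗ⋆[ℂ] W.space →ₗ[ℂ] ℂ := LinearMap.mk₂'ₛₗ (starRingEnd ℂ) (RingHom.id ℂ)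
    (fun v w => h.form W.base v.1 w.1) (by simp) (by simp) (by simp) (by simp)
  obtain ⟨b, hb, -⟩ := exists_orthonormal_extension_form (f := f)
    (fun v w => h.conj_symm W.base v.1 w.1) (fun v hv => h.pos_def W.base v.1 (by simpa using hv))
    (ι := Fin k) (by simpa using W.finrank_eq) ∅ 0 (by simp)
  let e : StiefelBundle h k := ⟨W.base, fun i => (b i : E W.base), hb⟩
  exact ⟨e, (W.eq_ofFrame (w := e.frame) e.linearIndependent fun i => (b i).2).symm⟩

theorem isQuotientMap_span [NeZero k] :
    IsQuotientMap (StiefelBundle.span : StiefelBundle h k → GrassmannBundle h k) :=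
  ⟨⟨rfl⟩, span_surjective⟩

theorem continuous_span :
    Continuous (StiefelBundle.span : StiefelBundle h k → GrassmannBundle h k) :=
  continuous_coinduced_rng

section Charts

variable [NormedSpace ℂ F] [IsScalarTower ℝ ℂ F] [VectorBundle ℂ F E] [NeZero k]
  (u : UnitaryFrame h (Fin k ⊕ Fin r))

theorem continuous_base : Continuous (base : GrassmannBundle h k → X) :=
  isQuotientMap_span.continuous_iff.2 StiefelBundle.continuous_base

theorem exists_coords_eq {x : X} {w w' : Fin k → E x} (hw : LinearIndependent ℂ w)
    (hspan : Submodule.span ℂ (Set.range w) = Submodule.span ℂ (Set.range w')) :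
    ∃ g : Matrix (Fin k) (Fin k) ℂ, g.det ≠ 0 ∧ u.coords x w' = frameMul (u.coords x w) g := by
  obtain ⟨g, hg, hgw⟩ := exists_change_of_frame hw hspan
  refine ⟨g, hg, ?_⟩
  funext j i
  simp [UnitaryFrame.coords, frameMul, hgw, map_sum, mul_apply, mul_comm]

/-- The slope of a subspace with respect to a unitary frame. -/
noncomputable def slopeIn (W : GrassmannBundle h k) : Fin r → Fin k → ℂ :=
  frameSlope (u.coords W.base W.frame)

/-- The subspaces that are graphs with respect to a unitary frame. -/
def graphs : Set (GrassmannBundle h k) :=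
  base ⁻¹' u.dom ∩ {W | (topBlock (u.coords W.base W.frame)).det ≠ 0}

/-- `slopeIn` is defined with a chosen basis; any other one differs by an invertible matrix, which
the slope ignores. -/
theorem slopeIn_eq (W : GrassmannBundle h k) {w : Fin k → E W.base}
    (hw : Submodule.span ℂ (Set.range w) = W.space) :
    slopeIn u W = frameSlope (u.coords W.base w) := by
  obtain ⟨g, hg, h1⟩ := exists_coords_eq u W.linearIndependent_frame (W.span_frame.trans hw.symm)
  rw [h1, frameSlope_frameMul _ _ hg]
  rfl

theorem mem_graphs_iff (W : GrassmannBundle h k) {w : Fin k → E W.base}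
    (hw : Submodule.span ℂ (Set.range w) = W.space) :
    W ∈ graphs u ↔ W.base ∈ u.dom ∧ (topBlock (u.coords W.base w)).det ≠ 0 := by
  obtain ⟨g, hg, h1⟩ := exists_coords_eq u W.linearIndependent_frame (W.span_frame.trans hw.symm)
  rw [h1, topBlock_frameMul, det_mul]
  simp [graphs, hg]

/-- The graph of a given slope. -/
noncomputable def ofSlope (x : X) (A : Fin r → Fin k → ℂ) : GrassmannBundle h k :=
  ofFrame x (u.comb x (graphFrame A)) (u.linearIndependent_comb x
    (linearIndependent_col_graphFrame A))

theorem slopeIn_ofSlope (x : X) (A : Fin r → Fin k → ℂ) : slopeIn u (ofSlope u x A) = A := by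
  rw [slopeIn_eq u (ofSlope u x A) (w := u.comb x (graphFrame A)) rfl]
  change frameSlope (u.coords x _) = A
  rw [u.coords_comb, frameSlope_graphFrame]

theorem ofSlope_mem_graphs {x : X} (hx : x ∈ u.dom) (A : Fin r → Fin k → ℂ) :
    ofSlope u x A ∈ graphs u := by
  rw [mem_graphs_iff u (ofSlope u x A) (w := u.comb x (graphFrame A)) rfl]
  refine ⟨hx, ?_⟩
  change (topBlock (u.coords x _)).det ≠ 0
  rw [u.coords_comb]
  exact det_topBlock_graphFrame A

/-- If S is the coordinate matrix of a basis of `W` with invertible upper block B, then the graph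
frame of its slope is SB⁻¹. Its vectors thus lie in `W`, and the dimensions agree. -/
theorem ofSlope_slopeIn {W : GrassmannBundle h k} (hW : W ∈ graphs u) :
    ofSlope u W.base (slopeIn u W) = W := by
  refine (W.eq_ofFrame _ ?_).symm
  intro i
  have h1 := frameMul_graphFrame_frameSlope hW.2
  set S := u.coords W.base W.frame with hS
  have hB : IsUnit (topBlock S).det := IsUnit.mk0 _ hW.2
  have h2 : graphFrame (slopeIn u W) = frameMul S (topBlock S)⁻¹ := by
    have h3 : frameMul (frameMul (graphFrame (slopeIn u W)) (topBlock S)) (topBlock S)⁻¹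
        = graphFrame (slopeIn u W) := by
      change (of (graphFrame (slopeIn u W)) * topBlock S) * (topBlock S)⁻¹ = of (graphFrame _)
      rw [Matrix.mul_assoc, mul_nonsing_inv _ hB, Matrix.mul_one]
    rw [← h3]
    exact congrArg (fun T => frameMul T (topBlock S)⁻¹) h1
  have h4 : u.comb W.base (graphFrame (slopeIn u W)) i
      = ∑ l, (topBlock S)⁻¹ l i • W.frame l := by
    rw [h2]
    conv_rhs => rw [← u.comb_coords W.base W.frame]
    simp only [UnitaryFrame.comb, Finset.smul_sum, smul_smul]
    rw [Finset.sum_comm]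
    refine Finset.sum_congr rfl fun j _ => ?_
    rw [← Finset.sum_smul]
    congr 1
    change (of S * (topBlock S)⁻¹) j i = _
    rw [mul_apply]
    exact Finset.sum_congr rfl fun l _ => mul_comm _ _
  rw [h4]
  refine Submodule.sum_mem _ fun l _ => Submodule.smul_mem _ _ ?_
  rw [← W.span_frame]
  exact Submodule.subset_span ⟨l, rfl⟩

theorem span_preimage_graphs : (StiefelBundle.span : StiefelBundle h k → _) ⁻¹' graphs u =
    StiefelBundle.base ⁻¹' u.dom ∩
      (fun e => u.coords e.base e.frame) ⁻¹' {S | (topBlock S).det ≠ 0} := by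
  ext e
  exact mem_graphs_iff u e.span (w := e.frame) rfl

/-- In the quotient topology openness is tested on orthonormal frames, where it is the non-vanishing
of a continuous determinant. -/
theorem isOpen_graphs : IsOpen (graphs u) := by
  rw [← isQuotientMap_span.isOpen_preimage, span_preimage_graphs]
  exact (StiefelBundle.continuousOn_coords u).isOpen_inter_preimage
    (u.isOpen_dom.preimage StiefelBundle.continuous_base) isOpen_det_topBlock_ne_zero

theorem continuousOn_slopeIn : ContinuousOn (slopeIn u) (graphs u) := by
  rw [isQuotientMap_span.continuousOn_isOpen_iff (isOpen_graphs u), span_preimage_graphs]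
  have h1 : (slopeIn u ∘ StiefelBundle.span) = fun e => frameSlope (u.coords e.base e.frame) :=
    funext fun e => slopeIn_eq u e.span (w := e.frame) rfl
  rw [h1]
  exact contDiffOn_frameSlope.continuousOn.comp
    ((StiefelBundle.continuousOn_coords u).mono Set.inter_subset_left) fun e he => he.2

end Charts

/-- Linearly independent smooth sections can locally be orthonormalized to a smooth map into the
Stiefel bundle. -/
theorem exists_orthonormalization [NormedSpace ℂ F] [IsScalarTower ℝ ℂ F] [VectorBundle ℂ F E]
    [NeZero k] {f : P → X} {w : ∀ p, Fin k → E (f p)} {O : Set P} (hO : IsOpen O) {p₀ : P}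
    (hp₀ : p₀ ∈ O) (hf : ContMDiffOn J (𝓡 d) ∞ f O)
    (hw : ∀ i, SmoothSec d F J f (fun p => w p i) O) (hli : ∀ p, LinearIndependent ℂ (w p)) :
    ∃ O' ⊆ O, IsOpen O' ∧ p₀ ∈ O' ∧ ∃ σ : P → StiefelBundle h k,
      (∀ i, ContMDiffOn J ((𝓡 d).prod 𝓘(ℝ, F)) ∞ (fun p => (σ p).vec i) O') ∧
      (∀ p ∈ O', (σ p).span = ofFrame (f p) (w p) (hli p)) ∧
      ((∀ i j, h.form (f p₀) (w p₀ i) (w p₀ j) = if i = j then 1 else 0) →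
        ∀ i, (σ p₀).vec i = ⟨f p₀, w p₀ i⟩) := by
  classical
  obtain ⟨O', hO', ho, hp, s, h1, h2, h3, h4⟩ :=
    h.exists_gramSchmidt (w := fun i p => w p i) hO hp₀ hf hw (hli p₀)
  -- Outside `O'` the frame over `p₀` serves as a default value.
  let σ : P → StiefelBundle h k := fun p =>
    if hp' : p ∈ O' then ⟨f p, fun i => s i p, h2 p hp'⟩ else ⟨f p₀, fun i => s i p₀, h2 p₀ hp⟩
  have hσ : ∀ p (hp : p ∈ O'), σ p = ⟨f p, fun i => s i p, h2 p hp⟩ := fun p hp => dif_pos hp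
  refine ⟨O', hO', ho, hp, σ, fun i => ContMDiffOn.congr (h1 i) fun p hp => ?_,
    fun p hp => ?_, fun hort i => ?_⟩
  · rw [hσ p hp]
    rfl
  · rw [hσ p hp]
    symm
    exact eq_ofFrame (ofFrame (f p) (w p) (hli p)) (StiefelBundle.linearIndependent
      (⟨f p, fun i => s i p, h2 p hp⟩ : StiefelBundle h k)) fun i => h3 p hp i
  · rw [hσ p₀ hp, ← h4 hort i]
    rfl

end GrassmannBundle

end GrassmannCharts

/-! ### Charts, separation and smooth structure of the Grassmann bundle. -/

namespace GrassmannBundle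

open Matrix

variable {d : ℕ} {X : Type*} [TopologicalSpace X] [ChartedSpace (EuclideanSpace ℝ (Fin d)) X]
  {F : Type*} [NormedAddCommGroup F] [NormedSpace ℝ F]
  {E : X → Type*} [∀ x, AddCommGroup (E x)] [∀ x, Module ℂ (E x)]
  [TopologicalSpace (TotalSpace F E)] [∀ x, TopologicalSpace (E x)] [FiberBundle F E]
  {EP : Type*} [NormedAddCommGroup EP] [NormedSpace ℝ EP] {HP : Type*} [TopologicalSpace HP]
  {J : ModelWithCorners ℝ EP HP} {P : Type*} [TopologicalSpace P] [ChartedSpace HP P]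
  {h : HermitianMetric d F E} {k r : ℕ}
  [NormedSpace ℂ F] [IsScalarTower ℝ ℂ F] [VectorBundle ℂ F E] [NeZero k]

/-- The local product structure of the Grassmann bundle given by the slopes of graphs. -/
noncomputable def chart (u : UnitaryFrame h (Fin k ⊕ Fin r)) :
    OpenPartialHomeomorph (GrassmannBundle h k) (X × (Fin r → Fin k → ℂ)) where
  toFun W := (W.base, slopeIn u W)
  invFun z := ofSlope u z.1 z.2
  source := graphs u
  target := u.dom ×ˢ Set.univ
  map_source' W hW := ⟨hW.1, trivial⟩
  map_target' z hz := ofSlope_mem_graphs u hz.1 z.2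
  left_inv' W hW := ofSlope_slopeIn u hW
  right_inv' z _ := Prod.ext rfl (slopeIn_ofSlope u z.1 z.2)
  open_source := isOpen_graphs u
  open_target := u.isOpen_dom.prod isOpen_univ
  continuousOn_toFun := continuous_base.continuousOn.prodMk (continuousOn_slopeIn u)
  continuousOn_invFun := by
    intro z hz
    -- The graph frame is in general not orthonormal. Orthonormalizing it lifts the inverse chart
    -- locally to the Stiefel bundle, from which the span map is continuous.
    obtain ⟨O', -, ho, hz', σ, hσ, hspan, -⟩ := exists_orthonormalization (h := h)
      (J := (𝓡 d).prod 𝓘(ℝ, Fin r → Fin k → ℂ)) (u.isOpen_dom.prod isOpen_univ) hz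
      contMDiffOn_fst (w := fun z : X × (Fin r → Fin k → ℂ) => u.comb z.1 (graphFrame z.2))
      (fun i => u.smoothSec_comb contMDiffOn_fst (fun p hp => hp.1)
        (contDiff_graphFrame.contMDiff.comp_contMDiffOn contMDiffOn_snd) i)
      (fun z => u.linearIndependent_comb z.1 (linearIndependent_col_graphFrame z.2))
    have hc : ContinuousOn σ O' := by
      rw [StiefelBundle.isInducing_vec.continuousOn_iff]
      exact continuousOn_pi.2 fun i => (hσ i).continuousOn
    exact ((continuous_span.comp_continuousOn hc).congr fun p hp =>
      (hspan p hp).symm).continuousAt (ho.mem_nhds hz') |>.continuousWithinAt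

/-- `w` is a smooth family of frames of the subspaces `f p` for `p ∈ O`. -/
structure IsSmoothFrame (J : ModelWithCorners ℝ EP HP) (f : P → GrassmannBundle h k)
    (w : Fin k → P → TotalSpace F E) (O : Set P) : Prop where
  smooth : ∀ i, ContMDiffOn J ((𝓡 d).prod 𝓘(ℝ, F)) ∞ (w i) O
  spans : ∀ p ∈ O, ∃ v : Fin k → E (f p).base, (∀ i, w i p = ⟨(f p).base, v i⟩) ∧
    Submodule.span ℂ (Set.range v) = (f p).space

theorem IsSmoothFrame.exists_smoothSec {f : P → GrassmannBundle h k}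
    {w : Fin k → P → TotalSpace F E} {O : Set P} (hw : IsSmoothFrame J f w O) :
    ∃ v : ∀ p, Fin k → E (f p).base,
      (∀ i, SmoothSec d F J (fun p => (f p).base) (fun p => v p i) O) ∧
      ∀ p ∈ O, Submodule.span ℂ (Set.range (v p)) = (f p).space := by
  choose! v hv using hw.spans
  exact ⟨v, fun i => ContMDiffOn.congr (hw.smooth i) fun p hp => ((hv p hp).1 i).symm,
    fun p hp => (hv p hp).2⟩

theorem IsSmoothFrame.contMDiffOn_base {f : P → GrassmannBundle h k}
    {w : Fin k → P → TotalSpace F E} {O : Set P} (hw : IsSmoothFrame J f w O) :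
    ContMDiffOn J (𝓡 d) ∞ (fun p => (f p).base) O := by
  obtain ⟨v, hv, -⟩ := hw.exists_smoothSec
  exact (hv 0).base

/-- Slopes may be computed in any frame, so a smooth frame of the subspaces is enough and need not
be orthonormal. -/
theorem contMDiffOn_chart_comp (u : UnitaryFrame h (Fin k ⊕ Fin r))
    {f : P → GrassmannBundle h k} {w : Fin k → P → TotalSpace F E} {O : Set P}
    (hw : IsSmoothFrame J f w O) (hO : ∀ p ∈ O, f p ∈ (chart u).source) :
    ContMDiffOn J ((𝓡 d).prod 𝓘(ℝ, Fin r → Fin k → ℂ)) ∞ (fun p => chart u (f p)) O := by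
  obtain ⟨v, hv, hspan⟩ := hw.exists_smoothSec
  refine (hv 0).base.prodMk (ContMDiffOn.congr (ContMDiffOn.comp
    (contMDiffOn_iff_contDiffOn.2 contDiffOn_frameSlope)
    (u.contMDiffOn_coords hv (hv 0).base fun p hp => (hO p hp).1) fun p hp => ?_) fun p hp => ?_)
  · exact ((mem_graphs_iff u (f p) (hspan p hp)).1 (hO p hp)).2
  · exact slopeIn_eq u (f p) (hspan p hp)

theorem isSmoothFrame_chart_symm (u : UnitaryFrame h (Fin k ⊕ Fin r)) :
    IsSmoothFrame ((𝓡 d).prod 𝓘(ℝ, Fin r → Fin k → ℂ)) (chart u).symm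
      (fun i z => ⟨z.1, u.comb z.1 (graphFrame z.2) i⟩) (chart u).target :=
  ⟨fun i => u.smoothSec_comb contMDiffOn_fst (fun _ hp => hp.1)
    (contDiff_graphFrame.contMDiff.comp_contMDiffOn contMDiffOn_snd) i,
    fun z _ => ⟨u.comb z.1 (graphFrame z.2), fun _ => rfl, rfl⟩⟩

theorem IsSmoothFrame.mono {f : P → GrassmannBundle h k}
    {w : Fin k → P → TotalSpace F E} {O O' : Set P} (hw : IsSmoothFrame J f w O)
    (hO : O' ⊆ O) : IsSmoothFrame J f w O' :=
  ⟨fun i => (hw.smooth i).mono hO, fun p hp => hw.spans p (hO hp)⟩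

variable [FiniteDimensional ℂ F] [∀ x, Module ℝ (E x)]
    [VectorBundle ℝ F E] [ContMDiffVectorBundle ∞ F E (𝓡 d)]

/-- Through every orthonormal frame there is a local section of the map to the Grassmann bundle. -/
theorem exists_section (hr : Module.finrank ℂ F = k + r) (e : StiefelBundle h k) :
    ∃ u : UnitaryFrame h (Fin k ⊕ Fin r), e.span ∈ (chart u).source ∧
      ∃ O ⊆ (chart u).target, IsOpen O ∧ chart u e.span ∈ O ∧
        ∃ σ : X × (Fin r → Fin k → ℂ) → StiefelBundle h k,
        (∀ i, ContMDiffOn ((𝓡 d).prod 𝓘(ℝ, Fin r → Fin k → ℂ)) ((𝓡 d).prod 𝓘(ℝ, F)) ∞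
          (fun p => (σ p).vec i) O) ∧
        (∀ p ∈ O, (σ p).span = (chart u).symm p) ∧ σ (chart u e.span) = e := by
  obtain ⟨u, hu, hue⟩ := StiefelBundle.exists_unitaryFrame hr e
  have htop : topBlock (u.coords e.base e.frame) = 1 := StiefelBundle.coords_of_vec_eq u e hue
  have hmem : e.span ∈ (chart u).source := by
    refine (mem_graphs_iff u e.span (w := e.frame) rfl).2 ⟨hu, ?_⟩
    change (topBlock (u.coords e.base e.frame)).det ≠ 0
    rw [htop, det_one]
    exact one_ne_zero
  have hslope : slopeIn u e.span = 0 := by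
    rw [slopeIn_eq u e.span (w := e.frame) rfl]
    change (botBlock (u.coords e.base e.frame) * (topBlock (u.coords e.base e.frame))⁻¹ :
      Matrix (Fin r) (Fin k) ℂ) = 0
    have hbot : botBlock (u.coords e.base e.frame) = 0 := by
      ext i j
      rw [botBlock, UnitaryFrame.coords, ← hue, u.orthonormal]
      simp
    rw [hbot, Matrix.zero_mul]
  -- In the frame adapted to `e` the slope is 0, and the graph frame of slope 0 is `e` itself. Being
  -- orthonormal already, it is left unchanged by Gram–Schmidt, so the section passes through `e`.
  have hcomb : ∀ i, u.comb e.base (graphFrame (slopeIn u e.span)) i = e.frame i := by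
    intro i
    rw [hslope, ← hue]
    have h1 : ∀ a, graphFrame (0 : Fin r → Fin k → ℂ) (Sum.inl a) i = if a = i then (1 : ℂ) else 0 :=
      fun a => one_apply
    have h2 : ∀ a, graphFrame (0 : Fin r → Fin k → ℂ) (Sum.inr a) i = 0 := fun a => rfl
    simp [UnitaryFrame.comb, h1, h2]
  obtain ⟨O', hO', ho, hz', σ, hσ, hspan, hσe⟩ := exists_orthonormalization (h := h)
      (J := (𝓡 d).prod 𝓘(ℝ, Fin r → Fin k → ℂ)) (u.isOpen_dom.prod isOpen_univ)
      ((chart u).map_source hmem)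
      contMDiffOn_fst (w := fun z : X × (Fin r → Fin k → ℂ) => u.comb z.1 (graphFrame z.2))
      (fun i => u.smoothSec_comb contMDiffOn_fst (fun p hp => hp.1)
        (contDiff_graphFrame.contMDiff.comp_contMDiffOn contMDiffOn_snd) i)
      (fun z => u.linearIndependent_comb z.1 (linearIndependent_col_graphFrame z.2))
  refine ⟨u, hmem, O', hO', ho, hz', σ, hσ, hspan, StiefelBundle.vec_ext fun i => ?_⟩
  have hc : ∀ i, u.comb (chart u e.span).1 (graphFrame (chart u e.span).2) i = e.frame i := hcomb
  rw [hσe (fun i j => ?_) i, hc]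
  · rfl
  · rw [hc, hc]
    exact e.orthonormal i j

theorem exists_mem_chart_source (hr : Module.finrank ℂ F = k + r) (W : GrassmannBundle h k) :
    ∃ u : UnitaryFrame h (Fin k ⊕ Fin r), W ∈ (chart u).source := by
  obtain ⟨e, rfl⟩ := span_surjective W
  obtain ⟨u, hu, -⟩ := exists_section hr e
  exact ⟨u, hu⟩

/-- A map with continuous local sections through every point of its source is open. Second
countability then descends to the quotient. -/
theorem isOpenMap_span (hr : Module.finrank ℂ F = k + r) :
    IsOpenMap (StiefelBundle.span : StiefelBundle h k → GrassmannBundle h k) := by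
  rw [isOpenMap_iff_nhds_le]
  intro e N hN
  obtain ⟨u, hu, O, -, ho, heO, σ, hσ, hspan, hσe⟩ := exists_section hr e
  have hc : ContinuousAt σ (chart u e.span) := by
    rw [StiefelBundle.isInducing_vec.continuousAt_iff]
    exact continuousAt_pi.2 fun i => (hσ i).continuousOn.continuousAt (ho.mem_nhds heO)
  have hcc : ContinuousAt (chart u) e.span := (chart u).continuousAt hu
  have hcomp : ContinuousAt (fun W => σ (chart u W)) e.span := hc.comp hcc
  have h1 := hcomp.preimage_mem_nhds (by
    rw [hσe]
    exact hN)
  filter_upwards [h1, hcc.preimage_mem_nhds (ho.mem_nhds heO),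
    (chart u).open_source.mem_nhds hu] with W hW hWO hWs
  have : (σ (chart u W)).span = W := by rw [hspan _ hWO, (chart u).left_inv hWs]
  rw [Set.mem_preimage] at hW
  simpa [this] using hW

variable (h k) in
theorem secondCountableTopology [SecondCountableTopology X] (hr : Module.finrank ℂ F = k + r) :
    SecondCountableTopology (GrassmannBundle h k) := by
  have := StiefelBundle.secondCountableTopology h k
  exact isQuotientMap_span.secondCountableTopology (isOpenMap_span hr)

/-- The orthogonal projection to a subspace, in the coordinates of a unitary frame. -/
noncomputable def projectionIn (u : UnitaryFrame h (Fin k ⊕ Fin r)) (W : GrassmannBundle h k) :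
    Fin k ⊕ Fin r → Fin k ⊕ Fin r → ℂ :=
  fun i j => ∑ l, u.coords (Function.surjInv span_surjective W).base
      (Function.surjInv span_surjective W).frame i l *
    star (u.coords (Function.surjInv span_surjective W).base
      (Function.surjInv span_surjective W).frame j l)

/-- Two orthonormal bases of a subspace differ by a unitary g, and (Sg)(Sg)* = SS*. -/
theorem coords_mul_conjTranspose_eq (u : UnitaryFrame h (Fin k ⊕ Fin r)) {e e' : StiefelBundle h k}
    (he : e.span = e'.span) :
    (of (u.coords e.base e.frame) * (of (u.coords e.base e.frame))ᴴ) =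
      (of (u.coords e'.base e'.frame) * (of (u.coords e'.base e'.frame))ᴴ) := by
  have horth := StiefelBundle.coords_orthonormal u e
  have horth' := StiefelBundle.coords_orthonormal u e'
  obtain ⟨x, w, hw⟩ := e
  obtain ⟨x', w', hw'⟩ := e'
  obtain rfl : x = x' := congrArg GrassmannBundle.base he
  have hs : Submodule.span ℂ (Set.range w) = Submodule.span ℂ (Set.range w') := by
    simpa [StiefelBundle.span] using he
  obtain ⟨g, -, hg⟩ := exists_coords_eq u (linearIndependent_of_orthonormal_form hw) hs
  have hg' : (of (u.coords x w')) = of (u.coords x w) * g := congrArg of hg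
  simp only at horth horth' ⊢
  rw [hg', conjTranspose_mul, Matrix.mul_assoc, ← Matrix.mul_assoc _ _ g, horth,
    Matrix.one_mul] at horth'
  have hgg : g * gᴴ = 1 := mul_eq_one_comm.1 horth'
  rw [hg', conjTranspose_mul, Matrix.mul_assoc, ← Matrix.mul_assoc g, hgg, Matrix.one_mul]

theorem projectionIn_span (u : UnitaryFrame h (Fin k ⊕ Fin r)) (e : StiefelBundle h k) :
    projectionIn u e.span = fun i j => ∑ l, u.coords e.base e.frame i l *
      star (u.coords e.base e.frame j l) :=
  coords_mul_conjTranspose_eq u (Function.surjInv_eq span_surjective e.span)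

theorem continuousOn_projectionIn (u : UnitaryFrame h (Fin k ⊕ Fin r)) :
    ContinuousOn (projectionIn u) (base ⁻¹' u.dom : Set (GrassmannBundle h k)) := by
  rw [isQuotientMap_span.continuousOn_isOpen_iff (u.isOpen_dom.preimage continuous_base)]
  have h1 : projectionIn u ∘ StiefelBundle.span = fun e : StiefelBundle h k => fun i j =>
      ∑ l, u.coords e.base e.frame i l * star (u.coords e.base e.frame j l) :=
    funext fun e => projectionIn_span u e
  rw [h1]
  have h2 := StiefelBundle.continuousOn_coords (k := k) u
  have h3 : ∀ i l, ContinuousOn (fun e : StiefelBundle h k => u.coords e.base e.frame i l)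
      (StiefelBundle.base ⁻¹' u.dom) := fun i l =>
    continuousOn_pi.1 (continuousOn_pi.1 h2 i) l
  exact continuousOn_pi.2 fun i => continuousOn_pi.2 fun j =>
    continuousOn_finsetSum _ fun l _ => (h3 i l).mul (h3 j l).star

/-- From S*S = 1 and SS* = S'S'* follows S = S'(S'*S), so one subspace lies in the other, which has
the same dimension. -/
theorem eq_of_projectionIn_eq (u : UnitaryFrame h (Fin k ⊕ Fin r)) {W W' : GrassmannBundle h k}
    (hb : W.base = W'.base) (hp : projectionIn u W = projectionIn u W') : W = W' := by
  obtain ⟨e, rfl⟩ := span_surjective W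
  obtain ⟨e', rfl⟩ := span_surjective W'
  rw [projectionIn_span, projectionIn_span] at hp
  have horth := StiefelBundle.coords_orthonormal u e
  obtain ⟨x, w, hw⟩ := e
  obtain ⟨x', w', hw'⟩ := e'
  obtain rfl : x = x' := hb
  simp only at horth hp
  have hp' : of (u.coords x w) * (of (u.coords x w))ᴴ = of (u.coords x w') * (of (u.coords x w'))ᴴ :=
    hp
  have h1 : of (u.coords x w) = of (u.coords x w') * ((of (u.coords x w'))ᴴ * of (u.coords x w)) := by
    rw [← Matrix.mul_assoc, ← hp', Matrix.mul_assoc, horth, Matrix.mul_one]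
  have hli : LinearIndependent ℂ w := linearIndependent_of_orthonormal_form hw
  refine (eq_ofFrame (h := h) ⟨x, Submodule.span ℂ (Set.range w'),
    (⟨x, w', hw'⟩ : StiefelBundle h k).span.finrank_eq⟩ (w := w) hli fun i => ?_).symm
  set g := (of (u.coords x w'))ᴴ * of (u.coords x w)
  have h2 : w i = ∑ l, g l i • w' l := by
    conv_lhs => rw [← u.comb_coords x w]
    conv_rhs => rw [← u.comb_coords x w']
    simp only [UnitaryFrame.comb, Finset.smul_sum, smul_smul]
    rw [Finset.sum_comm]
    refine Finset.sum_congr rfl fun j _ => ?_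
    rw [← Finset.sum_smul]
    congr 1
    have h3 : u.coords x w j i = ∑ l, u.coords x w' j l * g l i := congrFun (congrFun h1 j) i
    rw [h3]
    exact Finset.sum_congr rfl fun l _ => mul_comm _ _
  rw [h2]
  exact Submodule.sum_mem _ fun l _ => Submodule.smul_mem _ _ (Submodule.subset_span ⟨l, rfl⟩)

-- Two subspaces of one fibre need not be graphs in a common chart, but their orthogonal projections
-- are continuous over the whole domain of a unitary frame and separate them.
variable (h k) in
theorem t2Space [T2Space X] (hr : Module.finrank ℂ F = k + r) : T2Space (GrassmannBundle h k) := by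
  refine ⟨fun W W' hne => ?_⟩
  by_cases hb : W.base = W'.base
  · obtain ⟨u, hu⟩ := exists_mem_chart_source hr W
    have hW : W ∈ base ⁻¹' u.dom := hu.1
    have hW' : W' ∈ base ⁻¹' u.dom := by rwa [Set.mem_preimage, ← hb]
    have hne' : projectionIn u W ≠ projectionIn u W' := fun hp =>
      hne (eq_of_projectionIn_eq u hb hp)
    obtain ⟨A, B, hA, hB, hWA, hWB, hAB⟩ := t2_separation hne'
    have hopen : IsOpen (base ⁻¹' u.dom : Set (GrassmannBundle h k)) :=
      u.isOpen_dom.preimage continuous_base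
    exact ⟨_, _, (continuousOn_projectionIn u).isOpen_inter_preimage hopen hA,
      (continuousOn_projectionIn u).isOpen_inter_preimage hopen hB, ⟨hW, hWA⟩, ⟨hW', hWB⟩,
      (hAB.preimage (projectionIn u)).mono Set.inter_subset_right Set.inter_subset_right⟩
  · exact separated_by_continuous continuous_base hb

/-- The smooth structure is the one given by the charts `GrassmannBundle.chart`. -/
structure IsAdapted (n r : ℕ) (h : HermitianMetric d F E)
    [ChartedSpace (EuclideanSpace ℝ (Fin n)) (GrassmannBundle h k)] : Prop where
  isManifold : IsManifold (𝓡 n) ∞ (GrassmannBundle h k)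
  smooth : ∀ u : UnitaryFrame h (Fin k ⊕ Fin r),
    ContMDiffOn (𝓡 n) ((𝓡 d).prod 𝓘(ℝ, Fin r → Fin k → ℂ)) ∞ (chart u) (chart u).source
  smooth_symm : ∀ u : UnitaryFrame h (Fin k ⊕ Fin r),
    ContMDiffOn ((𝓡 d).prod 𝓘(ℝ, Fin r → Fin k → ℂ)) (𝓡 n) ∞ (chart u).symm (chart u).target

-- The inverse charts carry the graph frames as smooth frames, which makes the transition maps
-- smooth.
variable (h) in
theorem exists_isAdapted [IsManifold (𝓡 d) ∞ X] (hr : Module.finrank ℂ F = k + r)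
    {n : ℕ} (hn : n = d + 2 * (k * r)) :
    ∃ _ : ChartedSpace (EuclideanSpace ℝ (Fin n)) (GrassmannBundle h k),
      IsAdapted (k := k) n r h := by
  obtain ⟨cs, h1, h2⟩ := exists_chartedSpace_of_local_products (d := d) (m := n)
    (fun u : UnitaryFrame h (Fin k ⊕ Fin r) => chart (h := h) (k := k) u)
    (exists_mem_chart_source hr) (fun u v => contMDiffOn_chart_comp v
      ((isSmoothFrame_chart_symm u).mono Set.inter_subset_left) fun p hp => hp.2)
    (by rw [finrank_grassmannParam, hn])
  exact ⟨cs, h1, fun u => (h2 u).1, fun u => (h2 u).2⟩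

variable {n : ℕ} [ChartedSpace (EuclideanSpace ℝ (Fin n)) (GrassmannBundle h k)]

theorem IsAdapted.contMDiff_base (ha : IsAdapted (k := k) n r h)
    (hr : Module.finrank ℂ F = k + r) :
    ContMDiff (𝓡 n) (𝓡 d) ∞ (base : GrassmannBundle h k → X) := by
  intro W
  obtain ⟨u, hu⟩ := exists_mem_chart_source hr W
  exact contMDiffAt_fst.comp W
    ((ha.smooth u).contMDiffAt ((chart u).open_source.mem_nhds hu))

theorem IsAdapted.contMDiffOn (ha : IsAdapted (k := k) n r h) (hr : Module.finrank ℂ F = k + r)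
    {f : P → GrassmannBundle h k} {w : Fin k → P → TotalSpace F E} {O : Set P} (hO : IsOpen O)
    (hw : IsSmoothFrame J f w O) : ContMDiffOn J (𝓡 n) ∞ f O := by
  obtain ⟨v, hv, hspan⟩ := hw.exists_smoothSec
  intro p hp
  obtain ⟨u, hu⟩ := exists_mem_chart_source hr (f p)
  have hb : ContMDiffOn J (𝓡 d) ∞ (fun p => (f p).base) O := hw.contMDiffOn_base
  have hO1 : IsOpen (O ∩ (fun p => (f p).base) ⁻¹' u.dom) :=
    hb.continuousOn.isOpen_inter_preimage hO u.isOpen_dom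
  have hc := u.contMDiffOn_coords (fun i => (hv i).mono Set.inter_subset_left)
    (hb.mono Set.inter_subset_left) (O := O ∩ (fun p => (f p).base) ⁻¹' u.dom) fun p hp => hp.2
  -- Continuity of `f` is not presupposed: the set where `f` lands in the chart is open because it
  -- is described by the smooth frame.
  have hO2 := hc.continuousOn.isOpen_inter_preimage hO1 isOpen_det_topBlock_ne_zero
  set O2 := O ∩ (fun p => (f p).base) ⁻¹' u.dom ∩
    (fun p => u.coords (f p).base (v p)) ⁻¹' {S | (topBlock S).det ≠ 0} with hO2def
  have hpO : p ∈ O2 :=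
    ⟨⟨hp, hu.1⟩, ((mem_graphs_iff u (f p) (hspan p hp)).1 hu).2⟩
  have hsrc : ∀ q ∈ O2, f q ∈ (chart u).source := fun q hq =>
    (mem_graphs_iff u (f q) (hspan q hq.1.1)).2 ⟨hq.1.2, hq.2⟩
  have hsub : O2 ⊆ O := fun q hq => hq.1.1
  have h1 := ((ha.smooth_symm u).comp (contMDiffOn_chart_comp u (hw.mono hsub) hsrc)
    (fun q hq => (chart u).map_source (hsrc q hq))).contMDiffAt (hO2.mem_nhds hpO)
  refine (h1.congr_of_eventuallyEq ?_).contMDiffWithinAt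
  filter_upwards [hO2.mem_nhds hpO] with q hq
  exact ((chart u).left_inv (hsrc q hq)).symm

/-- Near every subspace there is a smooth family of frames of the nearby subspaces. -/
theorem IsAdapted.exists_isSmoothFrame_id (ha : IsAdapted (k := k) n r h)
    (hr : Module.finrank ℂ F = k + r) (W : GrassmannBundle h k) :
    ∃ O, IsOpen O ∧ W ∈ O ∧ ∃ w, IsSmoothFrame (𝓡 n) (id : GrassmannBundle h k → _) w O := by
  obtain ⟨u, hu⟩ := exists_mem_chart_source hr W
  have h1 := isSmoothFrame_chart_symm u
  refine ⟨(chart u).source, (chart u).open_source, hu,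
    fun i W => ⟨W.base, u.comb W.base (graphFrame (slopeIn u W)) i⟩, fun i => ?_, fun W hW => ?_⟩
  · exact (h1.smooth i).comp (ha.smooth u) (chart u).mapsTo
  · refine ⟨u.comb W.base (graphFrame (slopeIn u W)), fun i => rfl, ?_⟩
    have h2 : ofSlope u W.base (slopeIn u W) = W := ofSlope_slopeIn u hW
    obtain ⟨x, S, hS⟩ := W
    simpa [ofSlope, ofFrame] using h2

theorem IsAdapted.isSmoothManifold [T2Space X] [SecondCountableTopology X]
    (ha : IsAdapted (k := k) n r h) (hr : Module.finrank ℂ F = k + r) :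
    IsSmoothManifold n (GrassmannBundle h k) :=
  ⟨t2Space h k hr, secondCountableTopology h k hr, ha.isManifold⟩

variable {m : ℕ} [ChartedSpace (EuclideanSpace ℝ (Fin m)) (StiefelBundle h k)]

theorem IsAdapted.contMDiff_span (ha : IsAdapted (k := k) n r h)
    (hs : StiefelBundle.IsAdapted (k := k) m r h) (hr : Module.finrank ℂ F = k + r) :
    ContMDiff (𝓡 m) (𝓡 n) ∞ (StiefelBundle.span : StiefelBundle h k → GrassmannBundle h k) :=
  contMDiffOn_univ.1 (ha.contMDiffOn hr isOpen_univ (w := fun i e => e.vec i)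
    ⟨fun i => (hs.contMDiff_vec hr i).contMDiffOn, fun e _ => ⟨e.frame, fun _ => rfl, rfl⟩⟩)

/-- A smooth local section through `e` provides a right inverse of the differential at `e`. -/
theorem IsAdapted.submersion (ha : IsAdapted (k := k) n r h)
    (hs : StiefelBundle.IsAdapted (k := k) m r h) (hr : Module.finrank ℂ F = k + r)
    (e : StiefelBundle h k) : Function.Surjective
      (mfderiv (𝓡 m) (𝓡 n) (StiefelBundle.span : StiefelBundle h k → GrassmannBundle h k) e) := by
  obtain ⟨u, hu, O, -, ho, heO, σ, hσ, hspan, hσe⟩ := exists_section hr e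
  have h1 : ContMDiffAt (𝓡 n) (𝓡 m) ∞ (fun W => σ (chart u W)) e.span :=
    ContMDiffAt.comp e.span ((hs.contMDiffOn hr ho hσ).contMDiffAt (ho.mem_nhds heO))
      ((ha.smooth u).contMDiffAt ((chart u).open_source.mem_nhds hu))
  have h2 : (fun W => (σ (chart u W)).span) =ᶠ[𝓝 e.span] id := by
    filter_upwards [((chart u).continuousAt hu).preimage_mem_nhds (ho.mem_nhds heO),
      (chart u).open_source.mem_nhds hu] with W hW hWs
    rw [hspan _ hW, (chart u).left_inv hWs]
    rfl
  have h3 : Function.Surjective (mfderiv (𝓡 m) (𝓡 n)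
      (StiefelBundle.span : StiefelBundle h k → GrassmannBundle h k) (σ (chart u e.span))) := by
    have h4 := mfderiv_comp e.span (g := (StiefelBundle.span : StiefelBundle h k → _))
      ((ha.contMDiff_span hs hr _).mdifferentiableAt (by simp))
      (h1.mdifferentiableAt (by simp : (∞ : WithTop ℕ∞) ≠ 0))
    have h5 : mfderiv (𝓡 n) (𝓡 n) (StiefelBundle.span ∘ fun W => σ (chart u W)) e.span
        = ContinuousLinearMap.id ℝ (TangentSpace (𝓡 n) e.span) := by
      rw [← mfderiv_id (I := 𝓡 n) (x := e.span)]
      exact h2.mfderiv_eq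
    rw [h5] at h4
    intro y
    exact ⟨_, (DFunLike.congr_fun h4 y).symm⟩
  rwa [hσe] at h3

theorem IsAdapted.isGrassmannManifold [T2Space X] [SecondCountableTopology X]
    (ha : IsAdapted (k := k) n r h) (hs : StiefelBundle.IsAdapted (k := k) m r h)
    (hr : Module.finrank ℂ F = k + r) : IsGrassmannManifold m n h k :=
  ⟨ha.isSmoothManifold hr, ha.contMDiff_span hs hr, ha.submersion hs hr⟩

end GrassmannBundle

/-! ### The model fibre, as a bundle over a point. -/

section ModelFibre

open Matrix

variable {EP : Type*} [NormedAddCommGroup EP] [NormedSpace ℝ EP] {HP : Type*} [TopologicalSpace HP]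
  {J : ModelWithCorners ℝ EP HP} {P : Type*} [TopologicalSpace P] [ChartedSpace HP P]

/-- Smooth sections of a trivial bundle are smooth functions. -/
theorem smoothSec_trivial_iff {d : ℕ} {X : Type*} [TopologicalSpace X]
    [ChartedSpace (EuclideanSpace ℝ (Fin d)) X] {F : Type*} [NormedAddCommGroup F] [NormedSpace ℝ F]
    {f : P → X} {w : P → F} {O : Set P} :
    SmoothSec d F J (E := Trivial X F) f w O ↔
      ContMDiffOn J (𝓡 d) ∞ f O ∧ ContMDiffOn J 𝓘(ℝ, F) ∞ w O :=
  ⟨fun h => ⟨fun p hp => (contMDiffWithinAt_totalSpace.1 (h p hp)).1,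
      fun p hp => (contMDiffWithinAt_totalSpace.1 (h p hp)).2⟩,
    fun h p hp => contMDiffWithinAt_totalSpace.2 ⟨h.1 p hp, h.2 p hp⟩⟩

/-- The one-point manifold. -/
abbrev PointManifold : Type := EuclideanSpace ℝ (Fin 0)

theorem contMDiff_dotProduct_star {ι : Type*} [Fintype ι] {v w : P → ι → ℂ} {O : Set P}
    (hv : ContMDiffOn J 𝓘(ℝ, ι → ℂ) ∞ v O) (hw : ContMDiffOn J 𝓘(ℝ, ι → ℂ) ∞ w O) :
    ContMDiffOn J 𝓘(ℝ, ℂ) ∞ (fun p => star (v p) ⬝ᵥ w p) O := by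
  have h1 : ContDiff ℝ ∞ (fun z : (ι → ℂ) × (ι → ℂ) => star z.1 ⬝ᵥ z.2) :=
    ContDiff.sum fun i _ => (Complex.conjCLE.contDiff.comp
      ((contDiff_apply ℝ ℂ i).comp contDiff_fst)).mul ((contDiff_apply ℝ ℂ i).comp contDiff_snd)
  exact h1.contMDiff.comp_contMDiffOn (hv.prodMk_space hw)

/-- The standard Hermitian form on `ι → ℂ`. -/
noncomputable def stdForm (ι : Type*) [Fintype ι] : (ι → ℂ) →ₗ⋆[ℂ] (ι → ℂ) →ₗ[ℂ] ℂ :=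
  LinearMap.mk₂'ₛₗ (starRingEnd ℂ) (RingHom.id ℂ) (fun v w => star v ⬝ᵥ w)
    (fun v v' w => by simp [add_dotProduct]) (fun c v w => by simp)
    (fun v w w' => by simp [dotProduct_add]) (fun c v w => by simp)

theorem stdForm_apply {ι : Type*} [Fintype ι] (v w : ι → ℂ) :
    stdForm ι v w = ∑ i, star (v i) * w i := rfl

theorem stdForm_conj_symm {ι : Type*} [Fintype ι] (v w : ι → ℂ) :
    starRingEnd ℂ (stdForm ι v w) = stdForm ι w v := by
  simp [stdForm_apply, map_sum, mul_comm]

theorem stdForm_pos {ι : Type*} [Fintype ι] {v : ι → ℂ} (hv : v ≠ 0) :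
    0 < (stdForm ι v v).re := by
  obtain ⟨i, hi⟩ := Function.ne_iff.1 hv
  have h1 : ∀ i, (star (v i) * v i).re = Complex.normSq (v i) := fun i => by
    rw [Complex.star_def, ← Complex.normSq_eq_conj_mul_self, Complex.ofReal_re]
  rw [stdForm_apply, Complex.re_sum]
  simp only [h1]
  exact Finset.sum_pos' (fun i _ => Complex.normSq_nonneg _)
    ⟨i, Finset.mem_univ _, Complex.normSq_pos.2 hi⟩

/-- The standard metric of the trivial bundle over a point. -/
noncomputable def stdMetric (ι : Type) [Fintype ι] :
    HermitianMetric 0 (ι → ℂ) (Trivial PointManifold (ι → ℂ)) where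
  form _ := stdForm ι
  conj_symm _ := stdForm_conj_symm
  pos_def _ _ := stdForm_pos
  smooth := by
    have h1 : SmoothSec 0 ((ι → ℂ) × (ι → ℂ)) ((𝓡 0).prod 𝓘(ℝ, (ι → ℂ) × (ι → ℂ)))
        (E := Trivial PointManifold (ι → ℂ) ×ᵇ Trivial PointManifold (ι → ℂ))
        (fun z : TotalSpace ((ι → ℂ) × (ι → ℂ)) (Trivial PointManifold (ι → ℂ) ×ᵇ
          Trivial PointManifold (ι → ℂ)) => z.1) (fun z => z.2) Set.univ := contMDiffOn_id
    exact contMDiffOn_univ.1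
      (contMDiff_dotProduct_star (smoothSec_trivial_iff.1 h1.fst).2 (smoothSec_trivial_iff.1 h1.snd).2)

end ModelFibre

/-! ### Isometric coordinates in the fibres. -/

section FibreCoordinates

variable {d : ℕ} {X : Type*} [TopologicalSpace X] [ChartedSpace (EuclideanSpace ℝ (Fin d)) X]
  {F : Type*} [NormedAddCommGroup F] [NormedSpace ℝ F]
  {E : X → Type*} [∀ x, AddCommGroup (E x)] [∀ x, Module ℂ (E x)]
  [TopologicalSpace (TotalSpace F E)] [∀ x, TopologicalSpace (E x)] [FiberBundle F E]
  {EP : Type*} [NormedAddCommGroup EP] [NormedSpace ℝ EP] {HP : Type*} [TopologicalSpace HP]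
  {J : ModelWithCorners ℝ EP HP} {P : Type*} [TopologicalSpace P] [ChartedSpace HP P]
  {h : HermitianMetric d F E} {k r : ℕ}
  [NormedSpace ℂ F] [IsScalarTower ℝ ℂ F] [VectorBundle ℂ F E]

/-- A local unitary frame gives coordinates in the fibres. -/
def UnitaryFrame.coordEquiv {ι : Type} [Fintype ι] [DecidableEq ι] (u : UnitaryFrame h ι) (x : X) :
    E x ≃ₗ[ℂ] (ι → ℂ) where
  toFun v j := h.form x (u.vec j x) v
  invFun c := ∑ j, c j • u.vec j x
  left_inv v := (u.repr x v).symm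
  right_inv c := by
    funext j
    simp [map_sum, u.orthonormal]
  map_add' v w := by
    funext j
    simp
  map_smul' c v := by
    funext j
    simp

theorem UnitaryFrame.stdForm_coordEquiv {ι : Type} [Fintype ι] [DecidableEq ι]
    (u : UnitaryFrame h ι) (x : X) (v w : E x) :
    stdForm ι (u.coordEquiv x v) (u.coordEquiv x w) = h.form x v w := by
  conv_rhs => rw [u.repr x v, u.repr x w]
  simp [stdForm_apply, UnitaryFrame.coordEquiv, map_sum, u.orthonormal, mul_comm, h.conj_symm]

theorem UnitaryFrame.contMDiffOn_coordEquiv {ι : Type} [Fintype ι] [DecidableEq ι]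
    (u : UnitaryFrame h ι) {z : P → TotalSpace F E} {O : Set P}
    (hz : ContMDiffOn J ((𝓡 d).prod 𝓘(ℝ, F)) ∞ z O) (hO : ∀ p ∈ O, (z p).proj ∈ u.dom) :
    ContMDiffOn J 𝓘(ℝ, ι → ℂ) ∞ (fun p => u.coordEquiv (z p).proj (z p).2) O :=
  contMDiffOn_pi_space.2 fun j => (u.contMDiffOn_form_vec j).comp hz hO

theorem UnitaryFrame.contMDiffOn_coordEquiv_symm {ι : Type} [Fintype ι] [DecidableEq ι]
    (u : UnitaryFrame h ι) {f : P → X} {c : P → ι → ℂ} {O : Set P}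
    (hf : ContMDiffOn J (𝓡 d) ∞ f O) (hc : ContMDiffOn J 𝓘(ℝ, ι → ℂ) ∞ c O)
    (hO : ∀ p ∈ O, f p ∈ u.dom) :
    SmoothSec d F J f (fun p => (u.coordEquiv (f p)).symm (c p)) O :=
  SmoothSec.sum Finset.univ hf fun j _ => SmoothSec.smul
    (contMDiffOn_pi_space.1 hc j) (smoothSec_comp (u.smooth j) hf hO)

/-! ### Local triviality of the Stiefel bundle. -/

section StiefelTrivialization

variable [FiniteDimensional ℂ F] [∀ x, Module ℝ (E x)]
    [VectorBundle ℝ F E] [ContMDiffVectorBundle ∞ F E (𝓡 d)] [NeZero k]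
  {m n : ℕ} [ChartedSpace (EuclideanSpace ℝ (Fin m)) (StiefelBundle h k)]
  [ChartedSpace (EuclideanSpace ℝ (Fin n)) (StiefelBundle (stdMetric (Fin k ⊕ Fin r)) k)]

theorem StiefelBundle.IsAdapted.contMDiff_base (ha : StiefelBundle.IsAdapted (k := k) m r h)
    (hr : Module.finrank ℂ F = k + r) :
    ContMDiff (𝓡 m) (𝓡 d) ∞ (StiefelBundle.base : StiefelBundle h k → X) := fun e =>
  (contMDiffAt_totalSpace.1 (ha.contMDiff_vec hr 0 e)).1

/-- The coordinates of an orthonormal frame, as a frame in the model fibre. -/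
def StiefelBundle.toModel (u : UnitaryFrame h (Fin k ⊕ Fin r)) (e : StiefelBundle h k) :
    StiefelBundle (stdMetric (Fin k ⊕ Fin r)) k where
  base := 0
  frame i := u.coordEquiv e.base (e.frame i)
  orthonormal i j := (u.stdForm_coordEquiv e.base _ _).trans (e.orthonormal i j)

/-- The orthonormal frame over a point whose coordinates are a given frame in the model fibre. -/
def StiefelBundle.ofModel (u : UnitaryFrame h (Fin k ⊕ Fin r)) (x : X)
    (y : StiefelBundle (stdMetric (Fin k ⊕ Fin r)) k) : StiefelBundle h k where
  base := x
  frame i := (u.coordEquiv x).symm (y.frame i)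
  orthonormal i j := by
    rw [← u.stdForm_coordEquiv, LinearEquiv.apply_symm_apply, LinearEquiv.apply_symm_apply]
    exact y.orthonormal i j

theorem StiefelBundle.contMDiffOn_toModel (ha : StiefelBundle.IsAdapted (k := k) m r h)
    (hY : StiefelBundle.IsAdapted (k := k) n r (stdMetric (Fin k ⊕ Fin r)))
    (hr : Module.finrank ℂ F = k + r) (u : UnitaryFrame h (Fin k ⊕ Fin r)) :
    ContMDiffOn (𝓡 m) (𝓡 n) ∞ (StiefelBundle.toModel u)
      (StiefelBundle.base ⁻¹' u.dom : Set (StiefelBundle h k)) := by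
  refine hY.contMDiffOn (by simp) (u.isOpen_dom.preimage StiefelBundle.continuous_base) fun i => ?_
  refine smoothSec_trivial_iff.2 ⟨contMDiffOn_const, ?_⟩
  exact u.contMDiffOn_coordEquiv (ha.contMDiff_vec hr i).contMDiffOn fun e he => he

theorem StiefelBundle.contMDiffOn_ofModel (ha : StiefelBundle.IsAdapted (k := k) m r h)
    (hY : StiefelBundle.IsAdapted (k := k) n r (stdMetric (Fin k ⊕ Fin r)))
    (hr : Module.finrank ℂ F = k + r) (u : UnitaryFrame h (Fin k ⊕ Fin r)) :
    ContMDiffOn ((𝓡 d).prod (𝓡 n)) (𝓡 m) ∞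
      (fun z : X × StiefelBundle (stdMetric (Fin k ⊕ Fin r)) k => StiefelBundle.ofModel u z.1 z.2)
      (u.dom ×ˢ Set.univ) := by
  refine ha.contMDiffOn hr (u.isOpen_dom.prod isOpen_univ) fun i => ?_
  have h1 : SmoothSec 0 (Fin k ⊕ Fin r → ℂ) (𝓡 n)
      (E := Trivial PointManifold (Fin k ⊕ Fin r → ℂ))
      (StiefelBundle.base : StiefelBundle (stdMetric (Fin k ⊕ Fin r)) k → PointManifold)
      (fun y => y.frame i) Set.univ := (hY.contMDiff_vec (by simp) i).contMDiffOn
  exact u.contMDiffOn_coordEquiv_symm contMDiffOn_fst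
    ((smoothSec_trivial_iff.1 h1).2.comp contMDiffOn_snd fun _ _ => trivial) fun p hp => hp.1

/-- A unitary frame is a smooth family of isometries from the fibres to ℂ^(k+r), hence transports
orthonormal frames in both directions. The model fibre is the Stiefel bundle over a point, so its
manifold structure needs no separate argument. -/
theorem StiefelBundle.isSmoothFibreBundle [T2Space X] [SecondCountableTopology X]
    (ha : StiefelBundle.IsAdapted (k := k) m r h) (hr : Module.finrank ℂ F = k + r) :
    IsSmoothFibreBundle m d (StiefelBundle.base : StiefelBundle h k → X) := by
  obtain ⟨cs, hY⟩ := StiefelBundle.exists_isAdapted (k := k) (r := r)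
    (stdMetric (Fin k ⊕ Fin r)) (by simp) (m := 0 + k * (k + 2 * r)) rfl
  refine ⟨_, StiefelBundle (stdMetric (Fin k ⊕ Fin r)) k, inferInstance, cs,
    hY.isSmoothManifold, fun x => ?_⟩
  have hcard : Module.finrank ℂ F = Fintype.card (Fin k ⊕ Fin r) := by simp [hr]
  obtain ⟨b, hb, -⟩ := h.exists_orthonormal_extension x hcard ∅ (fun _ => 0) (by simp)
  obtain ⟨u, hu, -⟩ := h.exists_unitaryFrame hcard x b hb
  have h1 := StiefelBundle.contMDiffOn_toModel ha hY hr u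
  have h2 := StiefelBundle.contMDiffOn_ofModel ha hY hr u
  refine ⟨{ toFun := fun e => (e.base, StiefelBundle.toModel u e)
            invFun := fun z => StiefelBundle.ofModel u z.1 z.2
            source := StiefelBundle.base ⁻¹' u.dom
            target := u.dom ×ˢ Set.univ
            map_source' := fun e he => ⟨he, trivial⟩
            map_target' := fun z hz => hz.1
            left_inv' := fun e _ => StiefelBundle.vec_ext fun i => ?_
            right_inv' := fun z _ => Prod.ext rfl (StiefelBundle.vec_ext fun i => ?_)
            open_source := u.isOpen_dom.preimage StiefelBundle.continuous_base
            open_target := u.isOpen_dom.prod isOpen_univ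
            continuousOn_toFun := StiefelBundle.continuous_base.continuousOn.prodMk h1.continuousOn
            continuousOn_invFun := h2.continuousOn
            baseSet := u.dom
            open_baseSet := u.isOpen_dom
            source_eq := rfl
            target_eq := rfl
            proj_toFun := fun e _ => rfl }, hu,
          (ha.contMDiff_base hr).contMDiffOn.prodMk h1, h2⟩
  · simp [StiefelBundle.ofModel, StiefelBundle.toModel, StiefelBundle.vec]
  · obtain ⟨x, y⟩ := z
    have : y.base = 0 := Subsingleton.elim _ _
    simp [StiefelBundle.ofModel, StiefelBundle.toModel, StiefelBundle.vec, this]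

end StiefelTrivialization

/-! ### Local triviality of the Grassmann bundle. -/

section GrassmannTrivialization

/-- Linear maps carry spanning families to spanning families of the image. Applied to coordinates
this gives the trivializations, applied to `ρ g` the smoothness of the action. -/
theorem GrassmannBundle.IsSmoothFrame.map [NeZero k] {f : P → GrassmannBundle h k}
    {w : Fin k → P → TotalSpace F E} {O : Set P} (hw : GrassmannBundle.IsSmoothFrame J f w O)
    {d' : ℕ} {X' : Type*} [TopologicalSpace X'] [ChartedSpace (EuclideanSpace ℝ (Fin d')) X']
    {F' : Type*} [NormedAddCommGroup F'] [NormedSpace ℝ F']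
    {E' : X' → Type*} [∀ x, AddCommGroup (E' x)] [∀ x, Module ℂ (E' x)]
    [TopologicalSpace (TotalSpace F' E')] [∀ x, TopologicalSpace (E' x)] [FiberBundle F' E']
    [NormedSpace ℂ F'] [IsScalarTower ℝ ℂ F'] [VectorBundle ℂ F' E']
    {h' : HermitianMetric d' F' E'} {g : P → GrassmannBundle h' k}
    {Φ : P → TotalSpace F E → TotalSpace F' E'}
    (hΦ : ∀ i, ContMDiffOn J ((𝓡 d').prod 𝓘(ℝ, F')) ∞ (fun p => Φ p (w i p)) O)
    (hg : ∀ p ∈ O, ∃ T : E (f p).base →ₗ[ℂ] E' (g p).base,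
      (∀ v, Φ p ⟨(f p).base, v⟩ = ⟨(g p).base, T v⟩) ∧ (g p).space = (f p).space.map T) :
    GrassmannBundle.IsSmoothFrame J g (fun i p => Φ p (w i p)) O := by
  refine ⟨hΦ, fun p hp => ?_⟩
  obtain ⟨v, hv, hspan⟩ := hw.spans p hp
  obtain ⟨T, hT, hTs⟩ := hg p hp
  refine ⟨fun i => T (v i), fun i => by rw [hv, hT], ?_⟩
  rw [hTs, ← hspan, Submodule.map_span, ← Set.range_comp]
  rfl

variable [FiniteDimensional ℂ F] [∀ x, Module ℝ (E x)]
    [VectorBundle ℝ F E] [ContMDiffVectorBundle ∞ F E (𝓡 d)] [NeZero k]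
  {m n : ℕ} [ChartedSpace (EuclideanSpace ℝ (Fin m)) (GrassmannBundle h k)]
  [ChartedSpace (EuclideanSpace ℝ (Fin n)) (GrassmannBundle (stdMetric (Fin k ⊕ Fin r)) k)]

namespace GrassmannBundle

/-- The coordinates of a subspace, as a subspace of the model fibre. -/
def toModel (u : UnitaryFrame h (Fin k ⊕ Fin r)) (W : GrassmannBundle h k) :
    GrassmannBundle (stdMetric (Fin k ⊕ Fin r)) k where
  base := 0
  space := W.space.map (u.coordEquiv W.base).toLinearMap
  finrank_eq := ((u.coordEquiv W.base).finrank_map_eq W.space).trans W.finrank_eq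

/-- The subspace over a point whose coordinates are a given subspace of the model fibre. -/
def ofModel (u : UnitaryFrame h (Fin k ⊕ Fin r)) (x : X)
    (W : GrassmannBundle (stdMetric (Fin k ⊕ Fin r)) k) : GrassmannBundle h k where
  base := x
  space := Submodule.map (u.coordEquiv x).symm.toLinearMap W.space
  finrank_eq := ((u.coordEquiv x).symm.finrank_map_eq W.space).trans W.finrank_eq

theorem contMDiffOn_toModel (ha : IsAdapted (k := k) m r h)
    (hY : IsAdapted (k := k) n r (stdMetric (Fin k ⊕ Fin r)))
    (hr : Module.finrank ℂ F = k + r) (u : UnitaryFrame h (Fin k ⊕ Fin r)) :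
    ContMDiffOn (𝓡 m) (𝓡 n) ∞ (toModel u) (base ⁻¹' u.dom : Set (GrassmannBundle h k)) := by
  intro W hW
  obtain ⟨O, hO, hWO, w, hw⟩ := ha.exists_isSmoothFrame_id hr W
  have hO' : IsOpen (O ∩ base ⁻¹' u.dom) := hO.inter (u.isOpen_dom.preimage continuous_base)
  have hw' := hw.mono (O' := O ∩ base ⁻¹' u.dom) Set.inter_subset_left
  have h1 := hw'.map (h' := stdMetric (Fin k ⊕ Fin r)) (g := toModel u)
    (Φ := fun _ z => ⟨0, u.coordEquiv z.proj z.2⟩) (fun i =>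
      smoothSec_trivial_iff.2 ⟨contMDiffOn_const, u.contMDiffOn_coordEquiv (hw'.smooth i)
        fun W hW => by
          obtain ⟨v, hv, -⟩ := hw'.spans W hW
          rw [hv]
          exact hW.2⟩)
    (fun W _ => ⟨(u.coordEquiv W.base).toLinearMap, fun v => rfl, rfl⟩)
  exact ((hY.contMDiffOn (by simp) hO' h1).contMDiffAt
    (hO'.mem_nhds ⟨hWO, hW⟩)).contMDiffWithinAt

theorem contMDiffOn_ofModel (ha : IsAdapted (k := k) m r h)
    (hY : IsAdapted (k := k) n r (stdMetric (Fin k ⊕ Fin r)))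
    (hr : Module.finrank ℂ F = k + r) (u : UnitaryFrame h (Fin k ⊕ Fin r)) :
    ContMDiffOn ((𝓡 d).prod (𝓡 n)) (𝓡 m) ∞
      (fun z : X × GrassmannBundle (stdMetric (Fin k ⊕ Fin r)) k => ofModel u z.1 z.2)
      (u.dom ×ˢ Set.univ) := by
  rintro ⟨x, W⟩ hx
  obtain ⟨O, hO, hWO, w, hw⟩ := hY.exists_isSmoothFrame_id (by simp) W
  have hO' : IsOpen (u.dom ×ˢ O) := u.isOpen_dom.prod hO
  have hw' : IsSmoothFrame ((𝓡 d).prod (𝓡 n))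
      (fun z : X × GrassmannBundle (stdMetric (Fin k ⊕ Fin r)) k => z.2)
      (fun i z => w i z.2) (u.dom ×ˢ O) :=
    ⟨fun i => (hw.smooth i).comp contMDiffOn_snd fun z hz => hz.2,
      fun z hz => hw.spans z.2 hz.2⟩
  have hsec : ∀ i, ContMDiffOn ((𝓡 d).prod (𝓡 n)) 𝓘(ℝ, Fin k ⊕ Fin r → ℂ) ∞
      (fun z : X × GrassmannBundle (stdMetric (Fin k ⊕ Fin r)) k => (w i z.2).2) (u.dom ×ˢ O) :=
    fun i p hp => (contMDiffWithinAt_totalSpace.1 (hw'.smooth i p hp)).2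
  have h1 := hw'.map (h' := h) (g := fun z => ofModel u z.1 z.2)
    (Φ := fun z y => ⟨z.1, (u.coordEquiv z.1).symm y.2⟩) (fun i =>
      u.contMDiffOn_coordEquiv_symm contMDiffOn_fst
        (hsec i) fun z hz => hz.1)
    (fun z _ => ⟨(u.coordEquiv z.1).symm.toLinearMap, fun v => rfl, rfl⟩)
  exact ((ha.contMDiffOn hr hO' h1).contMDiffAt
    (hO'.mem_nhds ⟨hx.1, hWO⟩)).contMDiffWithinAt

theorem isSmoothFibreBundle [T2Space X] [SecondCountableTopology X]
    (ha : IsAdapted (k := k) m r h) (hr : Module.finrank ℂ F = k + r) :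
    IsSmoothFibreBundle m d (base : GrassmannBundle h k → X) := by
  obtain ⟨cs, hY⟩ := exists_isAdapted (k := k) (r := r)
    (stdMetric (Fin k ⊕ Fin r)) (by simp) (n := 0 + 2 * (k * r)) rfl
  refine ⟨_, GrassmannBundle (stdMetric (Fin k ⊕ Fin r)) k, inferInstance, cs,
    hY.isSmoothManifold (by simp), fun x => ?_⟩
  have hcard : Module.finrank ℂ F = Fintype.card (Fin k ⊕ Fin r) := by simp [hr]
  obtain ⟨b, hb, -⟩ := h.exists_orthonormal_extension x hcard ∅ (fun _ => 0) (by simp)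
  obtain ⟨u, hu, -⟩ := h.exists_unitaryFrame hcard x b hb
  have h1 := contMDiffOn_toModel ha hY hr u
  have h2 := contMDiffOn_ofModel ha hY hr u
  refine ⟨{ toFun := fun W => (W.base, toModel u W)
            invFun := fun z => ofModel u z.1 z.2
            source := base ⁻¹' u.dom
            target := u.dom ×ˢ Set.univ
            map_source' := fun e he => ⟨he, trivial⟩
            map_target' := fun z hz => hz.1
            left_inv' := fun W _ => ?_
            right_inv' := fun z _ => Prod.ext rfl ?_
            open_source := u.isOpen_dom.preimage continuous_base
            open_target := u.isOpen_dom.prod isOpen_univ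
            continuousOn_toFun := continuous_base.continuousOn.prodMk h1.continuousOn
            continuousOn_invFun := h2.continuousOn
            baseSet := u.dom
            open_baseSet := u.isOpen_dom
            source_eq := rfl
            target_eq := rfl
            proj_toFun := fun e _ => rfl }, hu,
          (ha.contMDiff_base hr).contMDiffOn.prodMk h1, h2⟩
  · obtain ⟨x, S, hS⟩ := W
    simp [ofModel, toModel, ← Submodule.map_comp]
  · obtain ⟨x, y, S, hS⟩ := z
    obtain rfl : y = 0 := Subsingleton.elim _ _
    simp only [ofModel, toModel, mk.injEq, heq_eq_eq, true_and]
    ext v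
    constructor
    · rintro ⟨_, ⟨s, hs, rfl⟩, rfl⟩
      have : u.coordEquiv x ((u.coordEquiv x).symm s) = s := LinearEquiv.apply_symm_apply _ s
      exact (congrArg (· ∈ S) this).mpr hs
    · exact fun hv => ⟨_, ⟨v, hv, rfl⟩, LinearEquiv.apply_symm_apply (u.coordEquiv x) v⟩

end GrassmannBundle

end GrassmannTrivialization

end FibreCoordinates

/-! ### Pull-back of sesquilinear forms. -/

section PulledBackForms

variable {V V' : Type*} [AddCommGroup V] [Module ℂ V] [AddCommGroup V'] [Module ℂ V']

/-- The pull-back of a sesquilinear form under a linear map. -/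
noncomputable def pullForm (f : V' →ₗ⋆[ℂ] V' →ₗ[ℂ] ℂ) (T : V →ₗ[ℂ] V') : V →ₗ⋆[ℂ] V →ₗ[ℂ] ℂ :=
  LinearMap.mk₂'ₛₗ (starRingEnd ℂ) (RingHom.id ℂ) (fun v w => f (T v) (T w))
    (by simp) (by simp) (by simp) (by simp)

theorem pullForm_apply (f : V' →ₗ⋆[ℂ] V' →ₗ[ℂ] ℂ) (T : V →ₗ[ℂ] V') (v w : V) :
    pullForm f T v w = f (T v) (T w) := rfl

end PulledBackForms

/-! ### Existence of Hermitian metrics. -/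

section MetricExistence

variable {d : ℕ} {X : Type*} [TopologicalSpace X] [ChartedSpace (EuclideanSpace ℝ (Fin d)) X]
  {F : Type*} [NormedAddCommGroup F] [NormedSpace ℝ F]
  {E : X → Type*} [∀ x, AddCommGroup (E x)] [∀ x, Module ℂ (E x)]
  [TopologicalSpace (TotalSpace F E)] [∀ x, TopologicalSpace (E x)] [FiberBundle F E]
  [NormedSpace ℂ F] [IsScalarTower ℝ ℂ F] [VectorBundle ℂ F E]
  [FiniteDimensional ℂ F] [∀ x, Module ℝ (E x)]
  [VectorBundle ℝ F E] [ContMDiffVectorBundle ∞ F E (𝓡 d)]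

/-- The coordinates in a fibre given by the trivialization around `x₀`. -/
noncomputable def trivializationCoords (F : Type*) [NormedAddCommGroup F]
    {E : X → Type*} [∀ x, AddCommGroup (E x)] [∀ x, Module ℂ (E x)]
    [TopologicalSpace (TotalSpace F E)] [∀ x, TopologicalSpace (E x)] [FiberBundle F E]
    [NormedSpace ℂ F] [VectorBundle ℂ F E]
    [FiniteDimensional ℂ F] (x₀ x : X) : E x →ₗ[ℂ] (Fin (Module.finrank ℂ F) → ℂ) :=
  (ContinuousLinearEquiv.ofFinrankEq (by simp) :
    F ≃L[ℂ] (Fin (Module.finrank ℂ F) → ℂ)).toLinearEquiv.toLinearMap ∘ₗ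
      (trivializationAt F E x₀).linearMapAt ℂ x

theorem trivializationCoords_ne_zero {x₀ x : X} (hx : x ∈ (trivializationAt F E x₀).baseSet)
    {v : E x} (hv : v ≠ 0) : trivializationCoords F x₀ x v ≠ 0 := by
  intro h0
  have h1 : (trivializationAt F E x₀).linearMapAt ℂ x v = 0 := by
    simpa [trivializationCoords] using h0
  apply hv
  rw [← (trivializationAt F E x₀).symmₗ_linearMapAt (R := ℂ) hx v, h1, map_zero]

theorem contMDiffOn_trivializationCoords {EP : Type*} [NormedAddCommGroup EP] [NormedSpace ℝ EP]
    {HP : Type*} [TopologicalSpace HP]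
    {J : ModelWithCorners ℝ EP HP} {P : Type*} [TopologicalSpace P] [ChartedSpace HP P]
    (x₀ : X) {f : P → X} {w : ∀ p, E (f p)} {O : Set P} (hw : SmoothSec d F J f w O)
    (hO : ∀ p ∈ O, f p ∈ (trivializationAt F E x₀).baseSet) :
    ContMDiffOn J 𝓘(ℝ, Fin (Module.finrank ℂ F) → ℂ) ∞
      (fun p => trivializationCoords F x₀ (f p) (w p)) O := by
  have h1 : ContMDiffOn J 𝓘(ℝ, F) ∞
      (fun p => ((trivializationAt F E x₀) (TotalSpace.mk' F (f p) (w p))).2) O :=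
    ((trivializationAt F E x₀).contMDiffOn_iff (IB := 𝓡 d)
      (fun p hp => (trivializationAt F E x₀).mem_source.2 (hO p hp)) |>.1 hw).2
  let a : F ≃L[ℂ] (Fin (Module.finrank ℂ F) → ℂ) := ContinuousLinearEquiv.ofFinrankEq (by simp)
  have ha : ContDiff ℝ ∞ a := (a.contDiff (n := ∞)).restrict_scalars ℝ
  refine (ha.contMDiff.comp_contMDiffOn h1).congr fun p hp => ?_
  simp only [trivializationCoords, LinearMap.comp_apply, Function.comp]
  rw [(trivializationAt F E x₀).linearMapAt_apply, if_pos (hO p hp)]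
  rfl

variable (F E) in
/-- Hermitian metrics exist. -/
theorem HermitianMetric.nonempty [T2Space X] [SecondCountableTopology X] [IsManifold (𝓡 d) ∞ X] :
    Nonempty (HermitianMetric d F E) := by
  have : LocallyCompactSpace X := Manifold.locallyCompact_of_finiteDimensional (𝓡 d)
  obtain ⟨ρ, hρ⟩ := SmoothPartitionOfUnity.exists_isSubordinate (𝓡 d) isClosed_univ
    (fun x : X => (trivializationAt F E x).baseSet)
    (fun x => (trivializationAt F E x).open_baseSet)
    (fun x _ => Set.mem_iUnion.2 ⟨x, mem_baseSet_trivializationAt F E x⟩)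
  let loc : ∀ i x : X, E x →ₗ⋆[ℂ] E x →ₗ[ℂ] ℂ := fun i x =>
    pullForm (stdForm (Fin (Module.finrank ℂ F))) (trivializationCoords F i x)
  -- A convex combination of local standard forms: positive definite forms are closed under it.
  let form : ∀ x, E x →ₗ⋆[ℂ] E x →ₗ[ℂ] ℂ := fun x =>
    ∑ i ∈ ρ.finsupport x, ((ρ i x : ℝ) : ℂ) • loc i x
  have hform : ∀ x v w, form x v w = ∑ i ∈ ρ.finsupport x, ((ρ i x : ℝ) : ℂ) * loc i x v w :=
    fun x v w => by simp [form, LinearMap.sum_apply]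
  have hformf : ∀ x v w, form x v w = ∑ᶠ i, ((ρ i x : ℝ) : ℂ) * loc i x v w := by
    intro x v w
    rw [hform, finsum_eq_sum_of_support_subset]
    intro i hi
    rw [ρ.coe_finsupport x, Function.mem_support]
    intro h0
    simp [h0] at hi
  have hloc : ∀ i x v w, starRingEnd ℂ (loc i x v w) = loc i x w v := fun i x v w =>
    stdForm_conj_symm _ _
  refine ⟨⟨form, fun x v w => ?_, fun x v hv => ?_, ?_⟩⟩
  · simp only [hform, map_sum, map_mul, hloc, Complex.conj_ofReal]
  · rw [hform, Complex.re_sum]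
    simp only [Complex.re_ofReal_mul]
    -- Away from the base set of its trivialization a local form is only semidefinite; definiteness
    -- comes from an index with `ρ i x > 0`, whose base set contains `x`.
    have hnn : ∀ i, 0 ≤ (loc i x v v).re := fun i => by
      by_cases h0 : trivializationCoords F i x v = 0
      · simp [loc, pullForm_apply, h0]
      · exact (stdForm_pos h0).le
    obtain ⟨i, hi⟩ : ∃ i, 0 < ρ i x := ρ.exists_pos_of_mem (Set.mem_univ x)
    have hib : x ∈ (trivializationAt F E i).baseSet := hρ i (subset_tsupport _ hi.ne')
    refine Finset.sum_pos' (fun j _ => mul_nonneg (ρ.nonneg j x) (hnn j)) ⟨i, ?_, ?_⟩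
    · rw [ρ.mem_finsupport]
      exact hi.ne'
    · exact mul_pos hi (stdForm_pos (trivializationCoords_ne_zero hib hv))
  · simp only [hformf]
    have hproj : ContMDiff ((𝓡 d).prod 𝓘(ℝ, F × F)) (𝓡 d) ∞
        (TotalSpace.proj : TotalSpace (F × F) (E ×ᵇ E) → X) := contMDiff_proj _
    refine contMDiff_finsum (fun i z => ?_) ?_
    -- On the support the local form is smooth; off the closed support the whole term vanishes
    -- nearby.
    · by_cases hz : z.1 ∈ tsupport (ρ i)
      · set B := (trivializationAt F E i).baseSet with hB
        have hsec : SmoothSec d (F × F) ((𝓡 d).prod 𝓘(ℝ, F × F)) (E := E ×ᵇ E)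
            (fun z : TotalSpace (F × F) (E ×ᵇ E) => z.1) (fun z => z.2) (TotalSpace.proj ⁻¹' B) :=
          contMDiffOn_id
        have h1 := contMDiff_dotProduct_star
          (contMDiffOn_trivializationCoords i hsec.fst fun p hp => hp)
          (contMDiffOn_trivializationCoords i hsec.snd fun p hp => hp)
        have h2 : ContMDiff ((𝓡 d).prod 𝓘(ℝ, F × F)) 𝓘(ℝ, ℂ) ∞
            (fun z : TotalSpace (F × F) (E ×ᵇ E) => ((ρ i z.1 : ℝ) : ℂ)) :=
          Complex.ofRealCLM.contDiff.contMDiff.comp ((ρ i).contMDiff.comp hproj)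
        have hmem : TotalSpace.proj ⁻¹' B ∈ 𝓝 z :=
          ((trivializationAt F E i).open_baseSet.preimage hproj.continuous).mem_nhds (hρ i hz)
        have h3 : ContMDiffOn ((𝓡 d).prod 𝓘(ℝ, F × F)) 𝓘(ℝ, ℂ) ∞
            (fun z : TotalSpace (F × F) (E ×ᵇ E) => ((ρ i z.1 : ℝ) : ℂ) * loc i z.1 z.2.1 z.2.2)
            (TotalSpace.proj ⁻¹' B) :=
          fun p hp => contMDiffWithinAt_complex_mul (h2.contMDiffOn p hp) (h1 p hp)
        exact h3.contMDiffAt hmem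
      · refine (contMDiffAt_const (c := (0 : ℂ))).congr_of_eventuallyEq ?_
        filter_upwards [((isClosed_tsupport (ρ i)).isOpen_compl.preimage
          hproj.continuous).mem_nhds hz] with y hy
        rw [image_eq_zero_of_notMem_tsupport hy]
        simp
    · refine (ρ.locallyFinite.preimage_continuous hproj.continuous).subset fun i z hz => ?_
      rw [Set.mem_preimage, Function.mem_support]
      intro h0
      rw [Function.mem_support] at hz
      simp [h0] at hz

end MetricExistence

/-! ### Fibre maps of bundle automorphisms and averaging of metrics. -/

section FibrewiseLinearMaps

variable {d : ℕ} {X : Type*} [TopologicalSpace X] [ChartedSpace (EuclideanSpace ℝ (Fin d)) X]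
  {F : Type*} [NormedAddCommGroup F] [NormedSpace ℝ F]
  {E : X → Type*} [∀ x, AddCommGroup (E x)] [∀ x, Module ℂ (E x)]
  [TopologicalSpace (TotalSpace F E)] [∀ x, TopologicalSpace (E x)] [FiberBundle F E]

namespace vectorBundleDiff

/-- The image of a point of the base under an automorphism of a vector bundle. -/
noncomputable def fibreBase (φ : vectorBundleDiff d F E) (x : X) : X := (φ.2.2 x).choose

/-- The linear map of fibres given by an automorphism of a vector bundle. -/
noncomputable def fibreMap (φ : vectorBundleDiff d F E) (x : X) : E x →ₗ[ℂ] E (fibreBase φ x) :=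
  (φ.2.2 x).choose_spec.choose

theorem apply_mk (φ : vectorBundleDiff d F E) (x : X) (v : E x) :
    φ.1 ⟨x, v⟩ = ⟨fibreBase φ x, fibreMap φ x v⟩ :=
  (φ.2.2 x).choose_spec.choose_spec v

theorem fibreMap_injective (φ : vectorBundleDiff d F E) (x : X) :
    Function.Injective (fibreMap φ x) := by
  intro v w hvw
  have : φ.1 ⟨x, v⟩ = φ.1 ⟨x, w⟩ := by rw [apply_mk, apply_mk, hvw]
  simpa using φ.1.injective this

theorem contMDiff (φ : vectorBundleDiff d F E) :
    ContMDiff ((𝓡 d).prod 𝓘(ℝ, F)) ((𝓡 d).prod 𝓘(ℝ, F)) ∞ φ.1 := φ.2.1.1.1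

theorem form_apply (h : HermitianMetric d F E) (φ : vectorBundleDiff d F E) {x y : X}
    {v w : E x} {v' w' : E y} (hv : φ.1 ⟨x, v⟩ = ⟨y, v'⟩) (hw : φ.1 ⟨x, w⟩ = ⟨y, w'⟩) :
    h.form (fibreBase φ x) (fibreMap φ x v) (fibreMap φ x w) = h.form y v' w' := by
  rw [apply_mk] at hv hw
  obtain rfl : fibreBase φ x = y := congrArg TotalSpace.proj hv
  have h1 : fibreMap φ x v = v' := by simpa using hv
  have h2 : fibreMap φ x w = w' := by simpa using hw
  rw [h1, h2]

end vectorBundleDiff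

variable {C G M : Type*} [Group C] [Group G] [Group M] {ε : GroupExtension C G M}

/-- Averaging a Hermitian metric over a finite group makes it invariant. -/
theorem HermitianMetric.exists_isInvariant [Finite G] (h : HermitianMetric d F E)
    (β : VectorBundleAction d F E ε) : ∃ h' : HermitianMetric d F E, h'.IsInvariant β := by
  have := Fintype.ofFinite G
  let form : ∀ x, E x →ₗ⋆[ℂ] E x →ₗ[ℂ] ℂ := fun x => ∑ g : G,
    pullForm (h.form (vectorBundleDiff.fibreBase (β.ρ g) x))
      (vectorBundleDiff.fibreMap (β.ρ g) x)
  have hform : ∀ x v w, form x v w = ∑ g : G, h.form (vectorBundleDiff.fibreBase (β.ρ g) x)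
      (vectorBundleDiff.fibreMap (β.ρ g) x v) (vectorBundleDiff.fibreMap (β.ρ g) x w) :=
    fun x v w => by simp [form, LinearMap.sum_apply, pullForm_apply]
  refine ⟨⟨form, fun x v w => ?_, fun x v hv => ?_, ?_⟩, fun g x y v w v' w' hv hw => ?_⟩
  · simp only [hform, map_sum, h.conj_symm]
  · rw [hform, Complex.re_sum]
    refine Finset.sum_pos (fun g _ => h.pos_def _ _ fun h0 => hv ?_) Finset.univ_nonempty
    exact vectorBundleDiff.fibreMap_injective (β.ρ g) x (h0.trans (map_zero _).symm)
  · have hsec : SmoothSec d (F × F) ((𝓡 d).prod 𝓘(ℝ, F × F)) (E := E ×ᵇ E)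
        (fun z : TotalSpace (F × F) (E ×ᵇ E) => z.1) (fun z => z.2) Set.univ := contMDiffOn_id
    simp only [hform]
    refine contMDiff_finsetSum fun g _ => contMDiffOn_univ.1 (h.contMDiffOn_form ?_ ?_)
    · refine ContMDiffOn.congr ((vectorBundleDiff.contMDiff (β.ρ g)).comp_contMDiffOn hsec.fst)
        fun z _ => ?_
      exact (vectorBundleDiff.apply_mk (β.ρ g) z.1 z.2.1).symm
    · refine ContMDiffOn.congr ((vectorBundleDiff.contMDiff (β.ρ g)).comp_contMDiffOn hsec.snd)
        fun z _ => ?_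
      exact (vectorBundleDiff.apply_mk (β.ρ g) z.1 z.2.2).symm
  · change form y v' w' = form x v w
    rw [hform, hform]
    -- Translating by `g` permutes the summands: `g'` at the image point corresponds to `g' * g` at
    -- `x`.
    refine Fintype.sum_equiv (Equiv.mulRight g) _ _ fun g' => ?_
    have hmul : ∀ (u : E x) (u' : E y), (β.ρ g).1 ⟨x, u⟩ = ⟨y, u'⟩ →
        (β.ρ (g' * g)).1 ⟨x, u⟩ = ⟨vectorBundleDiff.fibreBase (β.ρ g') y,
          vectorBundleDiff.fibreMap (β.ρ g') y u'⟩ := fun u u' hu => by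
      rw [map_mul, Subgroup.coe_mul, Equiv.Perm.mul_apply, hu, vectorBundleDiff.apply_mk]
    exact (vectorBundleDiff.form_apply h (β.ρ (g' * g)) (hmul v v' hv) (hmul w w' hw)).symm

end FibrewiseLinearMaps

/-! ### Actions of an extension built from actions of its middle group. -/

section ExtensionActions

variable {EL HL L : Type*} [NormedAddCommGroup EL] [NormedSpace ℝ EL] [TopologicalSpace HL]
  [TopologicalSpace L] [ChartedSpace HL L]
  {EX HX X : Type*} [NormedAddCommGroup EX] [NormedSpace ℝ EX] [TopologicalSpace HX]
  [TopologicalSpace X] [ChartedSpace HX X]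
  {C G M : Type*} [Group C] [Group G] [Group M] {ε : GroupExtension C G M}

/-- The action of an extension given by actions of `G` and of `M` on the total space and on the
base. -/
def ExtensionAction.ofPerm {IX : ModelWithCorners ℝ EX HX} {A : Subgroup (Equiv.Perm L)} {p : L → X}
    (ρ : G →* Equiv.Perm L) (hρ : ∀ g, ρ g ∈ A) (τ : M →* Equiv.Perm X)
    (hτ : ∀ a, τ a ∈ diffGroup IX X) (hp : ∀ g z, p (ρ g z) = τ (ε.rightHom g) (p z)) :
    ExtensionAction ε IX A p where
  σ := (ρ.comp ε.inl).codRestrict (fixingFibres A p) fun c => ⟨hρ _, fun z => by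
    rw [MonoidHom.comp_apply, hp, ε.rightHom_inl, map_one, Equiv.Perm.one_apply]⟩
  ρ := ρ.codRestrict A hρ
  τ := τ.codRestrict (baseDiff IX A p) fun a => ⟨hτ a, by
    -- Every element of `M` lifts to `G`, so its action on the base is covered by an automorphism.
    obtain ⟨g, rfl⟩ := ε.rightHom_surjective a
    exact ⟨ρ g, hρ g, hp g⟩⟩
  comm_fibre _ := rfl
  comm_base := hp

/-- A smooth action of `G` on a total space `L` over the given action of `M` on the base is an
action of the extension. -/
theorem ExtensionAction.exists_of_contMDiff {IX : ModelWithCorners ℝ EX HX} {L₀ : Type*}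
    {A₀ : Subgroup (Equiv.Perm L₀)} {p₀ : L₀ → X} (α₀ : ExtensionAction ε IX A₀ p₀)
    {IL : ModelWithCorners ℝ EL HL} {p : L → X} {A : Subgroup (Equiv.Perm L)} (act : G → L → L)
    (hone : ∀ z, act 1 z = z) (hmul : ∀ g g' z, act (g * g') z = act g (act g' z))
    (hs : ∀ g, ContMDiff IL IL ∞ (act g))
    (hp : ∀ g z, p (act g z) = (α₀.τ (ε.rightHom g)).1 (p z))
    (hA : ∀ φ ∈ bundleDiff IL IX p, (∃ g, ⇑φ = act g) → φ ∈ A) :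
    ∃ α : ExtensionAction ε IX A p, (∀ g, ⇑(α.ρ g).1 = act g) ∧
      ∀ a, (α.τ a).1 = (α₀.τ a).1 := by
  let ρ : G →* Equiv.Perm L := MonoidHom.toHomPerm
    { toFun := act
      map_one' := funext hone
      map_mul' := fun g g' => funext (hmul g g') }
  have hρ : ∀ g, ⇑(ρ g) = act g := fun _ => rfl
  have hinv : ∀ g, ⇑(ρ g).symm = act g⁻¹ := fun g => by
    rw [← hρ, map_inv]
    rfl
  refine ⟨ExtensionAction.ofPerm ρ (fun g => hA _ ⟨⟨?_, ?_⟩, _, (α₀.τ (ε.rightHom g)).2.1, hp g⟩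
    ⟨g, hρ g⟩) ((Subgroup.subtype _).comp α₀.τ) (fun a => (α₀.τ a).2.1) hp,
    fun g => hρ g, fun a => rfl⟩
  · rw [hρ]
    exact hs g
  · rw [hinv]
    exact hs _

/-- By `comm_fibre`, `σ` is `ρ` restricted along the injection of `C`, so it needs no condition of
its own. -/
theorem ExtensionAction.faithful_of_injective {IX : ModelWithCorners ℝ EX HX}
    {A : Subgroup (Equiv.Perm L)} {p : L → X} (α : ExtensionAction ε IX A p)
    (hρ : ∀ g, (∀ z, (α.ρ g).1 z = z) → g = 1)
    (hτ : Function.Injective α.τ) : α.Faithful := by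
  have hρ' : Function.Injective α.ρ := (injective_iff_map_eq_one _).2 fun g hg =>
    hρ g fun z => by rw [hg]; rfl
  refine ⟨fun c c' hc => ε.inl_injective (hρ' (Subtype.ext ?_)), hρ', hτ⟩
  rw [α.comm_fibre, α.comm_fibre, hc]

theorem ExtensionAction.injective_of_eq {IX : ModelWithCorners ℝ EX HX} {L₀ : Type*}
    {A₀ : Subgroup (Equiv.Perm L₀)} {p₀ : L₀ → X} {α₀ : ExtensionAction ε IX A₀ p₀}
    {p : L → X} {A : Subgroup (Equiv.Perm L)} {α : ExtensionAction ε IX A p}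
    (hτ : ∀ a, (α.τ a).1 = (α₀.τ a).1) (hinj : Function.Injective α₀.τ) :
    Function.Injective α.τ := fun a b hab =>
  hinj (Subtype.ext (by rw [← hτ, ← hτ, hab]))

end ExtensionActions

/-! ### Induced actions on frames and subspaces. -/

section InducedActions

variable {d : ℕ} {X : Type*} [TopologicalSpace X] [ChartedSpace (EuclideanSpace ℝ (Fin d)) X]
  {F : Type*} [NormedAddCommGroup F] [NormedSpace ℝ F]
  {E : X → Type*} [∀ x, AddCommGroup (E x)] [∀ x, Module ℂ (E x)]
  [TopologicalSpace (TotalSpace F E)] [∀ x, TopologicalSpace (E x)] [FiberBundle F E]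
  {C G M : Type*} [Group C] [Group G] [Group M] {ε : GroupExtension C G M}
  (β : VectorBundleAction d F E ε) {h : HermitianMetric d F E} {k r : ℕ}

namespace VectorBundleAction

open vectorBundleDiff

theorem fibreBase_eq (g : G) (x : X) :
    fibreBase (β.ρ g) x = (β.τ (ε.rightHom g)).1 x := by
  rw [← β.comm_base g (⟨x, 0⟩ : TotalSpace F E), apply_mk]

theorem apply_smul (g : G) {x : X} {v : E x} (hv : (β.ρ g).1 ⟨x, v⟩ = ⟨x, v⟩) (c : ℂ) :
    (β.ρ g).1 ⟨x, c • v⟩ = ⟨x, c • v⟩ := by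
  rw [apply_mk] at hv ⊢
  rw [map_smul]
  -- The target fibre is only propositionally the fibre over `x`; generalizing permits substituting
  -- the base point.
  generalize fibreMap (β.ρ g) x v = w at hv ⊢
  generalize fibreBase (β.ρ g) x = y at w hv ⊢
  obtain rfl : y = x := congrArg TotalSpace.proj hv
  rw [TotalSpace.mk_inj] at hv
  rw [hv]

theorem one_apply (z : TotalSpace F E) : (β.ρ 1).1 z = z := by
  rw [map_one]
  rfl

theorem mul_apply (g g' : G) (z : TotalSpace F E) :
    (β.ρ (g * g')).1 z = (β.ρ g).1 ((β.ρ g').1 z) := by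
  rw [map_mul]
  rfl

variable {β} in
/-- The action on the orthonormal frames. -/
noncomputable def onFrames (hinv : h.IsInvariant β) (g : G) (e : StiefelBundle h k) :
    StiefelBundle h k where
  base := fibreBase (β.ρ g) e.base
  frame i := fibreMap (β.ρ g) e.base (e.frame i)
  orthonormal i j := by
    rw [hinv g _ _ _ _ _ _ (apply_mk (β.ρ g) _ _) (apply_mk (β.ρ g) _ _), e.orthonormal]

variable {β} in
theorem vec_onFrames (hinv : h.IsInvariant β) (g : G) (e : StiefelBundle h k) (i : Fin k) :
    (onFrames hinv g e).vec i = (β.ρ g).1 (e.vec i) :=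
  (apply_mk (β.ρ g) _ _).symm

/-- The action on the subspaces of the fibres. -/
noncomputable def onSubspaces (g : G) (W : GrassmannBundle h k) : GrassmannBundle h k where
  base := fibreBase (β.ρ g) W.base
  space := W.space.map (fibreMap (β.ρ g) W.base)
  finrank_eq := (Submodule.equivMapOfInjective _
    (fibreMap_injective (β.ρ g) W.base) W.space).finrank_eq.symm.trans W.finrank_eq

theorem vectors_onSubspaces (g : G) (W : GrassmannBundle h k) :
    (onSubspaces β g W).vectors = (β.ρ g).1 '' W.vectors := by
  ext z
  simp only [GrassmannBundle.vectors, onSubspaces, Set.mem_image, SetLike.mem_coe]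
  constructor
  · rintro ⟨_, ⟨v, hv, rfl⟩, rfl⟩
    exact ⟨_, ⟨v, hv, rfl⟩, apply_mk _ _ _⟩
  · rintro ⟨_, ⟨v, hv, rfl⟩, rfl⟩
    exact ⟨_, ⟨v, hv, rfl⟩, (apply_mk _ _ _).symm⟩

end VectorBundleAction

end InducedActions

/-! ### Smoothness of the induced actions. -/

section InducedSmoothActions

variable {d : ℕ} {X : Type*} [TopologicalSpace X] [ChartedSpace (EuclideanSpace ℝ (Fin d)) X]
  {F : Type*} [NormedAddCommGroup F] [NormedSpace ℝ F]
  {E : X → Type*} [∀ x, AddCommGroup (E x)] [∀ x, Module ℂ (E x)]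
  [TopologicalSpace (TotalSpace F E)] [∀ x, TopologicalSpace (E x)] [FiberBundle F E]
  [NormedSpace ℂ F] [IsScalarTower ℝ ℂ F] [VectorBundle ℂ F E]
  [FiniteDimensional ℂ F] [∀ x, Module ℝ (E x)]
  [VectorBundle ℝ F E] [ContMDiffVectorBundle ∞ F E (𝓡 d)]
  {C G M : Type*} [Group C] [Group G] [Group M] {ε : GroupExtension C G M}
  {β : VectorBundleAction d F E ε} {h : HermitianMetric d F E} {k r : ℕ}
  [NeZero k]

open VectorBundleAction

/-- The action on the Stiefel bundle. -/
theorem StiefelBundle.IsAdapted.exists_action {m : ℕ}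
    [ChartedSpace (EuclideanSpace ℝ (Fin m)) (StiefelBundle h k)]
    (ha : StiefelBundle.IsAdapted (k := k) m r h) (hr : Module.finrank ℂ F = k + r)
    (hinv : h.IsInvariant β) :
    ∃ α : FibreBundleAction d m ε (StiefelBundle.base : StiefelBundle h k → X),
      (∀ g e i, ((α.ρ g).1 e).vec i = (β.ρ g).1 (e.vec i)) ∧ ∀ a, (α.τ a).1 = (β.τ a).1 := by
  obtain ⟨α, h1, h2⟩ := ExtensionAction.exists_of_contMDiff β (IL := 𝓡 m)
    (p := (StiefelBundle.base : StiefelBundle h k → X)) (A := bundleDiff (𝓡 m) (𝓡 d) _)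
    (onFrames hinv)
    (fun e => StiefelBundle.vec_ext fun i => by rw [vec_onFrames, one_apply])
    (fun g g' e => StiefelBundle.vec_ext fun i => by simp only [vec_onFrames, mul_apply])
    (fun g => contMDiffOn_univ.1 (ha.contMDiffOn hr isOpen_univ fun i =>
      (((vectorBundleDiff.contMDiff (β.ρ g)).comp (ha.contMDiff_vec hr i)).congr fun e =>
        vec_onFrames hinv g e i).contMDiffOn))
    (fun g e => fibreBase_eq β g e.base) (fun φ hφ _ => hφ)
  exact ⟨α, fun g e i => by rw [h1, vec_onFrames], h2⟩

/-- The action on the Grassmann bundle. -/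
theorem GrassmannBundle.IsAdapted.exists_action {n : ℕ}
    [ChartedSpace (EuclideanSpace ℝ (Fin n)) (GrassmannBundle h k)]
    (ha : GrassmannBundle.IsAdapted (k := k) n r h) (hr : Module.finrank ℂ F = k + r)
    (β : VectorBundleAction d F E ε) :
    ∃ α : FibreBundleAction d n ε (GrassmannBundle.base : GrassmannBundle h k → X),
      (∀ g W, ((α.ρ g).1 W).vectors = (β.ρ g).1 '' W.vectors) ∧ ∀ a, (α.τ a).1 = (β.τ a).1 := by
  obtain ⟨α, h1, h2⟩ := ExtensionAction.exists_of_contMDiff β (IL := 𝓡 n)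
    (p := (GrassmannBundle.base : GrassmannBundle h k → X)) (A := bundleDiff (𝓡 n) (𝓡 d) _)
    (onSubspaces β)
    (fun W => GrassmannBundle.vectors_injective (by
      rw [vectors_onSubspaces, funext (one_apply β), Set.image_id']))
    (fun g g' W => GrassmannBundle.vectors_injective (by
      simp only [vectors_onSubspaces, Set.image_image, mul_apply]))
    (fun g W => by
      -- A smooth frame of the subspaces near `W` is carried by `ρ g` to a smooth frame of their
      -- images.
      obtain ⟨O, hO, hW, w, hw⟩ := ha.exists_isSmoothFrame_id hr W
      refine (ha.contMDiffOn hr hO (hw.map (Φ := fun _ => (β.ρ g).1) (fun i =>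
        (vectorBundleDiff.contMDiff (β.ρ g)).comp_contMDiffOn (hw.smooth i))
        fun W' _ => ⟨vectorBundleDiff.fibreMap (β.ρ g) W'.base,
          fun v => vectorBundleDiff.apply_mk _ _ _, rfl⟩)).contMDiffAt (hO.mem_nhds hW))
    (fun g W => fibreBase_eq β g W.base) (fun φ hφ _ => hφ)
  exact ⟨α, fun g W => by rw [h1, vectors_onSubspaces], h2⟩

end InducedSmoothActions

/-! ### Frames and subspaces detect vectors. -/

section Faithfulness

variable {d : ℕ} {X : Type*} [TopologicalSpace X] [ChartedSpace (EuclideanSpace ℝ (Fin d)) X]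
  {F : Type*} [NormedAddCommGroup F] [NormedSpace ℝ F]
  {E : X → Type*} [∀ x, AddCommGroup (E x)] [∀ x, Module ℂ (E x)]
  [TopologicalSpace (TotalSpace F E)] [∀ x, TopologicalSpace (E x)] [FiberBundle F E]
  {C G M : Type*} [Group C] [Group G] [Group M] {ε : GroupExtension C G M}
  {β : VectorBundleAction d F E ε} {h : HermitianMetric d F E} {k r : ℕ}

theorem HermitianMetric.exists_normalized (h : HermitianMetric d F E) {x : X} {v : E x}
    (hv : v ≠ 0) : ∃ c : ℂ, c ≠ 0 ∧ h.form x (c • v) (c • v) = 1 := by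
  have hpos := h.pos_def x v hv
  obtain ⟨s, hs, hself⟩ : ∃ s : ℝ, (s : ℂ) ≠ 0 ∧ h.form x v v = (s : ℂ) ^ 2 :=
    ⟨Real.sqrt (h.form x v v).re, by exact_mod_cast (Real.sqrt_pos.2 hpos).ne', by
      rw [← Complex.ofReal_pow, Real.sq_sqrt hpos.le, ← h.form_self_eq_ofReal]⟩
  refine ⟨((s⁻¹ : ℝ) : ℂ), by simpa using hs, ?_⟩
  simp only [map_smulₛₗ, LinearMap.smul_apply, Complex.conj_ofReal, smul_eq_mul, RingHom.id_apply]
  rw [hself, Complex.ofReal_inv]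
  field_simp

section Frames

variable [NormedSpace ℂ F] [IsScalarTower ℝ ℂ F] [VectorBundle ℂ F E]
  [FiniteDimensional ℂ F] [NeZero k]

/-- Every vector is a multiple of the first vector of some orthonormal frame. -/
theorem StiefelBundle.exists_smul_frame_zero (hr : Module.finrank ℂ F = k + r)
    (h : HermitianMetric d F E) (x : X) (v : E x) :
    ∃ (e : StiefelBundle h k) (c : ℂ), (⟨x, v⟩ : TotalSpace F E) = ⟨e.base, c • e.frame 0⟩ := by
  have hcard : Module.finrank ℂ F = Fintype.card (Fin k ⊕ Fin r) := by simp [hr]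
  by_cases hv : v = 0
  · obtain ⟨b, hb, -⟩ := h.exists_orthonormal_extension x hcard ∅ (fun _ => 0) (by simp)
    exact ⟨⟨x, fun i => b (Sum.inl i), fun i j => by simp [hb]⟩, 0, by simp [hv]⟩
  · obtain ⟨c, hc, hcv⟩ := h.exists_normalized hv
    obtain ⟨b, hb, hbv⟩ := h.exists_orthonormal_extension x hcard {Sum.inl 0} (fun _ => c • v)
      (by rintro i rfl j rfl; simpa using hcv)
    refine ⟨⟨x, fun i => b (Sum.inl i), fun i j => by simp [hb]⟩, c⁻¹, ?_⟩
    simp only [hbv _ rfl, smul_smul, inv_mul_cancel₀ hc, one_smul]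

/-- The fibres of the Grassmann bundle are nonempty. -/
theorem GrassmannBundle.exists_base_eq (hr : Module.finrank ℂ F = k + r)
    (h : HermitianMetric d F E) (x : X) : ∃ W : GrassmannBundle h k, W.base = x := by
  obtain ⟨e, c, he⟩ := StiefelBundle.exists_smul_frame_zero (k := k) hr h x 0
  exact ⟨e.span, (congrArg TotalSpace.proj he).symm⟩

/-- A line is the intersection of the `k`-dimensional subspaces containing it. -/
theorem GrassmannBundle.exists_eq_smul (hr : Module.finrank ℂ F = k + (r + 1))
    (h : HermitianMetric d F E) {x : X} {v : E x} (hv : v ≠ 0) (z : TotalSpace F E)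
    (hz : ∀ W : GrassmannBundle h k, ⟨x, v⟩ ∈ W.vectors → z ∈ W.vectors) :
    ∃ c : ℂ, z = ⟨x, c • v⟩ := by
  have hcard : Module.finrank ℂ F = Fintype.card (Fin k ⊕ Fin (r + 1)) := by simp [hr]
  obtain ⟨c, hc, hcv⟩ := h.exists_normalized hv
  -- The span of the first `k` basis vectors is a subspace containing `v`, so `z` lies in it and is
  -- orthogonal to the next vector. That vector exists because the complement has rank `r + 1`.
  have key : ∀ b : Fin k ⊕ Fin (r + 1) → E x,
      (∀ i j, h.form x (b i) (b j) = if i = j then 1 else 0) → b (Sum.inl 0) = c • v →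
      ∃ w : E x, z = ⟨x, w⟩ ∧ h.form x (b (Sum.inr 0)) w = 0 := by
    intro b hb hbv
    let e : StiefelBundle h k := ⟨x, fun i => b (Sum.inl i), fun i j => by simp [hb]⟩
    obtain ⟨w, hw, rfl⟩ := hz e.span ⟨v, by
      have h1 : c⁻¹ • b (Sum.inl 0) ∈ Submodule.span ℂ (Set.range e.frame) :=
        Submodule.smul_mem _ _ (Submodule.subset_span ⟨0, rfl⟩)
      rwa [hbv, smul_smul, inv_mul_cancel₀ hc, one_smul] at h1, rfl⟩
    refine ⟨w, rfl, ?_⟩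
    have h2 : Submodule.span ℂ (Set.range e.frame) ≤
        LinearMap.ker (h.form x (b (Sum.inr 0))) := by
      rw [Submodule.span_le]
      rintro _ ⟨i, rfl⟩
      simp [e, hb]
    exact h2 hw
  obtain ⟨b, hb, hbv⟩ := h.exists_orthonormal_extension x hcard {Sum.inl 0} (fun _ => c • v)
    (by rintro i rfl j rfl; simpa using hcv)
  obtain ⟨w, rfl, -⟩ := key b hb (hbv _ rfl)
  by_contra! hne
  set a := h.form x (c • v) w with ha
  -- If `w` is not a multiple of `v`, its component orthogonal to `v` can be normalized and used as
  -- the vector `Sum.inr 0` of a basis. Then `w` is orthogonal to it by `key`, so the unit vector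
  -- would be orthogonal to itself.
  have hu : w - a • (c • v) ≠ 0 := fun h0 => hne (a * c) (by rw [sub_eq_zero.1 h0, smul_smul])
  obtain ⟨c', hc', hcu⟩ := h.exists_normalized hu
  have horth : h.form x (c • v) (c' • (w - a • (c • v))) = 0 := by
    rw [map_smul (h.form x (c • v)), map_sub, map_smul (h.form x (c • v)), hcv, ← ha]
    simp
  have horth' : h.form x (c' • (w - a • (c • v))) (c • v) = 0 := by
    rw [← h.conj_symm, horth, map_zero]
  obtain ⟨b, hb, hbv⟩ := h.exists_orthonormal_extension x hcard {Sum.inl 0, Sum.inr 0}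
    (Sum.elim (fun _ => c • v) (fun _ => c' • (w - a • (c • v)))) (by
      rintro i (rfl | rfl) j (rfl | rfl)
      · simpa using hcv
      · simpa using horth
      · simpa using horth'
      · simpa using hcu)
  obtain ⟨w', hw', hw0⟩ := key b hb (hbv _ (Or.inl rfl))
  obtain rfl : w = w' := by simpa using hw'
  rw [hbv _ (Or.inr rfl), Sum.elim_inr] at hw0
  refine one_ne_zero (α := ℂ) ?_
  rw [← hcu, map_smul (h.form x (c' • (w - a • (c • v)))), map_sub, hw0,
    map_smul (h.form x (c' • (w - a • (c • v)))), horth']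
  simp

end Frames

theorem VectorBundleAction.eq_one_of_apply_eq (hβ : β.Faithful) {g : G}
    (hg : ∀ x (v : E x), (β.ρ g).1 ⟨x, v⟩ = ⟨x, v⟩) : g = 1 :=
  hβ.2.1 (by rw [map_one]; exact Subtype.ext (Equiv.ext fun z => hg z.1 z.2))

/-- The action on the Stiefel bundle is faithful. -/
theorem StiefelBundle.faithful_of_vec_eq [NormedSpace ℂ F] [IsScalarTower ℝ ℂ F]
    [VectorBundle ℂ F E] [FiniteDimensional ℂ F] [NeZero k]
    (hr : Module.finrank ℂ F = k + r) {m : ℕ}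
    [ChartedSpace (EuclideanSpace ℝ (Fin m)) (StiefelBundle h k)]
    {α : FibreBundleAction d m ε (StiefelBundle.base : StiefelBundle h k → X)}
    (hρ : ∀ g e i, ((α.ρ g).1 e).vec i = (β.ρ g).1 (e.vec i))
    (hτ : ∀ a, (α.τ a).1 = (β.τ a).1) (hβ : β.Faithful) : α.Faithful := by
  refine α.faithful_of_injective (fun g hg => ?_) (ExtensionAction.injective_of_eq hτ hβ.2.2)
  refine VectorBundleAction.eq_one_of_apply_eq hβ fun x v => ?_
  obtain ⟨e, c, he⟩ := StiefelBundle.exists_smul_frame_zero (k := k) hr h x v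
  rw [he]
  refine VectorBundleAction.apply_smul β g ?_ c
  have := hρ g e 0
  rw [hg e] at this
  exact this.symm

end Faithfulness

/-! ### The sum with the trivial line bundle and faithfulness on Grassmann bundles. -/

section SumWithTrivialLine

variable {d : ℕ} {X : Type*} [TopologicalSpace X] [ChartedSpace (EuclideanSpace ℝ (Fin d)) X]
  {F : Type*} [NormedAddCommGroup F] [NormedSpace ℝ F]
  {E : X → Type*} [∀ x, AddCommGroup (E x)] [∀ x, Module ℂ (E x)]
  [TopologicalSpace (TotalSpace F E)] [∀ x, TopologicalSpace (E x)] [FiberBundle F E]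
  {C G M : Type*} [Group C] [Group G] [Group M] {ε : GroupExtension C G M}

theorem sumTrivialLine_mk (φ : vectorBundleDiff d F E) (x : X) (v : E x) (c : ℂ) :
    sumTrivialLine φ.1 (⟨x, (v, c)⟩ : TotalSpace (F × ℂ) (E ×ᵇ Trivial X ℂ)) =
      ⟨vectorBundleDiff.fibreBase φ x, (vectorBundleDiff.fibreMap φ x v, c)⟩ := by
  simp only [sumTrivialLine]
  rw [vectorBundleDiff.apply_mk]

theorem contMDiff_sumTrivialLine {φ : TotalSpace F E → TotalSpace F E}
    (hφ : ContMDiff ((𝓡 d).prod 𝓘(ℝ, F)) ((𝓡 d).prod 𝓘(ℝ, F)) ∞ φ) :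
    ContMDiff ((𝓡 d).prod 𝓘(ℝ, F × ℂ)) ((𝓡 d).prod 𝓘(ℝ, F × ℂ)) ∞ (sumTrivialLine φ) := by
  have hsec : SmoothSec d (F × ℂ) ((𝓡 d).prod 𝓘(ℝ, F × ℂ)) (E := E ×ᵇ Trivial X ℂ)
      (fun z : TotalSpace (F × ℂ) (E ×ᵇ Trivial X ℂ) => z.1) (fun z => z.2) Set.univ :=
    contMDiffOn_id
  have h1 : SmoothSec d F ((𝓡 d).prod 𝓘(ℝ, F × ℂ)) (E := E)
      (fun z : TotalSpace (F × ℂ) (E ×ᵇ Trivial X ℂ) => (φ ⟨z.1, z.2.1⟩).1)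
      (fun z => (φ ⟨z.1, z.2.1⟩).2) Set.univ := hφ.comp_contMDiffOn hsec.fst
  have h2 := (smoothSec_trivial_iff.1 hsec.snd).2
  exact contMDiffOn_univ.1 (h1.pair (smoothSec_trivial_iff.2 ⟨h1.base, h2⟩))

/-- The direct sum of an action and of the action on the trivial line bundle. -/
theorem VectorBundleAction.exists_sumTrivialLine (β : VectorBundleAction d F E ε) :
    ∃ β₁ : VectorBundleAction d (F × ℂ) (E ×ᵇ Trivial X ℂ) ε,
      (∀ g, ⇑(β₁.ρ g).1 = sumTrivialLine (β.ρ g).1) ∧ ∀ a, (β₁.τ a).1 = (β.τ a).1 := by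
  refine ExtensionAction.exists_of_contMDiff β (fun g => sumTrivialLine (β.ρ g).1)
    (fun z => ?_) (fun g g' z => ?_)
    (fun g => contMDiff_sumTrivialLine (vectorBundleDiff.contMDiff (β.ρ g)))
    (fun g z => β.comm_base g _) (fun φ hφ hg => ⟨hφ, fun x => ?_⟩)
  · have h1 : ⇑(β.ρ 1).1 = id := funext β.one_apply
    simp only [h1]
    rfl
  · have h1 : ⇑(β.ρ (g * g')).1 = (β.ρ g).1 ∘ (β.ρ g').1 := funext (β.mul_apply g g')
    simp only [h1]
    rfl
  · obtain ⟨g, hg⟩ := hg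
    refine ⟨vectorBundleDiff.fibreBase (β.ρ g) x,
      (vectorBundleDiff.fibreMap (β.ρ g) x).prodMap LinearMap.id, fun v => ?_⟩
    rw [hg]
    exact sumTrivialLine_mk (β.ρ g) x v.1 v.2

section Grassmann

variable [NormedSpace ℂ F] [IsScalarTower ℝ ℂ F] [VectorBundle ℂ F E] [FiniteDimensional ℂ F]
  {β : VectorBundleAction d F E ε} {β₁ : VectorBundleAction d (F × ℂ) (E ×ᵇ Trivial X ℂ) ε}
  {h₁ : HermitianMetric d (F × ℂ) (E ×ᵇ Trivial X ℂ)} {k r : ℕ} [NeZero k] {n : ℕ}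
  [ChartedSpace (EuclideanSpace ℝ (Fin n)) (GrassmannBundle h₁ k)]
  {α : FibreBundleAction d n ε (GrassmannBundle.base : GrassmannBundle h₁ k → X)}

/-- The action on the Grassmann bundle of proper subspaces is faithful. -/
theorem GrassmannBundle.faithful_of_lt (hr : Module.finrank ℂ F = k + r)
    (hβ₁ : ∀ g, ⇑(β₁.ρ g).1 = sumTrivialLine (β.ρ g).1)
    (hρ : ∀ g W, ((α.ρ g).1 W).vectors = (β₁.ρ g).1 '' W.vectors)
    (hτ : ∀ a, (α.τ a).1 = (β.τ a).1) (hβ : β.Faithful) : α.Faithful := by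
  refine α.faithful_of_injective (fun g hg => ?_) (ExtensionAction.injective_of_eq hτ hβ.2.2)
  refine VectorBundleAction.eq_one_of_apply_eq hβ fun x v => ?_
  -- The vector `(v, 1)` is nonzero for every `v`, and each subspace containing it also contains its
  -- image. So the image is a multiple of it, and the preserved second coordinate forces the factor
  -- 1.
  obtain ⟨c, hc⟩ := GrassmannBundle.exists_eq_smul (k := k) (r := r)
    (by simp [hr, add_assoc]) h₁ (x := x) (v := ((v, 1) : E x × ℂ))
    (fun h0 => one_ne_zero (congrArg Prod.snd h0)) ((β₁.ρ g).1 ⟨x, ((v, 1) : E x × ℂ)⟩)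
    fun W hW => by
      rw [← hg W, hρ]
      exact Set.mem_image_of_mem _ hW
  rw [hβ₁, sumTrivialLine_mk] at hc
  rw [vectorBundleDiff.apply_mk]
  generalize vectorBundleDiff.fibreMap (β.ρ g) x v = w at hc ⊢
  generalize vectorBundleDiff.fibreBase (β.ρ g) x = y at w hc ⊢
  obtain rfl : y = x := congrArg TotalSpace.proj hc
  rw [TotalSpace.mk_inj] at hc
  have h1 : w = c • v := congrArg Prod.fst hc
  have h2 : (1 : ℂ) = c • 1 := congrArg Prod.snd hc
  obtain rfl : c = 1 := by simpa using h2.symm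
  rw [h1, one_smul]

/-- The whole fibre is its only subspace of maximal dimension. -/
theorem GrassmannBundle.eq_of_base_eq {F : Type*} [NormedAddCommGroup F] [NormedSpace ℝ F]
    {E : X → Type*} [∀ x, AddCommGroup (E x)] [∀ x, Module ℂ (E x)]
    [TopologicalSpace (TotalSpace F E)] [∀ x, TopologicalSpace (E x)] [FiberBundle F E]
    [NormedSpace ℂ F] [IsScalarTower ℝ ℂ F] [VectorBundle ℂ F E] [FiniteDimensional ℂ F]
    {h : HermitianMetric d F E} (hk : Module.finrank ℂ F = k) {W W' : GrassmannBundle h k}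
    (hW : W.base = W'.base) : W = W' := by
  have htop : ∀ W : GrassmannBundle h k, W.space = ⊤ := fun W => by
    have := finiteDimensional_fibre (F := F) (E := E) W.base
    exact Submodule.eq_top_of_finrank_eq
      (W.finrank_eq.trans (hk.symm.trans (finrank_fibre F E W.base).symm))
  have h1 := htop W
  have h2 := htop W'
  obtain ⟨x, S, hS⟩ := W
  obtain ⟨x', S', hS'⟩ := W'
  obtain rfl : x = x' := hW
  obtain rfl : S = ⊤ := h1
  obtain rfl : S' = ⊤ := h2
  rfl

/-- The action on the bundle of the full fibres is faithful if and only if `C` is trivial. -/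
theorem GrassmannBundle.faithful_iff_of_eq (hk : Module.finrank ℂ (F × ℂ) = k)
    (hτ : ∀ a, (α.τ a).1 = (β.τ a).1) (hβ : β.Faithful) : α.Faithful ↔ Subsingleton C := by
  constructor
  · intro hα
    -- Elements of `C` cover the identity, and in maximal dimension a subspace is determined by its
    -- base point, so they act trivially.
    refine subsingleton_of_forall_eq 1 fun c => ε.inl_injective (hα.2.1 ?_)
    rw [map_one, map_one]
    refine Subtype.ext (Equiv.ext fun W => GrassmannBundle.eq_of_base_eq hk ?_)
    rw [α.comm_base, ε.rightHom_inl, map_one]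
    rfl
  · intro hC
    refine α.faithful_of_injective (fun g hg => ?_) (ExtensionAction.injective_of_eq hτ hβ.2.2)
    -- Every point of `X` is the base point of some subspace, so an element acting trivially acts
    -- trivially on `X`; as `τ` is injective, it comes from `C`.
    have h1 : ε.rightHom g = 1 := hβ.2.2 <| by
      rw [map_one]
      refine Subtype.ext (Equiv.ext fun x => ?_)
      obtain ⟨W, rfl⟩ := GrassmannBundle.exists_base_eq (k := k) (r := 0) hk h₁ x
      rw [← hτ, ← α.comm_base, hg]
      rfl
    obtain ⟨c, rfl⟩ : g ∈ ε.inl.range := by rwa [ε.range_inl_eq_ker_rightHom]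
    rw [Subsingleton.elim c 1, map_one]

end Grassmann

end SumWithTrivialLine

/-! ### The compactification proposition. -/

theorem mainTheorem5
    {C G M : Type*} [Group C] [Group G] [Group M] [Finite C] [Finite G] [Finite M]
    (ε : GroupExtension C G M)
    {d t : ℕ} {X : Type*} [TopologicalSpace X] [T2Space X] [SecondCountableTopology X]
    [ChartedSpace (EuclideanSpace ℝ (Fin d)) X] [IsManifold (𝓡 d) ∞ X]
    (E : X → Type*) [∀ x, AddCommGroup (E x)] [∀ x, Module ℂ (E x)]
    [TopologicalSpace (TotalSpace (EuclideanSpace ℂ (Fin t)) E)] [∀ x, TopologicalSpace (E x)]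
    [FiberBundle (EuclideanSpace ℂ (Fin t)) E]
    [VectorBundle ℂ (EuclideanSpace ℂ (Fin t)) E] [VectorBundle ℝ (EuclideanSpace ℂ (Fin t)) E]
    [ContMDiffVectorBundle ∞ (EuclideanSpace ℂ (Fin t)) E (𝓡 d)]
    (β : VectorBundleAction d (EuclideanSpace ℂ (Fin t)) E ε) (hβ : β.Faithful) :
    -- Stiefel bundles of `p`
    ((∃ h : HermitianMetric d (EuclideanSpace ℂ (Fin t)) E, h.IsInvariant β) ∧
      ∀ h : HermitianMetric d (EuclideanSpace ℂ (Fin t)) E, h.IsInvariant β →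
      ∀ k m : ℕ, 1 ≤ k → k ≤ t → m = d + k * (2 * t - k) →
      ∃ _ : ChartedSpace (EuclideanSpace ℝ (Fin m)) (StiefelBundle h k),
        IsStiefelManifold m h k ∧
        IsSmoothFibreBundle m d (StiefelBundle.base : StiefelBundle h k → X) ∧
        ∃ α : FibreBundleAction d m ε (StiefelBundle.base : StiefelBundle h k → X),
          α.Faithful ∧
          (∀ g e i, ((α.ρ g).1 e).vec i = (β.ρ g).1 (e.vec i)) ∧
          (∀ a, (α.τ a).1 = (β.τ a).1)) ∧
    -- Grassmann bundles of the direct sum of `p` and the trivial line bundle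
    ∃ β₁ : VectorBundleAction d (EuclideanSpace ℂ (Fin t) × ℂ) (E ×ᵇ Trivial X ℂ) ε,
      (∀ g, ⇑(β₁.ρ g).1 = sumTrivialLine (β.ρ g).1) ∧
      (∀ a, (β₁.τ a).1 = (β.τ a).1) ∧
      (∃ h₁ : HermitianMetric d (EuclideanSpace ℂ (Fin t) × ℂ) (E ×ᵇ Trivial X ℂ),
        h₁.IsInvariant β₁) ∧
      ∀ h₁ : HermitianMetric d (EuclideanSpace ℂ (Fin t) × ℂ) (E ×ᵇ Trivial X ℂ),
      ∀ k m n : ℕ, 1 ≤ k → k ≤ t + 1 →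
      m = d + k * (2 * (t + 1) - k) → n = d + 2 * (k * (t + 1 - k)) →
      ∃ (_ : ChartedSpace (EuclideanSpace ℝ (Fin m)) (StiefelBundle h₁ k))
        (_ : ChartedSpace (EuclideanSpace ℝ (Fin n)) (GrassmannBundle h₁ k)),
        IsStiefelManifold m h₁ k ∧ IsGrassmannManifold m n h₁ k ∧
        IsSmoothFibreBundle n d (GrassmannBundle.base : GrassmannBundle h₁ k → X) ∧
        ∃ α : FibreBundleAction d n ε (GrassmannBundle.base : GrassmannBundle h₁ k → X),
          (k ≤ t → α.Faithful) ∧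
          (k = t + 1 → (α.Faithful ↔ Subsingleton C)) ∧
          (∀ g W, ((α.ρ g).1 W).vectors = (β₁.ρ g).1 '' W.vectors) ∧
          (∀ a, (α.τ a).1 = (β.τ a).1) := by
  have hF : Module.finrank ℂ (EuclideanSpace ℂ (Fin t)) = t := by simp
  have hF₁ : Module.finrank ℂ (EuclideanSpace ℂ (Fin t) × ℂ) = t + 1 := by simp
  let : ∀ x, Module ℝ (E x) := fun x => inferInstance
  refine ⟨⟨?_, fun h hinv k m hk hkt hm => ?_⟩, ?_⟩
  · obtain ⟨h⟩ := HermitianMetric.nonempty (d := d) (EuclideanSpace ℂ (Fin t)) E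
    exact h.exists_isInvariant β
  · have : NeZero k := ⟨by omega⟩
    -- With `t = k + r` the truncated difference `2 * t - k` becomes `k + 2 * r`, the factor in the
    -- dimension of the Cayley parameters.
    obtain ⟨r, rfl⟩ := Nat.exists_eq_add_of_le hkt
    obtain ⟨cs, ha⟩ := StiefelBundle.exists_isAdapted (k := k) (r := r) h hF
      (hm.trans (by congr 2; omega))
    obtain ⟨α, h1, h2⟩ := ha.exists_action hF hinv
    exact ⟨cs, ha.isStiefelManifold hF, StiefelBundle.isSmoothFibreBundle ha hF, α,
      StiefelBundle.faithful_of_vec_eq hF h1 h2 hβ, h1, h2⟩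
  · obtain ⟨β₁, hβ₁, hτ₁⟩ := β.exists_sumTrivialLine
    refine ⟨β₁, hβ₁, hτ₁, ?_, fun h₁ k m n hk hkt hm hn => ?_⟩
    · obtain ⟨h⟩ := HermitianMetric.nonempty (d := d) (EuclideanSpace ℂ (Fin t) × ℂ)
        (E ×ᵇ Trivial X ℂ)
      exact h.exists_isInvariant β₁
    · have : NeZero k := ⟨by omega⟩
      obtain ⟨r, hr⟩ := Nat.exists_eq_add_of_le hkt
      have hr₁ := hF₁.trans hr
      obtain ⟨cs, hs⟩ := StiefelBundle.exists_isAdapted (k := k) (r := r) h₁ hr₁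
        (hm.trans (by congr 2; omega))
      obtain ⟨cg, hg⟩ := GrassmannBundle.exists_isAdapted (k := k) (r := r) h₁ hr₁
        (hn.trans (by congr 3; omega))
      obtain ⟨α, h1, h2⟩ := hg.exists_action hr₁ β₁
      have h2' : ∀ a, (α.τ a).1 = (β.τ a).1 := fun a => (h2 a).trans (hτ₁ a)
      refine ⟨cs, cg, hs.isStiefelManifold hr₁, hg.isGrassmannManifold hs hr₁,
        GrassmannBundle.isSmoothFibreBundle hg hr₁, α, fun hk' => ?_, fun hk' => ?_, h1, h2'⟩
      -- Here the codimension is counted in `E`, not in the sum with the line bundle, so it is one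
      -- less than the `r` above.
      · exact GrassmannBundle.faithful_of_lt (r := t - k) (hF.trans (by omega)) hβ₁ h1 h2' hβ
      · exact GrassmannBundle.faithful_iff_of_eq (hF₁.trans hk'.symm) h2' hβ
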